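/- **Setting.** Let $d\ge 1$, $S\ge 2$, let $U\subset\mathbb R^d$ be a non-empty bounded open convex set and let $f_1,\dots,f_S:\overline U\to U$ be continuous maps that are injective and conformal on $U$: $f_i$ is $C^1$ on $U$, $|f_i'(x)y|=|f_i'(x)||y|\neq 0$ for all $x\in U$, $y\ne 0$, and $f_i'$ is Hölder continuous on $U$; assume also $\sup_{x\in U}|f_i'(x)|<1$. Let $\Lambda$ be the unique non-empty compact subset of $\overline U$ with $\Lambda=\bigcup_i f_i(\Lambda)$. Assume the open set condition: there is a non-empty open $O\subset U$ with $f_i(O)\subset O$ for all $i$ and $f_i(O)\cap f_j(O)=\emptyset$ for $i\neq j$. For a finite word $w=i_1\cdots i_n$ put $f_w=f_{i_1}\circ\cdots\circ f_{i_n}$ and $\|f_w'\|=\sup_{x\in U}|f_w'(x)|$. Let $\Sigma=\{1,\dots,S\}$, let $\sigma$ be the left shift on $\Sigma^{\mathbb N}$, and let $\pi:\Sigma^{\mathbb N}\to\Lambda$ be the coding map, $\{\pi(\mathbf i)\}=\bigcap_n f_{i_1\cdots i_n}(\Lambda)$. Write $\mathbf t|_m^n=t_m\cdots t_n$. For $\mathbf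 t\in\Sigma^{\mathbb N}$ and a sequence $(a_n)$ of natural numbers let $$R_e((a_n),\mathbf t)=\{\mathbf e\in\Sigma^{\mathbb N}:\ \exists N\ \forall n\ge N\ \exists m\le n:\ \sigma^m\mathbf e\text{ and }\mathbf t\text{ have the same first }a_n\text{ digits}\}.$$ Let $G$ be the set of all $\mathbf t$ for which there is $N$ such that for all $n>N$, all $1\le m<n$ and all $j\in\Sigma$ with $j\ne t_n$, $\ \mathbf t(n,j)|_m^n\neq\mathbf t|_1^{n-m+1}$, where $\mathbf t(n,j)$ is $\mathbf t$ with its $n$-th digit replaced by $j$. For $v\in(0,1)$, $\theta>1$ and $M\in\mathbb N$ with $vM\ge 1$, let $p$ be the largest natural number with $vM/\theta^p\ge1$, let $G(M,\mathbf t,\theta,v)$ be the concatenation of the prefixes of $\mathbf t$ of lengths $\lfloor vM/\theta^p\rfloor,\lfloor vM/\theta^{p-1}\rfloor,\dots,\lfloor vM/\theta\rfloor,\lfloor vM\rfloor,\lfloor\theta vM\rfloor$, and let $\Omega^+(\mathbf t,\theta,v)$ and $\Omega^-(\mathbf t,\theta,v)$ be the $\limsup$ and the $\liminf$ of $\frac1M\log\|f'_{G(M,\mathbf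 t,\theta,v)}\|$ as $M\to\infty$. Let $P(s)=\lim_{n\to\infty}\frac1n\log\sum_{w\in\Sigma^n}\|f_w'\|^s$ for $s\ge0$. For $\theta>\frac1{1-v}$ let $s^\pm(\mathbf t,v,\theta)\geq 0$ be the solution $s$ of the pressure equation $$P(s)=-s\,\frac{\theta-1}{\theta-\theta v-1}\,\Omega^\pm(\mathbf t,\theta,v),$$ and put $\omega^\pm(\mathbf t,0)=\dim_H\Lambda$, $\ \omega^\pm(\mathbf t,1)=0$, and $\omega^\pm(\mathbf t,v)=\min\{\sup_{\theta>1/(1-v)}s^\pm(\mathbf t,v,\theta),\ \dim_H\Lambda\}$ for $v\in(0,1)$. **Theorem.** Let $\mathbf t\in G$. The limit $P(s)$ exists for every $s\ge0$; for all $v\in(0,1)$ and $\theta>\frac1{1-v}$ the quantities $\Omega^\pm(\mathbf t,\theta,v)$ are finite and each of the two pressure equations has exactly one solution $s\ge0$. Let $(a_n)$ be a sequence of natural numbers with $a_n/n\to v\in[0,\infty]$. 1. If $v\in[0,1]$, then $\omega^-(\mathbf t,v)\le\dim_H\pi(R_e((a_n),\mathbf t))\le\omega^+(\mathbf t,v)$.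 2. If $v\in(1,\infty)$, then $R_e((a_n),\mathbf t)=\{\mathbf e\in\Sigma^{\mathbb N}:\ \sigma^k\mathbf e=\mathbf t\text{ for some }k\ge0\}$, that is, apart from the countably many sequences that end in $\mathbf t$ (which lie in $R_e((a_n),\mathbf t)$ for trivial reasons) the eventually always hitting set is empty. 3. If $v=\infty$, then $R_e((a_n),\mathbf t)$ is countable. In particular, if $v\in[0,1]$ and, in case $v\in(0,1)$, $\Omega^+(\mathbf t,\theta,v)=\Omega^-(\mathbf t,\theta,v)$ for all $\theta>\frac1{1-v}$, then $\omega^+(\mathbf t,v)=\omega^-(\mathbf t,v)$ and $\dim_H\pi(R_e((a_n),\mathbf t))=\omega^+(\mathbf t,v)=\omega^-(\mathbf t,v)$. -/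

import Mathlib

open Set Filter Topology
open scoped ENNReal NNReal

noncomputable section

/-! ### Symbolic space -/

/-- The left shift on one-sided sequences. -/
def shift {S : ℕ} (e : ℕ → Fin S) : ℕ → Fin S := fun n => e (n + 1)

/-- The finite word consisting of the first `n` digits of `t`. -/
def firstDigits {S : ℕ} (t : ℕ → Fin S) (n : ℕ) : List (Fin S) := (List.range n).map t

/-- The eventually always hitting set of a map `T` for a sequence `B` of targets. -/
def eventuallyAlwaysHitting {X : Type*} (T : X → X) (B : ℕ → Set X) : Set X :=
  {x | ∃ N : ℕ, ∀ n ≥ N, ∃ m ≤ n, T^[m] x ∈ B n}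

/-- The eventually always hitting set of the shift, the `n`-th target being the cylinder of
all sequences that share the first `a n` digits of `t`. -/
def hittingSet {S : ℕ} (a : ℕ → ℕ) (t : ℕ → Fin S) : Set (ℕ → Fin S) :=
  eventuallyAlwaysHitting shift (fun n => PiNat.cylinder t (a n))

/-- The sequences of the form `j t` with `j` a finite word. -/
def preOrbit {S : ℕ} (t : ℕ → Fin S) : Set (ℕ → Fin S) := {e | ∃ k : ℕ, shift^[k] e = t}

/-- The set `G` of admissible targets.  Positions are counted from `0`: the digit at position
`n` is replaced by `j`, and the block at the positions `m, …, n` of the modified sequence must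
not be a prefix of `t`. -/
def admissibleTargets (S : ℕ) : Set (ℕ → Fin S) :=
  {t | ∃ N : ℕ, ∀ n ≥ N, ∀ m < n, ∀ j : Fin S, j ≠ t n →
    ¬ ∀ k ≤ n - m, Function.update t n j (m + k) = t k}

/-- The concatenation of the prefixes of `t` of lengths
`⌊vM/θ^p⌋, ⌊vM/θ^(p-1)⌋, …, ⌊vM/θ⌋, ⌊vM⌋, ⌊θvM⌋`, where `p` is the largest natural number
with `vM/θ^p ≥ 1`. -/
def targetWord {S : ℕ} (t : ℕ → Fin S) (θ v : ℝ) (M : ℕ) : List (Fin S) :=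
  ((List.range (sSup {p : ℕ | 1 ≤ v * M / θ ^ p} + 1)).reverse.map
      (fun j => firstDigits t ⌊v * M / θ ^ j⌋₊)).flatten
    ++ firstDigits t ⌊θ * v * M⌋₊

/-! ### Conformal iterated function systems -/

/-- `g` is conformal on `W`: it is `C¹`, its differential is everywhere a similarity, and the
differential is Hölder continuous. -/
structure IsConformalOn {d : ℕ} (g : EuclideanSpace ℝ (Fin d) → EuclideanSpace ℝ (Fin d))
    (W : Set (EuclideanSpace ℝ (Fin d))) : Prop where
  contDiffOn : ContDiffOn ℝ 1 g W
  similarity : ∀ x ∈ W, ∀ y, y ≠ 0 →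
    ‖fderiv ℝ g x y‖ = ‖fderiv ℝ g x‖ * ‖y‖ ∧ fderiv ℝ g x y ≠ 0
  holder : ∃ α > (0 : ℝ), ∃ c > (0 : ℝ), ∀ x ∈ W, ∀ y ∈ W,
    ‖fderiv ℝ g x - fderiv ℝ g y‖ ≤ c * ‖x - y‖ ^ α

/-- A conformal iterated function system of `S ≥ 2` maps on a bounded open convex set `U` of
`ℝ^d`.  Only the values of the maps on the closure of `U` matter. -/
structure ConformalIFS (d S : ℕ) where
  two_le : 2 ≤ S
  U : Set (EuclideanSpace ℝ (Fin d))
  isOpen_U : IsOpen U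
  isBounded_U : Bornology.IsBounded U
  convex_U : Convex ℝ U
  nonempty_U : U.Nonempty
  f : Fin S → EuclideanSpace ℝ (Fin d) → EuclideanSpace ℝ (Fin d)
  continuousOn : ∀ i, ContinuousOn (f i) (closure U)
  conformal : ∀ i, IsConformalOn (f i) U
  injOn : ∀ i, InjOn (f i) U
  mapsTo : ∀ i, MapsTo (f i) (closure U) U
  /-- `sup_{x ∈ U} |f_i'(x)| < 1`. -/
  contracting : ∀ i, ∃ r < (1 : ℝ), ∀ x ∈ U, ‖fderiv ℝ (f i) x‖ ≤ r

namespace ConformalIFS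

variable {d S : ℕ} (F : ConformalIFS d S)

/-- The open set condition. -/
def OpenSetCondition : Prop :=
  ∃ O : Set (EuclideanSpace ℝ (Fin d)), IsOpen O ∧ O.Nonempty ∧ O ⊆ F.U ∧
    (∀ i, F.f i '' O ⊆ O) ∧ ∀ i j, i ≠ j → Disjoint (F.f i '' O) (F.f j '' O)

/-- The composition `f_{i_1} ∘ ⋯ ∘ f_{i_n}` along a finite word. -/
def wordMap : List (Fin S) → EuclideanSpace ℝ (Fin d) → EuclideanSpace ℝ (Fin d)
  | [] => id
  | i :: w => F.f i ∘ wordMap w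

/-- `‖f_w'‖ = sup_{x ∈ U} |f_w'(x)|`. -/
def derivNorm (w : List (Fin S)) : ℝ := ⨆ x : F.U, ‖fderiv ℝ (F.wordMap w) x‖

/-- `Λ` is a non-empty compact set with `Λ = ⋃ i, f_i(Λ)`. -/
structure IsAttractor (Λ : Set (EuclideanSpace ℝ (Fin d))) : Prop where
  subset : Λ ⊆ closure F.U
  nonempty : Λ.Nonempty
  isCompact : IsCompact Λ
  invariant : Λ = ⋃ i, F.f i '' Λ

theorem exists_ratio : ∃ r : ℝ≥0, r < 1 ∧ ∀ i, LipschitzOnWith r (F.f i) (closure F.U) := by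
  choose r hr hb using F.contracting
  have hS : 0 < S := by have := F.two_le; omega
  have : Nonempty (Fin S) := ⟨⟨0, hS⟩⟩
  refine ⟨Finset.univ.sup' Finset.univ_nonempty fun i => (r i).toNNReal, ?_, fun i => ?_⟩
  · rw [Finset.sup'_lt_iff]
    intro i _
    exact Real.toNNReal_lt_one.2 (hr i)
  · refine LipschitzOnWith.closure (F.continuousOn i) ?_
    refine F.convex_U.lipschitzOnWith_of_nnnorm_fderiv_le (𝕜 := ℝ) (fun x hx => ?_)
      (fun x hx => ?_)
    · exact ((F.conformal i).contDiffOn.differentiableOn (by norm_num)).differentiableAt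
        (F.isOpen_U.mem_nhds hx)
    · refine le_trans ?_ (Finset.le_sup' (fun i => (r i).toNNReal) (Finset.mem_univ i))
      exact NNReal.le_toNNReal_of_coe_le (hb i x hx)

theorem isCompact_closure_U : IsCompact (closure F.U) :=
  F.isBounded_U.isCompact_closure

theorem mapsTo_word (w : List (Fin S)) : MapsTo (F.wordMap w) (closure F.U) (closure F.U) := by
  induction w with
  | nil => exact fun x hx => hx
  | cons i w ih => exact fun x hx => subset_closure (F.mapsTo i (ih hx))

theorem lipschitz_word {r : ℝ≥0} (hr : ∀ i, LipschitzOnWith r (F.f i) (closure F.U))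
    (w : List (Fin S)) : LipschitzOnWith (r ^ w.length) (F.wordMap w) (closure F.U) := by
  induction w with
  | nil => simpa [wordMap] using (LipschitzWith.id.lipschitzOnWith (s := closure F.U))
  | cons i w ih =>
    have h := (hr i).comp ih (F.mapsTo_word w)
    rw [List.length_cons, pow_succ']
    exact h

theorem word_succ (i : ℕ → Fin S) (n : ℕ) :
    F.wordMap (firstDigits i (n + 1)) = F.f (i 0) ∘ F.wordMap (firstDigits (shift i) n) := by
  simp only [firstDigits, List.range_succ_eq_map, List.map_cons, List.map_map, wordMap]
  rfl

theorem wordMap_append (u w : List (Fin S)) :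
    F.wordMap (u ++ w) = F.wordMap u ∘ F.wordMap w := by
  induction u with
  | nil => rfl
  | cons i u ih => simp [wordMap, ih, Function.comp_assoc]

theorem word_succ' (i : ℕ → Fin S) (n : ℕ) :
    F.wordMap (firstDigits i (n + 1)) = F.wordMap (firstDigits i n) ∘ F.f (i n) := by
  simp [firstDigits, List.range_succ, wordMap_append, wordMap]

/-- Two points in the same image of the closure of `U` under `f_{i_1} ∘ ⋯ ∘ f_{i_n}` are
exponentially close. -/
theorem exists_dist_word : ∃ u : ℕ → ℝ, Tendsto u atTop (𝓝 0) ∧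
    ∀ (i : ℕ → Fin S) (n : ℕ), ∀ x ∈ F.wordMap (firstDigits i n) '' closure F.U,
      ∀ y ∈ F.wordMap (firstDigits i n) '' closure F.U, dist x y ≤ u n := by
  obtain ⟨r, hr1, hr⟩ := F.exists_ratio
  refine ⟨fun n => (r : ℝ) ^ n * Metric.diam (closure F.U), ?_, ?_⟩
  · simpa using (tendsto_pow_atTop_nhds_zero_of_lt_one r.coe_nonneg
      (by exact_mod_cast hr1)).mul_const (Metric.diam (closure F.U))
  · rintro i n _ ⟨x, hx, rfl⟩ _ ⟨y, hy, rfl⟩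
    have h := (F.lipschitz_word hr (firstDigits i n)).dist_le_mul x hx y hy
    simp only [firstDigits, List.length_map, List.length_range, NNReal.coe_pow] at h ⊢
    refine h.trans ?_
    gcongr
    exact Metric.dist_le_diam_of_mem F.isCompact_closure_U.isBounded hx hy

/-- For a non-empty compact set that the maps leave invariant, nested images along a sequence
shrink to exactly one point. -/
theorem existsUnique_point {K : Set (EuclideanSpace ℝ (Fin d))} (hK : IsCompact K)
    (hne : K.Nonempty) (hKU : K ⊆ closure F.U) (hinv : ∀ i, F.f i '' K ⊆ K) (i : ℕ → Fin S) :
    ∃! x, ∀ n, x ∈ F.wordMap (firstDigits i n) '' K := by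
  obtain ⟨r, hr1, hr⟩ := F.exists_ratio
  have hcpt : ∀ n, IsCompact (F.wordMap (firstDigits i n) '' K) := fun n =>
    hK.image_of_continuousOn ((F.lipschitz_word hr _).continuousOn.mono hKU)
  obtain ⟨x, hx⟩ := IsCompact.nonempty_iInter_of_sequence_nonempty_isCompact_isClosed
    (fun n => F.wordMap (firstDigits i n) '' K)
    (fun n => by
      rw [F.word_succ', image_comp]
      exact image_mono (hinv _))
    (fun n => hne.image _) (hcpt 0) (fun n => (hcpt n).isClosed)
  rw [mem_iInter] at hx
  refine ⟨x, hx, fun y hy => ?_⟩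
  obtain ⟨u, hu, hd⟩ := F.exists_dist_word
  refine dist_le_zero.1 (ge_of_tendsto' hu fun n => ?_)
  exact hd i n y (image_mono hKU (hy n)) x (image_mono hKU (hx n))

/-- Hutchinson's theorem. -/
theorem existsUnique_attractor : ∃! Λ, F.IsAttractor Λ := by
  have hex := F.existsUnique_point F.isCompact_closure_U F.nonempty_U.closure subset_rfl
    (fun i => ((F.mapsTo i).mono_right subset_closure).image_subset)
  choose p hp hu using hex
  simp only at hp hu
  obtain ⟨u, hu0, hd⟩ := F.exists_dist_word
  have hcont : Continuous p := by
    rw [continuous_iff_continuousAt]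
    intro i
    rw [ContinuousAt, tendsto_iff_dist_tendsto_zero, Metric.tendsto_nhds]
    intro ε hε
    obtain ⟨n, hn⟩ := ((tendsto_order.1 hu0).2 ε hε).exists
    have hmem : PiNat.cylinder i n ∈ 𝓝 i :=
      (PiNat.isOpen_cylinder (fun _ : ℕ => Fin S) i n).mem_nhds (PiNat.self_mem_cylinder i n)
    filter_upwards [hmem] with j hj
    have hij : firstDigits j n = firstDigits i n := by
      refine List.map_congr_left fun k hk => hj k (List.mem_range.1 hk)
    have := hd i n (p j) (hij ▸ hp j n) (p i) (hp i n)
    rw [Real.dist_0_eq_abs, abs_of_nonneg dist_nonneg]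
    exact this.trans_lt hn
  have hcode : ∀ i, p i = F.f (i 0) (p (shift i)) := by
    intro i
    refine (hu i _ fun n => ?_).symm
    cases n with
    | zero =>
      have h0 := hp (shift i) 0
      have h1 : p (shift i) ∈ closure F.U := by simpa [firstDigits, wordMap] using h0
      exact ⟨_, subset_closure (F.mapsTo (i 0) h1), rfl⟩
    | succ n =>
      rw [F.word_succ, image_comp]
      exact mem_image_of_mem _ (hp (shift i) n)
  have hS : 0 < S := by have := F.two_le; omega
  refine ⟨range p, ⟨?_, ⟨p fun _ => ⟨0, hS⟩, mem_range_self _⟩, isCompact_range hcont, ?_⟩, ?_⟩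
  · rintro _ ⟨i, rfl⟩
    simpa [firstDigits, wordMap] using hp i 0
  · ext x
    simp only [mem_iUnion, mem_image, mem_range]
    constructor
    · rintro ⟨i, rfl⟩
      exact ⟨i 0, p (shift i), ⟨shift i, rfl⟩, (hcode i).symm⟩
    · rintro ⟨a, _, ⟨i, rfl⟩, rfl⟩
      refine ⟨fun n => Nat.casesOn n a i, ?_⟩
      rw [hcode]
      rfl
  · intro A hA
    have hinv : ∀ i, F.f i '' A ⊆ A := fun i => by
      conv_rhs => rw [hA.invariant]
      exact subset_iUnion (fun i => F.f i '' A) i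
    refine Subset.antisymm (fun x hx => ?_) ?_
    · have hstep : ∀ y : A, ∃ (a : Fin S) (z : A), F.f a z = y := by
        rintro ⟨y, hy⟩
        rw [hA.invariant] at hy
        obtain ⟨a, z, hz, h⟩ := mem_iUnion.1 hy
        exact ⟨a, ⟨z, hz⟩, h⟩
      choose a b hab using hstep
      refine ⟨fun n => a (b^[n] ⟨x, hx⟩), (hu _ x fun n => ?_).symm⟩
      suffices H : ∀ n (y : A), F.wordMap (firstDigits (fun n => a (b^[n] y)) n) (b^[n] y) = y from
        ⟨_, hA.subset (b^[n] ⟨x, hx⟩).2, H n ⟨x, hx⟩⟩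
      intro n
      induction n with
      | zero => intro y; rfl
      | succ n ih =>
        intro y
        rw [F.word_succ]
        exact (congrArg _ (ih (b y))).trans (hab y)
    · rintro _ ⟨i, rfl⟩
      obtain ⟨y, hy, -⟩ := F.existsUnique_point hA.isCompact hA.nonempty hA.subset hinv i
      have : y = p i := hu i y fun n => image_mono hA.subset (hy n)
      simpa [← this, firstDigits, wordMap] using hy 0

/-- The self-conformal set `Λ` generated by the system. -/
def attractor : Set (EuclideanSpace ℝ (Fin d)) := F.existsUnique_attractor.choose

theorem isAttractor_attractor : F.IsAttractor F.attractor :=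
  F.existsUnique_attractor.choose_spec.1

theorem existsUnique_coding (i : ℕ → Fin S) :
    ∃! x, ∀ n, x ∈ F.wordMap (firstDigits i n) '' F.attractor := by
  have hA := F.isAttractor_attractor
  refine F.existsUnique_point hA.isCompact hA.nonempty hA.subset (fun j => ?_) i
  conv_rhs => rw [hA.invariant]
  exact subset_iUnion (fun i => F.f i '' F.attractor) j

/-- The coding map `π`: the point to which the decreasing compact sets
`f_{i_1} ∘ ⋯ ∘ f_{i_n}(Λ)` shrink. -/
def coding (i : ℕ → Fin S) : EuclideanSpace ℝ (Fin d) := (F.existsUnique_coding i).choose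

/-! ### Pressure and the dimension bounds -/

/-- `(1/n) log ∑_{w ∈ Σ^n} ‖f_w'‖^s`. -/
def pressureSeq (s : ℝ) (n : ℕ) : ℝ :=
  (1 / n) * Real.log (∑ w : Fin n → Fin S, F.derivNorm (List.ofFn w) ^ s)

/-- The pressure `P(s)`. -/
def pressure (s : ℝ) : ℝ := limUnder atTop (F.pressureSeq s)

/-- `(1/M) log ‖f_w'‖` for the word `w = targetWord t θ v M`. -/
def targetRate (t : ℕ → Fin S) (θ v : ℝ) (M : ℕ) : ℝ :=
  Real.log (F.derivNorm (targetWord t θ v M)) / M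

/-- `Ω⁺(t, θ, v)`. -/
def omegaSup (t : ℕ → Fin S) (θ v : ℝ) : ℝ := limsup (F.targetRate t θ v) atTop

/-- `Ω⁻(t, θ, v)`. -/
def omegaInf (t : ℕ → Fin S) (θ v : ℝ) : ℝ := liminf (F.targetRate t θ v) atTop

/-- `s ≥ 0` solves `P(s) = -s (θ - 1)/(θ - θ v - 1) Ω`. -/
def IsPressureSolution (θ v Ω s : ℝ) : Prop :=
  0 ≤ s ∧ F.pressure s = -s * ((θ - 1) / (θ - θ * v - 1)) * Ω

/-- The solution of the pressure equation. -/
def pressureSolution (θ v Ω : ℝ) : ℝ := Classical.epsilon (F.IsPressureSolution θ v Ω)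

/-- `ω⁺(t, v)` for `v ∈ [0, 1]`. -/
def upperBound (t : ℕ → Fin S) (v : ℝ) : ℝ≥0∞ :=
  if v = 0 then dimH F.attractor
  else if v = 1 then 0
  else min (⨆ θ ∈ Ioi (1 / (1 - v)),
    ENNReal.ofReal (F.pressureSolution θ v (F.omegaSup t θ v))) (dimH F.attractor)

/-- `ω⁻(t, v)` for `v ∈ [0, 1]`. -/
def lowerBound (t : ℕ → Fin S) (v : ℝ) : ℝ≥0∞ :=
  if v = 0 then dimH F.attractor
  else if v = 1 then 0
  else min (⨆ θ ∈ Ioi (1 / (1 - v)),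
    ENNReal.ofReal (F.pressureSolution θ v (F.omegaInf t θ v))) (dimH F.attractor)

end ConformalIFS

end

/-! On the symbolic side only one property of the norms ψ(w) = ‖f_w'‖ matters: ψ(uw) equals ψ(u)ψ(w)
up to a constant factor, and ψ decays exponentially in the length. This is bounded distortion
(`exists_isAlmostMultiplicative`). It traps the partition sums between e^{nP(s)} and a constant
multiple of it (`exists_pressure`) and makes P strictly decreasing, which gives existence and
uniqueness for the pressure equations.

The condition t ∈ G enters through `exists_overlap_bound`: a self-overlap of t longer than some L
never breaks off. If v > 1, hits of consecutive targets overlap by more than L, so they predict the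
same continuation, and the sequence ends in t (`hittingSet_subset_preOrbit`).

Upper bound for 0 < v < 1. If a sequence does not end in t, its first hits tend to infinity. If M is
a first hit, then target M - 1 was hit at some x < M by a prefix of length about vM, and this prefix
ends before M up to L digits (`firstHit_separated`). When the ratios n / (first hit of target n) are
at most θ, iterating backwards finds prefixes of lengths about vM, vM/θ, vM/θ², … before M. When the
ratio is close to θ for some target n first hit at M, a prefix of length about θvM starts at M.
These are the pieces of G(M, t, θ, v). The pieces before M have total length vMθ/(θ-1), so
M(θ-θv-1)/(θ-1) digits are free, and the natural cover has s-sum of exponent M(P(s)(θ-θv-1)/(θ-1) +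
sΩ). The pressure equation says that this exponent vanishes. The limsup of the ratios depends on the
sequence, so the set is cut into countably many short windows of ratios. Ratios near 1/(1-v) leave
almost no free digits, and unbounded ratios give arbitrarily long final prefixes; both extremes are
negligible (`dimH_coding_hittingSet_le`).

Lower bound. For fixed θ, prefixes of t of length about vθ^{k+1} are planted at positions about θ^k,
and the gaps are filled with independent words distributed proportionally to ψ^s. The prefix planted
at θ^k hits every target up to the next planting. The pressure equation says that the entropy of the
gaps pays for the planted prefixes, so a cylinder w of length N has mass at most ψ(w)^s up to a
factor e^{C+δN} (`exists_segments`, `infinitePi_gibbsMeasure_le`). By the open set condition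
boundedly many cylinders of comparable size meet a set of that size (`exists_card_bound`), and the
mass distribution principle applies (`le_dimH_coding_range`).

The rates v = 0 and v = 1 follow by monotonicity in the target lengths, from rates τ close to 0 and
to 1. -/

theorem ContinuousLinearMap.abs_det_of_norm_map {E : Type*} [NormedAddCommGroup E]
    [NormedSpace ℝ E] [FiniteDimensional ℝ E] [MeasurableSpace E] [BorelSpace E]
    (L : E →L[ℝ] E) {k : ℝ} (hk : 0 < k) (h : ∀ y, ‖L y‖ = k * ‖y‖) :
    |L.det| = k ^ Module.finrank ℝ E := by
  have hinj : Function.Injective L := by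
    rw [injective_iff_map_eq_zero]
    intro y hy
    have := h y
    rw [hy, norm_zero] at this
    rcases mul_eq_zero.1 this.symm with h | h
    · exact absurd h hk.ne'
    · exact norm_eq_zero.1 h
  have hsurj : Function.Surjective L := LinearMap.surjective_of_injective (f := (L : E →ₗ[ℝ] E)) hinj
  -- The image of the unit ball is the ball of radius k, so comparing Haar measures reads off |det
  -- L|.
  have himg : (L : E →ₗ[ℝ] E) '' Metric.closedBall 0 1 = Metric.closedBall 0 k := by
    ext z
    simp only [mem_image, Metric.mem_closedBall, dist_zero_right]
    constructor
    · rintro ⟨y, hy, rfl⟩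
      calc ‖L y‖ = k * ‖y‖ := h y
        _ ≤ k := by nlinarith
    · intro hz
      obtain ⟨y, rfl⟩ := hsurj z
      exact ⟨y, by rw [h] at hz; nlinarith, rfl⟩
  let μ : MeasureTheory.Measure E := MeasureTheory.Measure.addHaar
  have h1 := MeasureTheory.Measure.addHaar_image_linearMap μ (L : E →ₗ[ℝ] E)
    (Metric.closedBall 0 1)
  rw [himg, MeasureTheory.Measure.addHaar_closedBall μ _ hk.le,
    MeasureTheory.Measure.addHaar_closedBall μ _ zero_le_one, one_pow, ENNReal.ofReal_one,
    one_mul] at h1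
  have hpos : μ (Metric.ball (0 : E) 1) ≠ 0 := (Metric.measure_ball_pos μ 0 one_pos).ne'
  have hfin : μ (Metric.ball (0 : E) 1) ≠ ∞ := MeasureTheory.measure_ball_lt_top.ne
  rw [ENNReal.mul_left_inj hpos hfin,
    ENNReal.ofReal_eq_ofReal_iff (by positivity) (abs_nonneg _)] at h1
  exact h1.symm

/-! ### Derivatives of compositions and bounded distortion. -/

namespace ConformalIFS

variable {d S : ℕ} (F : ConformalIFS d S)

theorem mapsTo_word_U (w : List (Fin S)) : MapsTo (F.wordMap w) F.U F.U := by
  induction w with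
  | nil => exact fun x hx => hx
  | cons i w ih => exact fun x hx => F.mapsTo i (subset_closure (ih hx))

theorem differentiableAt_f (i : Fin S) {x} (hx : x ∈ F.U) : DifferentiableAt ℝ (F.f i) x :=
  ((F.conformal i).contDiffOn.differentiableOn (by norm_num)).differentiableAt
    (F.isOpen_U.mem_nhds hx)

theorem differentiableAt_word (w : List (Fin S)) {x} (hx : x ∈ F.U) :
    DifferentiableAt ℝ (F.wordMap w) x := by
  induction w with
  | nil => exact differentiableAt_id
  | cons i w ih => exact (F.differentiableAt_f i (F.mapsTo_word_U w hx)).comp x ih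

theorem injOn_word (w : List (Fin S)) : InjOn (F.wordMap w) F.U := by
  induction w with
  | nil => exact injOn_id _
  | cons i w ih => exact (F.injOn i).comp ih (F.mapsTo_word_U w)

theorem fderiv_cons (i : Fin S) (w : List (Fin S)) {x} (hx : x ∈ F.U) :
    fderiv ℝ (F.wordMap (i :: w)) x =
      (fderiv ℝ (F.f i) (F.wordMap w x)).comp (fderiv ℝ (F.wordMap w) x) :=
  fderiv_comp x (F.differentiableAt_f i (F.mapsTo_word_U w hx)) (F.differentiableAt_word w hx)

theorem norm_fderiv_f_apply (i : Fin S) {x} (hx : x ∈ F.U) (y) :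
    ‖fderiv ℝ (F.f i) x y‖ = ‖fderiv ℝ (F.f i) x‖ * ‖y‖ := by
  rcases eq_or_ne y 0 with rfl | hy
  · simp
  · exact ((F.conformal i).similarity x hx y hy).1

variable [Nontrivial (EuclideanSpace ℝ (Fin d))]

theorem norm_fderiv_f_pos (i : Fin S) {x} (hx : x ∈ F.U) : 0 < ‖fderiv ℝ (F.f i) x‖ := by
  obtain ⟨y, hy⟩ := exists_ne (0 : EuclideanSpace ℝ (Fin d))
  refine norm_pos_iff.2 fun h => ((F.conformal i).similarity x hx y hy).2 ?_
  rw [h]; rfl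

theorem norm_fderiv_nil (x) : ‖fderiv ℝ (F.wordMap []) x‖ = 1 := by
  have : F.wordMap [] = id := rfl
  rw [this, fderiv_id]
  exact ContinuousLinearMap.norm_id

theorem norm_fderiv_word_apply (w : List (Fin S)) {x} (hx : x ∈ F.U) (y) :
    ‖fderiv ℝ (F.wordMap w) x y‖ = ‖fderiv ℝ (F.wordMap w) x‖ * ‖y‖ := by
  induction w generalizing y with
  | nil =>
    rw [norm_fderiv_nil, one_mul]
    have : F.wordMap [] = id := rfl
    rw [this, fderiv_id]; rfl
  | cons i w ih =>
    have key : ∀ z, ‖fderiv ℝ (F.wordMap (i :: w)) x z‖ =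
        (‖fderiv ℝ (F.f i) (F.wordMap w x)‖ * ‖fderiv ℝ (F.wordMap w) x‖) * ‖z‖ := by
      intro z
      rw [F.fderiv_cons i w hx, ContinuousLinearMap.comp_apply,
        F.norm_fderiv_f_apply i (F.mapsTo_word_U w hx), ih, mul_assoc]
    rw [key, ContinuousLinearMap.homothety_norm _ key]

theorem norm_fderiv_cons (i : Fin S) (w : List (Fin S)) {x} (hx : x ∈ F.U) :
    ‖fderiv ℝ (F.wordMap (i :: w)) x‖ =
      ‖fderiv ℝ (F.f i) (F.wordMap w x)‖ * ‖fderiv ℝ (F.wordMap w) x‖ := by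
  refine ContinuousLinearMap.homothety_norm _ fun z => ?_
  rw [F.fderiv_cons i w hx, ContinuousLinearMap.comp_apply,
    F.norm_fderiv_f_apply i (F.mapsTo_word_U w hx), F.norm_fderiv_word_apply w hx, mul_assoc]

theorem norm_fderiv_append (u w : List (Fin S)) {x} (hx : x ∈ F.U) :
    ‖fderiv ℝ (F.wordMap (u ++ w)) x‖ =
      ‖fderiv ℝ (F.wordMap u) (F.wordMap w x)‖ * ‖fderiv ℝ (F.wordMap w) x‖ := by
  induction u with
  | nil => rw [norm_fderiv_nil, one_mul]; rfl
  | cons i u ih =>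
    rw [List.cons_append, F.norm_fderiv_cons i _ hx, ih,
      F.norm_fderiv_cons i u (F.mapsTo_word_U w hx), mul_assoc, F.wordMap_append]
    rfl

theorem norm_fderiv_word_pos (w : List (Fin S)) {x} (hx : x ∈ F.U) :
    0 < ‖fderiv ℝ (F.wordMap w) x‖ := by
  induction w with
  | nil => rw [norm_fderiv_nil]; exact one_pos
  | cons i w ih =>
    rw [F.norm_fderiv_cons i w hx]
    exact mul_pos (F.norm_fderiv_f_pos i (F.mapsTo_word_U w hx)) ih

omit [Nontrivial (EuclideanSpace ℝ (Fin d))] in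
theorem exists_uniform_contraction : ∃ r : ℝ, 0 < r ∧ r < 1 ∧
    ∀ i, ∀ x ∈ F.U, ‖fderiv ℝ (F.f i) x‖ ≤ r := by
  choose r hr hb using F.contracting
  have hS : 0 < S := by have := F.two_le; omega
  have : Nonempty (Fin S) := ⟨⟨0, hS⟩⟩
  refine ⟨max (1 / 2) (Finset.univ.sup' Finset.univ_nonempty r), by positivity, ?_, ?_⟩
  · rw [max_lt_iff, Finset.sup'_lt_iff]
    exact ⟨by norm_num, fun i _ => hr i⟩
  · intro i x hx
    exact (hb i x hx).trans ((Finset.le_sup' r (Finset.mem_univ i)).trans (le_max_right _ _))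

theorem norm_fderiv_word_le {r : ℝ} (hr : ∀ i, ∀ x ∈ F.U, ‖fderiv ℝ (F.f i) x‖ ≤ r)
    (w : List (Fin S)) {x} (hx : x ∈ F.U) : ‖fderiv ℝ (F.wordMap w) x‖ ≤ r ^ w.length := by
  induction w with
  | nil => rw [norm_fderiv_nil]; simp
  | cons i w ih =>
    rw [F.norm_fderiv_cons i w hx, List.length_cons, pow_succ']
    have h1 := hr i _ (F.mapsTo_word_U w hx)
    exact mul_le_mul h1 ih (norm_nonneg _) ((norm_nonneg _).trans h1)

theorem bddAbove_norm_fderiv (w : List (Fin S)) :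
    BddAbove (range fun x : F.U => ‖fderiv ℝ (F.wordMap w) x‖) := by
  obtain ⟨r, -, -, hr⟩ := F.exists_uniform_contraction
  refine ⟨r ^ w.length, ?_⟩
  rintro _ ⟨x, rfl⟩
  exact F.norm_fderiv_word_le hr w x.2

theorem norm_fderiv_le_derivNorm (w : List (Fin S)) {x} (hx : x ∈ F.U) :
    ‖fderiv ℝ (F.wordMap w) x‖ ≤ F.derivNorm w :=
  le_ciSup (F.bddAbove_norm_fderiv w) ⟨x, hx⟩

omit [Nontrivial (EuclideanSpace ℝ (Fin d))] in
theorem derivNorm_le {w : List (Fin S)} {c : ℝ}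
    (h : ∀ x ∈ F.U, ‖fderiv ℝ (F.wordMap w) x‖ ≤ c) : F.derivNorm w ≤ c := by
  have : Nonempty F.U := F.nonempty_U.to_subtype
  exact ciSup_le fun x => h x x.2

theorem derivNorm_pos (w : List (Fin S)) : 0 < F.derivNorm w := by
  obtain ⟨x, hx⟩ := F.nonempty_U
  exact (F.norm_fderiv_word_pos w hx).trans_le (F.norm_fderiv_le_derivNorm w hx)

theorem derivNorm_nil : F.derivNorm [] = 1 := by
  refine le_antisymm (F.derivNorm_le fun x _ => (F.norm_fderiv_nil x).le) ?_
  obtain ⟨x, hx⟩ := F.nonempty_U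
  rw [← F.norm_fderiv_nil x]
  exact F.norm_fderiv_le_derivNorm [] hx

theorem derivNorm_append_le (u w : List (Fin S)) :
    F.derivNorm (u ++ w) ≤ F.derivNorm u * F.derivNorm w := by
  refine F.derivNorm_le fun x hx => ?_
  rw [F.norm_fderiv_append u w hx]
  exact mul_le_mul (F.norm_fderiv_le_derivNorm u (F.mapsTo_word_U w hx))
    (F.norm_fderiv_le_derivNorm w hx) (norm_nonneg _) (F.derivNorm_pos u).le

theorem dist_word_le (w : List (Fin S)) {x y} (hx : x ∈ closure F.U) (hy : y ∈ closure F.U) :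
    dist (F.wordMap w x) (F.wordMap w y) ≤ F.derivNorm w * dist x y := by
  obtain ⟨r, -, hr⟩ := F.exists_ratio
  have h1 : LipschitzOnWith (F.derivNorm w).toNNReal (F.wordMap w) (closure F.U) := by
    refine LipschitzOnWith.closure (F.lipschitz_word hr w).continuousOn ?_
    refine F.convex_U.lipschitzOnWith_of_nnnorm_fderiv_le (𝕜 := ℝ)
      (fun x hx => F.differentiableAt_word w hx) (fun x hx => ?_)
    exact NNReal.le_toNNReal_of_coe_le (F.norm_fderiv_le_derivNorm w hx)
  have := h1.dist_le_mul x hx y hy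
  rwa [Real.coe_toNNReal _ (F.derivNorm_pos w).le] at this

/-- A compact subset of `U` that contains the images of the closure of `U`. -/
structure IsCore (K : Set (EuclideanSpace ℝ (Fin d))) : Prop where
  isCompact : IsCompact K
  subset : K ⊆ F.U
  mapsTo : ∀ i, MapsTo (F.f i) (closure F.U) K

omit [Nontrivial (EuclideanSpace ℝ (Fin d))] in
-- The maps send the compact set `closure F.U` into the open set `F.U`, so their images stay
-- compactly inside it. On such a compact set the derivatives are bounded away from 0, which may
-- fail on `F.U`.
theorem exists_isCore {B : Set (EuclideanSpace ℝ (Fin d))} (hB : IsCompact B) (hBU : B ⊆ F.U) :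
    ∃ K, F.IsCore K ∧ B ⊆ K := by
  refine ⟨B ∪ ⋃ i, F.f i '' closure F.U, ⟨hB.union (isCompact_iUnion fun i =>
    F.isCompact_closure_U.image_of_continuousOn (F.continuousOn i)), ?_, ?_⟩, subset_union_left⟩
  · exact union_subset hBU (iUnion_subset fun i => (F.mapsTo i).image_subset)
  · exact fun i x hx => Or.inr (mem_iUnion.2 ⟨i, mem_image_of_mem _ hx⟩)

variable {F}

omit [Nontrivial (EuclideanSpace ℝ (Fin d))] in
theorem IsCore.mapsTo_word {K} (hK : F.IsCore K) (w : List (Fin S)) : MapsTo (F.wordMap w) K K := by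
  cases w with
  | nil => exact fun x hx => hx
  | cons i w => exact fun x hx => hK.mapsTo i (F.mapsTo_word w (subset_closure (hK.subset hx)))

theorem IsCore.exists_lower_bound {K} (hK : F.IsCore K) : ∃ δ > (0 : ℝ), δ ≤ 1 ∧
    ∀ i, ∀ x ∈ K, δ ≤ ‖fderiv ℝ (F.f i) x‖ := by
  have h : ∀ i, ∃ δ > (0 : ℝ), ∀ x ∈ K, δ ≤ ‖fderiv ℝ (F.f i) x‖ := by
    intro i
    rcases K.eq_empty_or_nonempty with rfl | hne
    · exact ⟨1, one_pos, by simp⟩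
    have hc : ContinuousOn (fun x => ‖fderiv ℝ (F.f i) x‖) K :=
      (((F.conformal i).contDiffOn.continuousOn_fderiv_of_isOpen F.isOpen_U le_rfl).mono
        hK.subset).norm
    obtain ⟨x, hx, hmin⟩ := hK.isCompact.exists_isMinOn hne hc
    exact ⟨_, F.norm_fderiv_f_pos i (hK.subset hx), fun y hy => hmin hy⟩
  choose δ hδ hb using h
  have hS : 0 < S := by have := F.two_le; omega
  have : Nonempty (Fin S) := ⟨⟨0, hS⟩⟩
  refine ⟨min 1 (Finset.univ.inf' Finset.univ_nonempty δ), ?_, min_le_left _ _, ?_⟩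
  · rw [gt_iff_lt, lt_min_iff, Finset.lt_inf'_iff]
    exact ⟨one_pos, fun i _ => hδ i⟩
  · intro i x hx
    exact ((min_le_right _ _).trans (Finset.inf'_le δ (Finset.mem_univ i))).trans (hb i x hx)

/-- Bounded distortion on a core. -/
theorem IsCore.exists_distortion {K} (hK : F.IsCore K) : ∃ C ≥ (1 : ℝ), ∀ (w : List (Fin S)),
    ∀ x ∈ K, ∀ y ∈ K, ‖fderiv ℝ (F.wordMap w) x‖ ≤ C * ‖fderiv ℝ (F.wordMap w) y‖ := by
  obtain ⟨δ, hδ, -, hlow⟩ := hK.exists_lower_bound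
  obtain ⟨r, hr0, hr1, hr⟩ := F.exists_uniform_contraction
  have hhol : ∀ i, ∃ α > (0 : ℝ), ∃ c > (0 : ℝ), ∀ x ∈ F.U, ∀ y ∈ F.U,
    ‖fderiv ℝ (F.f i) x - fderiv ℝ (F.f i) y‖ ≤ c * ‖x - y‖ ^ α := fun i => (F.conformal i).holder
  choose α hα c hc hh using hhol
  set D := Metric.diam (closure F.U) with hD
  have hD0 : 0 ≤ D := Metric.diam_nonneg
  -- one step
  let a : Fin S → ℕ → ℝ := fun i n => c i / δ * (r ^ n * D) ^ α i
  have ha0 : ∀ i n, 0 ≤ a i n := fun i n => by have := hc i; positivity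
  have hsum : ∀ i, Summable (a i) := by
    intro i
    have : a i = fun n => (c i / δ * D ^ α i) * (r ^ α i) ^ n := by
      funext n
      simp only [a]
      rw [Real.mul_rpow (by positivity) hD0, ← Real.rpow_natCast, ← Real.rpow_mul hr0.le,
        ← Real.rpow_natCast, ← Real.rpow_mul hr0.le, mul_comm (n : ℝ)]
      ring
    rw [this]
    exact (summable_geometric_of_lt_one (by positivity)
      (Real.rpow_lt_one hr0.le hr1 (hα i))).mul_left _
  have hsumA : Summable fun n => ∑ i, a i n := summable_sum fun i _ => hsum i
  -- The outermost map acts on two points at distance at most r^|w| D. By Hölder continuity and the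
  -- lower bound δ, the logarithm of its derivative changes by at most ∑ᵢ `a i w.length`. These
  -- changes are summable in the length, so the total distortion is bounded uniformly in the word.
  have key : ∀ (w : List (Fin S)), ∀ x ∈ K, ∀ y ∈ K, ‖fderiv ℝ (F.wordMap w) x‖ ≤
      Real.exp (∑ n ∈ Finset.range w.length, ∑ i, a i n) * ‖fderiv ℝ (F.wordMap w) y‖ := by
    intro w x hx y hy
    have hxU := hK.subset hx
    have hyU := hK.subset hy
    induction w with
    | nil => simp [norm_fderiv_nil]
    | cons i w ih =>
      rw [F.norm_fderiv_cons i w hxU, F.norm_fderiv_cons i w hyU, List.length_cons,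
        Finset.sum_range_succ, Real.exp_add]
      set X := F.wordMap w x
      set Y := F.wordMap w y
      have hXU : X ∈ F.U := F.mapsTo_word_U w hxU
      have hYU : Y ∈ F.U := F.mapsTo_word_U w hyU
      have hdist : ‖X - Y‖ ≤ r ^ w.length * D := by
        rw [← dist_eq_norm]
        refine (F.dist_word_le w (subset_closure hxU) (subset_closure hyU)).trans ?_
        refine mul_le_mul (F.derivNorm_le fun z hz => F.norm_fderiv_word_le hr w hz) ?_
          dist_nonneg (by positivity)
        exact Metric.dist_le_diam_of_mem F.isCompact_closure_U.isBounded (subset_closure hxU)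
          (subset_closure hyU)
      have h1 : ‖fderiv ℝ (F.f i) X‖ ≤ ‖fderiv ℝ (F.f i) Y‖ + c i * (r ^ w.length * D) ^ α i := by
        have h2 := norm_le_norm_add_norm_sub' (fderiv ℝ (F.f i) X) (fderiv ℝ (F.f i) Y)
        have h3 := hh i X hXU Y hYU
        have h4 : ‖X - Y‖ ^ α i ≤ (r ^ w.length * D) ^ α i :=
          Real.rpow_le_rpow (norm_nonneg _) hdist (hα i).le
        have h5 := mul_le_mul_of_nonneg_left h4 (hc i).le
        linarith
      have hYlow : δ ≤ ‖fderiv ℝ (F.f i) Y‖ := hlow i _ (hK.mapsTo_word w hy)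
      have h2 : ‖fderiv ℝ (F.f i) X‖ ≤
          Real.exp (∑ i, a i w.length) * ‖fderiv ℝ (F.f i) Y‖ := by
        have h3 : c i * (r ^ w.length * D) ^ α i = δ * a i w.length := by
          simp only [a]; field_simp
        have h4 : a i w.length ≤ ∑ i, a i w.length :=
          Finset.single_le_sum (f := fun i => a i w.length) (fun j _ => ha0 j _)
            (Finset.mem_univ i)
        have h5 := Real.add_one_le_exp (∑ i, a i w.length)
        have h6 := ha0 i w.length
        rw [h3] at h1
        nlinarith [mul_le_mul_of_nonneg_right hYlow h6]
      calc _ ≤ (Real.exp (∑ i, a i w.length) * ‖fderiv ℝ (F.f i) Y‖) *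
            (Real.exp (∑ n ∈ Finset.range w.length, ∑ i, a i n) *
              ‖fderiv ℝ (F.wordMap w) y‖) :=
            mul_le_mul h2 ih (norm_nonneg _) (by positivity)
        _ = _ := by ring
  refine ⟨Real.exp (∑' n, ∑ i, a i n), Real.one_le_exp (tsum_nonneg fun n =>
    Finset.sum_nonneg fun i _ => ha0 i n), fun w x hx y hy => (key w x hx y hy).trans ?_⟩
  refine mul_le_mul_of_nonneg_right (Real.exp_le_exp.2 ?_) (norm_nonneg _)
  exact hsumA.sum_le_tsum _ fun n _ => Finset.sum_nonneg fun i _ => ha0 i n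

/-- The supremum in `derivNorm` runs over all of `F.U`, where distortion is not controlled directly.
The innermost map already sends `F.U` into the core, so distortion on the core handles the other
letters, and the single remaining derivative is at most 1 at one point and at least δ at the other.
-/
theorem IsCore.exists_derivNorm_le {K} (hK : F.IsCore K) : ∃ C ≥ (1 : ℝ), ∀ (w : List (Fin S)),
    ∀ y ∈ K, F.derivNorm w ≤ C * ‖fderiv ℝ (F.wordMap w) y‖ := by
  obtain ⟨δ, hδ, hδ1, hlow⟩ := hK.exists_lower_bound
  obtain ⟨C, hC, hdist⟩ := hK.exists_distortion
  obtain ⟨r, hr0, hr1, hr⟩ := F.exists_uniform_contraction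
  refine ⟨C / δ, by rw [ge_iff_le, le_div_iff₀ hδ]; linarith, fun w y hy => ?_⟩
  rcases List.eq_nil_or_concat w with rfl | ⟨w', i, rfl⟩
  · rw [derivNorm_nil, norm_fderiv_nil, mul_one, le_div_iff₀ hδ]; linarith
  · rw [List.concat_eq_append]
    refine F.derivNorm_le fun x hx => ?_
    rw [F.norm_fderiv_append _ _ hx, F.norm_fderiv_append _ _ (hK.subset hy)]
    have hi : F.wordMap [i] = F.f i := rfl
    rw [hi]
    have h1 := hdist w' _ (hK.mapsTo i (subset_closure hx)) _
      (hK.mapsTo i (subset_closure (hK.subset hy)))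
    have h2 : ‖fderiv ℝ (F.f i) x‖ ≤ 1 := (hr i x hx).trans hr1.le
    have h3 := hlow i y hy
    have h4 : ‖fderiv ℝ (F.f i) x‖ ≤ ‖fderiv ℝ (F.f i) y‖ / δ := by
      rw [le_div_iff₀ hδ]; nlinarith [norm_nonneg (fderiv ℝ (F.f i) x)]
    calc _ ≤ (C * ‖fderiv ℝ (F.wordMap w') (F.f i y)‖) * (‖fderiv ℝ (F.f i) y‖ / δ) :=
          mul_le_mul h1 h4 (norm_nonneg _) (by positivity)
      _ = _ := by ring

theorem IsCore.pow_le {K} (hK : F.IsCore K) {δ : ℝ} (hδ : 0 ≤ δ)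
    (hlow : ∀ i, ∀ x ∈ K, δ ≤ ‖fderiv ℝ (F.f i) x‖) (w : List (Fin S)) {x} (hx : x ∈ K) :
    δ ^ w.length ≤ ‖fderiv ℝ (F.wordMap w) x‖ := by
  induction w with
  | nil => simp [norm_fderiv_nil]
  | cons i w ih =>
    rw [F.norm_fderiv_cons i w (hK.subset hx), List.length_cons, pow_succ']
    exact mul_le_mul (hlow i _ (hK.mapsTo_word w hx)) ih (by positivity) (norm_nonneg _)

end ConformalIFS

/-- A function on finite words that is submultiplicative, supermultiplicative up to a constant,
and decays exponentially in the length of the word. -/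
structure IsAlmostMultiplicative {S : ℕ} (ψ : List (Fin S) → ℝ) (c b r : ℝ) : Prop where
  c_pos : 0 < c
  c_le_one : c ≤ 1
  b_pos : 0 < b
  b_lt_one : b < 1
  r_pos : 0 < r
  r_lt_one : r < 1
  nil : ψ [] = 1
  append_le : ∀ u w, ψ (u ++ w) ≤ ψ u * ψ w
  le_append : ∀ u w, c * (ψ u * ψ w) ≤ ψ (u ++ w)
  pow_le : ∀ w, b ^ w.length ≤ ψ w
  le_pow : ∀ w, ψ w ≤ r ^ w.length

/-! ### Almost multiplicativity of the norms; counting cylinders under the open set condition. -/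

namespace ConformalIFS

variable {d S : ℕ} (F : ConformalIFS d S) [Nontrivial (EuclideanSpace ℝ (Fin d))]

/-- The chain rule gives submultiplicativity. At one core point both factors are comparable to their
suprema, with constant C each, hence c = C⁻². The base b is δ/2 instead of δ because δ = 1 is not
excluded while b < 1 is required. -/
theorem exists_isAlmostMultiplicative : ∃ c b r, IsAlmostMultiplicative F.derivNorm c b r := by
  obtain ⟨x, hx⟩ := F.nonempty_U
  obtain ⟨K, hK, hxK⟩ := F.exists_isCore (isCompact_singleton (x := x)) (singleton_subset_iff.2 hx)
  replace hxK : x ∈ K := hxK rfl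
  obtain ⟨δ, hδ, hδ1, hlow⟩ := hK.exists_lower_bound
  obtain ⟨C, hC, hdist⟩ := hK.exists_derivNorm_le
  obtain ⟨r, hr0, hr1, hr⟩ := F.exists_uniform_contraction
  have hC0 : 0 < C := by linarith
  refine ⟨(C * C)⁻¹, δ / 2, r, ⟨by positivity, inv_le_one_of_one_le₀ (by nlinarith), by positivity,
    by linarith, hr0, hr1, F.derivNorm_nil, F.derivNorm_append_le, fun u w => ?_, fun w => ?_,
    fun w => F.derivNorm_le fun y hy => F.norm_fderiv_word_le hr w hy⟩⟩
  · rw [inv_mul_le_iff₀ (by positivity)]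
    have h1 := hdist u _ (hK.mapsTo_word w hxK)
    have h2 := hdist w x hxK
    have h3 := F.norm_fderiv_le_derivNorm (u ++ w) hx
    rw [F.norm_fderiv_append u w hx] at h3
    calc _ ≤ (C * _) * (C * _) := mul_le_mul h1 h2 (F.derivNorm_pos w).le (by positivity)
      _ = C * C * (‖fderiv ℝ (F.wordMap u) (F.wordMap w x)‖ * ‖fderiv ℝ (F.wordMap w) x‖) := by
        ring
      _ ≤ _ := by gcongr
  · have h1 := hK.pow_le hδ.le hlow w hxK
    have h2 := F.norm_fderiv_le_derivNorm w hx
    have h3 : (δ / 2) ^ w.length ≤ δ ^ w.length :=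
      pow_le_pow_left₀ (by positivity) (by linarith) _
    linarith

variable {F}

omit [Nontrivial (EuclideanSpace ℝ (Fin d))] in
-- Incomparable words differ at some first letter, where the images are disjoint by hypothesis. The
-- common letters before it are stripped with the injectivity of the maps on `F.U`.
theorem image_word_disjoint {O : Set (EuclideanSpace ℝ (Fin d))} (hOU : O ⊆ F.U)
    (hO : ∀ i, F.f i '' O ⊆ O)
    (hdisj : ∀ i j, i ≠ j → Disjoint (F.f i '' O) (F.f j '' O)) {u w : List (Fin S)}
    (huw : ¬ u <+: w) (hwu : ¬ w <+: u) :
    Disjoint (F.wordMap u '' O) (F.wordMap w '' O) := by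
  have hmaps : ∀ w : List (Fin S), MapsTo (F.wordMap w) O O := by
    intro w
    induction w with
    | nil => exact fun x hx => hx
    | cons i w ih => exact fun x hx => hO i (mem_image_of_mem _ (ih hx))
  induction u generalizing w with
  | nil => exact absurd (List.nil_prefix) huw
  | cons i u ih =>
    cases w with
    | nil => exact absurd (List.nil_prefix) hwu
    | cons j w =>
      rcases eq_or_ne i j with rfl | hij
      · simp only [List.cons_prefix_cons, true_and] at huw hwu
        have := ih huw hwu
        have e : ∀ v : List (Fin S), F.wordMap (i :: v) '' O = F.f i '' (F.wordMap v '' O) :=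
          fun v => image_comp _ _ _
        rw [e, e]
        rw [Set.disjoint_left] at this ⊢
        rintro _ ⟨x, hx, rfl⟩ ⟨y, hy, hxy⟩
        have hyx := F.injOn i (hOU ((hmaps w).image_subset hy))
          (hOU ((hmaps u).image_subset hx)) hxy
        exact this hx (hyx ▸ hy)
      · have e : ∀ (a : Fin S) (v : List (Fin S)), F.wordMap (a :: v) '' O ⊆ F.f a '' O := by
          intro a v
          rintro _ ⟨x, hx, rfl⟩
          exact mem_image_of_mem _ (hmaps v hx)
        exact (hdisj i j hij).mono (e i u) (e j w)

/-- Incomparable words whose cylinders have size comparable to `ρ` and meet a set of diameter at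
most `ρ` are boundedly many. -/
theorem exists_card_bound (hF : F.OpenSetCondition) {β : ℝ} (hβ : 0 < β) :
    ∃ N₀ : ℝ, ∀ ρ > (0 : ℝ), ∀ A : Set (EuclideanSpace ℝ (Fin d)),
      (∀ x ∈ A, ∀ y ∈ A, dist x y ≤ ρ) → ∀ T : Finset (List (Fin S)),
      (∀ u ∈ T, ∀ w ∈ T, u ≠ w → ¬ u <+: w) →
      (∀ w ∈ T, β * ρ ≤ F.derivNorm w ∧ F.derivNorm w ≤ ρ ∧
        ∃ x ∈ A, x ∈ F.wordMap w '' closure F.U) → (T.card : ℝ) ≤ N₀ := by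
  obtain ⟨O, hO, ⟨o, ho⟩, hOU, hmaps, hdisj⟩ := hF
  obtain ⟨ε, hε, hball⟩ := Metric.nhds_basis_closedBall.mem_iff.1 (hO.mem_nhds ho)
  set B := Metric.closedBall o ε with hB
  have hBU : B ⊆ F.U := hball.trans hOU
  have hBcpt : IsCompact B := isCompact_closedBall o ε
  obtain ⟨K, hK, hBK⟩ := F.exists_isCore hBcpt hBU
  obtain ⟨C, hC, hdist⟩ := hK.exists_derivNorm_le
  have hC0 : 0 < C := by linarith
  set D := Metric.diam (closure F.U) with hD
  have hD0 : 0 ≤ D := Metric.diam_nonneg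
  let μ : MeasureTheory.Measure (EuclideanSpace ℝ (Fin d)) := MeasureTheory.volume
  set n := Module.finrank ℝ (EuclideanSpace ℝ (Fin d)) with hn
  set V := μ (Metric.ball (0 : EuclideanSpace ℝ (Fin d)) 1) with hV
  have hV0 : V ≠ 0 := (Metric.measure_ball_pos μ 0 one_pos).ne'
  have hVtop : V ≠ ∞ := MeasureTheory.measure_ball_lt_top.ne
  -- Volume comparison: the images of a ball of radius ε inside O are disjoint. Each has volume at
  -- least that of a ball of radius (β/C)ερ, because the Jacobian is the n-th power of the
  -- derivative norm, and all of them lie in one ball of radius (1 + D)ρ.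
  refine ⟨(1 + D) ^ n / ((β / C * ε) ^ n), fun ρ hρ A hA T hT hTA => ?_⟩
  rcases T.eq_empty_or_nonempty with rfl | ⟨w₀, hw₀⟩
  · simp only [Finset.card_empty, Nat.cast_zero]; positivity
  obtain ⟨-, -, a, haA, -⟩ := hTA w₀ hw₀
  have hcont : ∀ w : List (Fin S), ContinuousOn (F.wordMap w) B := fun w x hx =>
    (F.differentiableAt_word w (hBU hx)).continuousAt.continuousWithinAt
  have hmeas : ∀ w : List (Fin S), MeasurableSet (F.wordMap w '' B) := fun w =>
    (hBcpt.image_of_continuousOn (hcont w)).measurableSet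
  have hlow : ∀ w ∈ T, ENNReal.ofReal ((β / C * ε * ρ) ^ n) * V ≤ μ (F.wordMap w '' B) := by
    intro w hw
    rw [← MeasureTheory.lintegral_abs_det_fderiv_eq_addHaar_image μ hBcpt.measurableSet
      (fun x hx => (F.differentiableAt_word w (hBU hx)).hasFDerivAt.hasFDerivWithinAt)
      ((F.injOn_word w).mono hBU)]
    calc ENNReal.ofReal ((β / C * ε * ρ) ^ n) * V
        = ∫⁻ x in B, ENNReal.ofReal ((β / C * ρ) ^ n) ∂μ := by
          rw [MeasureTheory.setLIntegral_const, hB, MeasureTheory.Measure.addHaar_closedBall μ o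
            hε.le, ← mul_assoc, ← ENNReal.ofReal_mul (by positivity), ← mul_pow]
          congr 3; ring
      _ ≤ _ := by
          refine MeasureTheory.setLIntegral_mono' hBcpt.measurableSet fun x hx => ?_
          have hxU := hBU hx
          rw [ContinuousLinearMap.abs_det_of_norm_map _ (F.norm_fderiv_word_pos w hxU)
            (F.norm_fderiv_word_apply w hxU)]
          refine ENNReal.ofReal_le_ofReal (pow_le_pow_left₀ (by positivity) ?_ _)
          have h1 := hdist w x (hBK hx)
          have h2 := (hTA w hw).1
          rw [div_mul_eq_mul_div, div_le_iff₀ hC0]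
          linarith
  have hsub : (⋃ w ∈ T, F.wordMap w '' B) ⊆ Metric.closedBall a ((1 + D) * ρ) := by
    refine iUnion₂_subset fun w hw => ?_
    rintro _ ⟨x, hx, rfl⟩
    obtain ⟨-, h2, z, hzA, y, hy, rfl⟩ := hTA w hw
    have h3 := F.dist_word_le w (subset_closure (hBU hx)) hy
    have h4 := Metric.dist_le_diam_of_mem F.isCompact_closure_U.isBounded
      (subset_closure (hBU hx)) hy
    have h5 := hA _ hzA _ haA
    have h6 := dist_triangle (F.wordMap w x) (F.wordMap w y) a
    have h7 : F.derivNorm w * dist x y ≤ ρ * D := mul_le_mul h2 h4 dist_nonneg hρ.le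
    rw [Metric.mem_closedBall]
    linarith
  have hsum : (T.card : ℝ≥0∞) * (ENNReal.ofReal ((β / C * ε * ρ) ^ n) * V) ≤
      ENNReal.ofReal (((1 + D) * ρ) ^ n) * V := by
    calc (T.card : ℝ≥0∞) * (ENNReal.ofReal ((β / C * ε * ρ) ^ n) * V)
        = ∑ w ∈ T, ENNReal.ofReal ((β / C * ε * ρ) ^ n) * V := by
          rw [Finset.sum_const, nsmul_eq_mul]
      _ ≤ ∑ w ∈ T, μ (F.wordMap w '' B) := Finset.sum_le_sum hlow
      _ = μ (⋃ w ∈ T, F.wordMap w '' B) := by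
          refine (MeasureTheory.measure_biUnion_finset (fun u hu w hw huw => ?_)
            fun w _ => hmeas w).symm
          exact (image_word_disjoint hOU hmaps hdisj (hT u hu w hw huw)
            (hT w hw u hu huw.symm)).mono (image_mono hball) (image_mono hball)
      _ ≤ μ (Metric.closedBall a ((1 + D) * ρ)) := MeasureTheory.measure_mono hsub
      _ = _ := MeasureTheory.Measure.addHaar_closedBall μ a (by positivity)
  rw [← mul_assoc, ENNReal.mul_le_mul_iff_left hV0 hVtop, ← ENNReal.ofReal_natCast,
    ← ENNReal.ofReal_mul (by positivity), ENNReal.ofReal_le_ofReal_iff (by positivity)] at hsum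
  rw [le_div_iff₀ (by positivity)]
  rw [mul_pow _ ρ, mul_pow _ ρ, ← mul_assoc] at hsum
  exact le_of_mul_le_mul_right hsum (by positivity)

end ConformalIFS

/-! ### The coding map. -/

namespace ConformalIFS

variable {d S : ℕ} (F : ConformalIFS d S)

/-- In dimension 0 all maps coincide, so two of them cannot have disjoint images. Hence d ≥ 1 need
not be assumed. -/
theorem nontrivial_of_openSetCondition {F : ConformalIFS d S} (hF : F.OpenSetCondition) :
    Nontrivial (EuclideanSpace ℝ (Fin d)) := by
  by_contra h
  rw [not_nontrivial_iff_subsingleton] at h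
  obtain ⟨O, -, ⟨x, hx⟩, -, -, hdisj⟩ := hF
  have h2 := F.two_le
  have := hdisj ⟨0, by omega⟩ ⟨1, by omega⟩ (by simp)
  refine Set.disjoint_left.1 this (mem_image_of_mem _ hx) ?_
  rw [Subsingleton.elim (F.f _ x) (F.f ⟨1, by omega⟩ x)]
  exact mem_image_of_mem _ hx

theorem coding_mem (e : ℕ → Fin S) (n : ℕ) :
    F.coding e ∈ F.wordMap (firstDigits e n) '' F.attractor :=
  (F.existsUnique_coding e).choose_spec.1 n

theorem coding_mem_attractor (e : ℕ → Fin S) : F.coding e ∈ F.attractor := by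
  simpa [firstDigits, wordMap] using F.coding_mem e 0

theorem coding_mem_closure (e : ℕ → Fin S) (n : ℕ) :
    F.coding e ∈ F.wordMap (firstDigits e n) '' closure F.U :=
  image_mono F.isAttractor_attractor.subset (F.coding_mem e n)

/-- Digits are produced by choosing a preimage inside the attractor again and again. -/
theorem exists_coding_eq {x} (hx : x ∈ F.attractor) : ∃ e, F.coding e = x := by
  have hA := F.isAttractor_attractor
  have hstep : ∀ y : F.attractor, ∃ (a : Fin S) (z : F.attractor), F.f a z = y := by
    rintro ⟨y, hy⟩
    rw [hA.invariant] at hy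
    obtain ⟨a, z, hz, h⟩ := mem_iUnion.1 hy
    exact ⟨a, ⟨z, hz⟩, h⟩
  choose a b hab using hstep
  have H : ∀ n (y : F.attractor),
      F.wordMap (firstDigits (fun n => a (b^[n] y)) n) (b^[n] y) = y := by
    intro n
    induction n with
    | zero => intro y; rfl
    | succ n ih =>
      intro y
      rw [F.word_succ]
      exact (congrArg _ (ih (b y))).trans (hab y)
  refine ⟨fun n => a (b^[n] ⟨x, hx⟩), ?_⟩
  exact (F.existsUnique_coding _).unique (fun n => F.coding_mem _ n)
    fun n => ⟨_, (b^[n] ⟨x, hx⟩).2, H n ⟨x, hx⟩⟩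

end ConformalIFS

/-- `∑_{w ∈ Σ^n} ψ(w)^s`. -/
noncomputable def partitionSum {S : ℕ} (ψ : List (Fin S) → ℝ) (s : ℝ) (n : ℕ) : ℝ :=
  ∑ w : Fin n → Fin S, ψ (List.ofFn w) ^ s

/-- The exponential growth rate of the partition sums. -/
noncomputable def wordPressure {S : ℕ} (ψ : List (Fin S) → ℝ) (s : ℝ) : ℝ :=
  limUnder atTop fun n : ℕ => (1 / n) * Real.log (partitionSum ψ s n)

theorem sum_append_words {S : ℕ} (g : List (Fin S) → ℝ) (m n : ℕ) :
    ∑ w : Fin (m + n) → Fin S, g (List.ofFn w) =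
      ∑ u : Fin m → Fin S, ∑ w : Fin n → Fin S, g (List.ofFn u ++ List.ofFn w) := by
  rw [← Fintype.sum_prod_type', ← (Fin.appendEquiv m n).sum_comp]
  refine Fintype.sum_congr _ _ fun p => ?_
  rw [← List.ofFn_fin_append]
  rfl

/-! ### Partition sums and the pressure. -/

namespace IsAlmostMultiplicative

variable {S : ℕ} {ψ : List (Fin S) → ℝ} {c b r : ℝ} (h : IsAlmostMultiplicative ψ c b r)
include h

theorem pos (w : List (Fin S)) : 0 < ψ w := (pow_pos h.b_pos _).trans_le (h.pow_le w)

theorem le_one (w : List (Fin S)) : ψ w ≤ 1 :=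
  (h.le_pow w).trans (pow_le_one₀ h.r_pos.le h.r_lt_one.le)

theorem append_le_left (u w : List (Fin S)) : ψ (u ++ w) ≤ ψ u :=
  (h.append_le u w).trans (mul_le_of_le_one_right (h.pos u).le (h.le_one w))

theorem log_r_neg : Real.log r < 0 := Real.log_neg h.r_pos h.r_lt_one

theorem log_b_neg : Real.log b < 0 := Real.log_neg h.b_pos h.b_lt_one

theorem log_c_nonpos : Real.log c ≤ 0 := Real.log_nonpos h.c_pos.le h.c_le_one

theorem log_nonpos (w : List (Fin S)) : Real.log (ψ w) ≤ 0 :=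
  Real.log_nonpos (h.pos w).le (h.le_one w)

theorem log_le (w : List (Fin S)) : Real.log (ψ w) ≤ w.length * Real.log r := by
  rw [← Real.log_pow]
  exact Real.log_le_log (h.pos w) (h.le_pow w)

theorem le_log (w : List (Fin S)) : w.length * Real.log b ≤ Real.log (ψ w) := by
  rw [← Real.log_pow]
  exact Real.log_le_log (pow_pos h.b_pos _) (h.pow_le w)

theorem log_append_le (u w : List (Fin S)) :
    Real.log (ψ (u ++ w)) ≤ Real.log (ψ u) + Real.log (ψ w) := by
  rw [← Real.log_mul (h.pos u).ne' (h.pos w).ne']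
  exact Real.log_le_log (h.pos _) (h.append_le u w)

theorem le_log_append (u w : List (Fin S)) :
    Real.log c + (Real.log (ψ u) + Real.log (ψ w)) ≤ Real.log (ψ (u ++ w)) := by
  rw [← Real.log_mul (h.pos u).ne' (h.pos w).ne',
    ← Real.log_mul h.c_pos.ne' (mul_pos (h.pos u) (h.pos w)).ne']
  exact Real.log_le_log (mul_pos h.c_pos (mul_pos (h.pos u) (h.pos w))) (h.le_append u w)

theorem log_append_le_left (u w : List (Fin S)) : Real.log (ψ (u ++ w)) ≤ Real.log (ψ u) :=
  Real.log_le_log (h.pos _) (h.append_le_left u w)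

theorem partitionSum_zero (s : ℝ) : partitionSum ψ s 0 = 1 := by
  simp [partitionSum, h.nil]

theorem partitionSum_pos [NeZero S] (s : ℝ) (n : ℕ) : 0 < partitionSum ψ s n :=
  Finset.sum_pos (fun _ _ => Real.rpow_pos_of_pos (h.pos _) s) Finset.univ_nonempty

theorem partitionSum_add_le {s : ℝ} (hs : 0 ≤ s) (m n : ℕ) :
    partitionSum ψ s (m + n) ≤ partitionSum ψ s m * partitionSum ψ s n := by
  unfold partitionSum
  rw [sum_append_words (fun w => ψ w ^ s), Finset.sum_mul_sum]
  refine Finset.sum_le_sum fun u _ => Finset.sum_le_sum fun w _ => ?_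
  rw [← Real.mul_rpow (h.pos _).le (h.pos _).le]
  exact Real.rpow_le_rpow (h.pos _).le (h.append_le _ _) hs

theorem le_partitionSum_add {s : ℝ} (hs : 0 ≤ s) (m n : ℕ) :
    c ^ s * (partitionSum ψ s m * partitionSum ψ s n) ≤ partitionSum ψ s (m + n) := by
  unfold partitionSum
  rw [sum_append_words (fun w => ψ w ^ s), Finset.sum_mul_sum, Finset.mul_sum]
  refine Finset.sum_le_sum fun u _ => ?_
  rw [Finset.mul_sum]
  refine Finset.sum_le_sum fun w _ => ?_
  have := h.pos (List.ofFn u)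
  have := h.pos (List.ofFn w)
  have := h.c_pos
  rw [← Real.mul_rpow (h.pos _).le (h.pos _).le, ← Real.mul_rpow h.c_pos.le (by positivity)]
  exact Real.rpow_le_rpow (by positivity) (h.le_append _ _) hs

theorem le_partitionSum [NeZero S] {s : ℝ} (hs : 0 ≤ s) (n : ℕ) :
    (b ^ n) ^ s ≤ partitionSum ψ s n := by
  have h1 : (b ^ n) ^ s ≤ ψ (List.ofFn fun _ : Fin n => (0 : Fin S)) ^ s := by
    refine Real.rpow_le_rpow (pow_pos h.b_pos _).le ?_ hs
    simpa using h.pow_le (List.ofFn fun _ : Fin n => (0 : Fin S))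
  exact h1.trans (Finset.single_le_sum (f := fun w : Fin n → Fin S => ψ (List.ofFn w) ^ s)
    (fun _ _ => (Real.rpow_pos_of_pos (h.pos _) s).le) (Finset.mem_univ _))

theorem partitionSum_add_exponent_le (s : ℝ) {k : ℝ} (hk : 0 ≤ k) (n : ℕ) :
    partitionSum ψ (s + k) n ≤ (r ^ n) ^ k * partitionSum ψ s n := by
  unfold partitionSum
  rw [Finset.mul_sum]
  refine Finset.sum_le_sum fun w _ => ?_
  rw [Real.rpow_add (h.pos _), mul_comm]
  refine mul_le_mul_of_nonneg_right ?_ (Real.rpow_pos_of_pos (h.pos _) s).le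
  refine Real.rpow_le_rpow (h.pos _).le ?_ hk
  simpa using h.le_pow (List.ofFn w)

theorem le_partitionSum_add_exponent (s : ℝ) {k : ℝ} (hk : 0 ≤ k) (n : ℕ) :
    (b ^ n) ^ k * partitionSum ψ s n ≤ partitionSum ψ (s + k) n := by
  unfold partitionSum
  rw [Finset.mul_sum]
  refine Finset.sum_le_sum fun w _ => ?_
  rw [Real.rpow_add (h.pos _), mul_comm]
  refine mul_le_mul_of_nonneg_left ?_ (Real.rpow_pos_of_pos (h.pos _) s).le
  refine Real.rpow_le_rpow (pow_pos h.b_pos _).le ?_ hk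
  simpa using h.pow_le (List.ofFn w)

variable [NeZero S]

/-- Both log Z_n and -(log Z_n + s log c) are subadditive. Fekete's lemma makes the common limit P
the infimum of the first quotients and, up to sign, of the second ones. This gives explicit
two-sided bounds for every n, which the cover and measure estimates need, beyond the existence of
the limit. -/
theorem exists_pressure {s : ℝ} (hs : 0 ≤ s) : ∃ P : ℝ,
    Tendsto (fun n : ℕ => (1 / n) * Real.log (partitionSum ψ s n)) atTop (𝓝 P) ∧
    ∀ n : ℕ, Real.exp (n * P) ≤ partitionSum ψ s n ∧
      partitionSum ψ s n ≤ c ^ (-s) * Real.exp (n * P) := by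
  have hZ := h.partitionSum_pos s
  have hcs : 0 < c ^ s := Real.rpow_pos_of_pos h.c_pos s
  have hsub : Subadditive fun n => Real.log (partitionSum ψ s n) := by
    intro m n
    rw [← Real.log_mul (hZ m).ne' (hZ n).ne']
    exact Real.log_le_log (hZ _) (h.partitionSum_add_le hs m n)
  have hlow : ∀ n : ℕ, s * Real.log b * n ≤ Real.log (partitionSum ψ s n) := by
    intro n
    have := Real.log_le_log (Real.rpow_pos_of_pos (pow_pos h.b_pos n) s) (h.le_partitionSum hs n)
    rw [Real.log_rpow (pow_pos h.b_pos n), Real.log_pow] at this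
    linarith
  have hsup : Subadditive fun n => -(Real.log (partitionSum ψ s n) + Real.log (c ^ s)) := by
    intro m n
    have := Real.log_le_log (mul_pos hcs (mul_pos (hZ m) (hZ n))) (h.le_partitionSum_add hs m n)
    rw [Real.log_mul hcs.ne' (mul_pos (hZ m) (hZ n)).ne',
      Real.log_mul (hZ m).ne' (hZ n).ne'] at this
    linarith
  have hbdd : BddBelow (range fun n : ℕ => Real.log (partitionSum ψ s n) / n) := by
    refine ⟨s * Real.log b, ?_⟩
    rintro _ ⟨n, rfl⟩
    rcases n.eq_zero_or_pos with rfl | hn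
    · simpa using mul_nonpos_of_nonneg_of_nonpos hs h.log_b_neg.le
    · have : (0 : ℝ) < n := by exact_mod_cast hn
      simp only
      rw [le_div_iff₀ this]
      exact hlow n
  have ht := hsub.tendsto_lim hbdd
  have ht2 : Tendsto (fun n : ℕ => -(Real.log (partitionSum ψ s n) + Real.log (c ^ s)) / n) atTop
      (𝓝 (-hsub.lim)) := by
    have h0 : Tendsto (fun n : ℕ => Real.log (c ^ s) / (n : ℝ)) atTop (𝓝 0) :=
      tendsto_const_div_atTop_nhds_zero_nat _
    have := (ht.add h0).neg
    rw [add_zero] at this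
    refine this.congr fun n => ?_
    ring
  have hbdd2 : BddBelow (range fun n : ℕ =>
      -(Real.log (partitionSum ψ s n) + Real.log (c ^ s)) / n) := ht2.bddBelow_range
  have hlim2 : hsup.lim = -hsub.lim := tendsto_nhds_unique (hsup.tendsto_lim hbdd2) ht2
  refine ⟨hsub.lim, ht.congr fun n => by ring, fun n => ?_⟩
  rcases n.eq_zero_or_pos with rfl | hn
  · rw [h.partitionSum_zero]
    simp only [Nat.cast_zero, zero_mul, Real.exp_zero, le_refl, mul_one, true_and]
    rw [Real.rpow_neg h.c_pos.le]
    exact (one_le_inv₀ hcs).2 (Real.rpow_le_one h.c_pos.le h.c_le_one hs)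
  have hn' : (0 : ℝ) < n := by exact_mod_cast hn
  have h1 := hsub.lim_le_div hbdd hn.ne'
  have h2 := hsup.lim_le_div hbdd2 hn.ne'
  rw [hlim2, le_div_iff₀ hn'] at h2
  rw [le_div_iff₀ hn'] at h1
  constructor
  · rw [← Real.le_log_iff_exp_le (hZ n)]; linarith
  · rw [Real.rpow_neg h.c_pos.le, ← Real.exp_log (inv_pos.2 hcs), ← Real.exp_add,
      ← Real.log_le_iff_le_exp (hZ n), Real.log_inv]
    linarith

theorem tendsto_wordPressure {s : ℝ} (hs : 0 ≤ s) :
    Tendsto (fun n : ℕ => (1 / n) * Real.log (partitionSum ψ s n)) atTop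
      (𝓝 (wordPressure ψ s)) := by
  obtain ⟨P, hP, -⟩ := h.exists_pressure hs
  exact tendsto_nhds_limUnder ⟨P, hP⟩

theorem exp_le_partitionSum {s : ℝ} (hs : 0 ≤ s) (n : ℕ) :
    Real.exp (n * wordPressure ψ s) ≤ partitionSum ψ s n := by
  obtain ⟨P, hP, hb⟩ := h.exists_pressure hs
  rw [tendsto_nhds_unique (h.tendsto_wordPressure hs) hP]
  exact (hb n).1

theorem partitionSum_le_exp {s : ℝ} (hs : 0 ≤ s) (n : ℕ) :
    partitionSum ψ s n ≤ c ^ (-s) * Real.exp (n * wordPressure ψ s) := by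
  obtain ⟨P, hP, hb⟩ := h.exists_pressure hs
  rw [tendsto_nhds_unique (h.tendsto_wordPressure hs) hP]
  exact (hb n).2

theorem wordPressure_zero : wordPressure ψ 0 = Real.log S := by
  refine tendsto_nhds_unique (h.tendsto_wordPressure le_rfl) (tendsto_const_nhds.congr' ?_)
  filter_upwards [eventually_gt_atTop 0] with n hn
  have : (n : ℝ) ≠ 0 := by exact_mod_cast hn.ne'
  simp [partitionSum]
  field_simp

theorem wordPressure_add_le {s k : ℝ} (hs : 0 ≤ s) (hk : 0 ≤ k) :
    wordPressure ψ (s + k) ≤ wordPressure ψ s + k * Real.log r := by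
  refine le_of_tendsto_of_tendsto (h.tendsto_wordPressure (add_nonneg hs hk))
    ((h.tendsto_wordPressure hs).add_const (k * Real.log r)) ?_
  filter_upwards [eventually_gt_atTop 0] with n hn
  have hn' : (0 : ℝ) < n := by exact_mod_cast hn
  have := Real.log_le_log (h.partitionSum_pos _ n) (h.partitionSum_add_exponent_le s hk n)
  rw [Real.log_mul (Real.rpow_pos_of_pos (pow_pos h.r_pos n) k).ne' (h.partitionSum_pos _ n).ne',
    Real.log_rpow (pow_pos h.r_pos n), Real.log_pow] at this
  have h2 : k * Real.log r = (1 / n) * (k * (n * Real.log r)) := by field_simp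
  rw [h2, ← mul_add]
  exact mul_le_mul_of_nonneg_left (by linarith) (by positivity)

theorem le_wordPressure_add {s k : ℝ} (hs : 0 ≤ s) (hk : 0 ≤ k) :
    wordPressure ψ s + k * Real.log b ≤ wordPressure ψ (s + k) := by
  refine le_of_tendsto_of_tendsto ((h.tendsto_wordPressure hs).add_const (k * Real.log b))
    (h.tendsto_wordPressure (add_nonneg hs hk)) ?_
  filter_upwards [eventually_gt_atTop 0] with n hn
  have hn' : (0 : ℝ) < n := by exact_mod_cast hn
  have hb := Real.rpow_pos_of_pos (pow_pos h.b_pos n) k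
  have := Real.log_le_log (mul_pos hb (h.partitionSum_pos _ n))
    (h.le_partitionSum_add_exponent s hk n)
  rw [Real.log_mul hb.ne' (h.partitionSum_pos _ n).ne',
    Real.log_rpow (pow_pos h.b_pos n), Real.log_pow] at this
  have h2 : k * Real.log b = (1 / n) * (k * (n * Real.log b)) := by field_simp
  rw [h2, ← mul_add]
  exact mul_le_mul_of_nonneg_left (by linarith) (by positivity)

theorem wordPressure_le_of_le {s s' : ℝ} (hs : 0 ≤ s) (hss : s ≤ s') :
    wordPressure ψ s' ≤ wordPressure ψ s + (s' - s) * Real.log r := by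
  have := h.wordPressure_add_le hs (sub_nonneg.2 hss)
  rwa [add_sub_cancel] at this

theorem le_wordPressure_of_le {s s' : ℝ} (hs : 0 ≤ s) (hss : s ≤ s') :
    wordPressure ψ s + (s' - s) * Real.log b ≤ wordPressure ψ s' := by
  have := h.le_wordPressure_add hs (sub_nonneg.2 hss)
  rwa [add_sub_cancel] at this

theorem continuousOn_wordPressure : ContinuousOn (wordPressure ψ) (Ici 0) := by
  refine LipschitzOnWith.continuousOn (K := (-Real.log b).toNNReal) ?_
  refine LipschitzOnWith.of_dist_le_mul fun x hx y hy => ?_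
  have key : ∀ x y : ℝ, 0 ≤ x → x ≤ y →
      |wordPressure ψ x - wordPressure ψ y| ≤ -Real.log b * |x - y| := by
    intro x y hx hxy
    have h1 := h.wordPressure_le_of_le hx hxy
    have h2 := h.le_wordPressure_of_le hx hxy
    have h3 : (y - x) * Real.log r ≤ 0 :=
      mul_nonpos_of_nonneg_of_nonpos (by linarith) h.log_r_neg.le
    rw [abs_of_nonneg (by linarith), abs_of_nonpos (by linarith : x - y ≤ 0)]
    linarith
  rw [Real.coe_toNNReal _ (by linarith [h.log_b_neg]), Real.dist_eq, Real.dist_eq]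
  rcases le_total x y with hxy | hxy
  · exact key x y hx hxy
  · rw [abs_sub_comm, abs_sub_comm x y]
    exact key y x hy hxy

/-- The difference of the two sides is continuous and strictly decreasing in s, with slope at most
log r < 0. It equals log S ≥ 0 at 0 and is at most 0 at T = log S / (-log r). -/
theorem existsUnique_pressure_eq {κ Ω : ℝ} (hκ : 0 ≤ κ) (hΩ : Ω ≤ 0) :
    ∃! s : ℝ, 0 ≤ s ∧ wordPressure ψ s = -s * κ * Ω := by
  have hr := h.log_r_neg
  have hκΩ : κ * Ω ≤ 0 := mul_nonpos_of_nonneg_of_nonpos hκ hΩ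
  have hlogS : 0 ≤ Real.log S := Real.log_natCast_nonneg S
  set T := Real.log S / (-Real.log r) with hT
  have hT0 : 0 ≤ T := div_nonneg hlogS (by linarith)
  have hcont : ContinuousOn (fun s => wordPressure ψ s + s * κ * Ω) (Icc 0 T) :=
    (h.continuousOn_wordPressure.mono fun x hx => hx.1).add (by fun_prop)
  have h0 : (0 : ℝ) ∈ Icc ((fun s => wordPressure ψ s + s * κ * Ω) T)
      ((fun s => wordPressure ψ s + s * κ * Ω) 0) := by
    constructor
    · have h1 := h.wordPressure_le_of_le le_rfl hT0
      rw [h.wordPressure_zero, sub_zero] at h1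
      have h2 : T * Real.log r = -Real.log S := by
        rw [hT, div_neg, neg_mul, div_mul_cancel₀ _ hr.ne]
      have h3 : T * (κ * Ω) ≤ 0 := mul_nonpos_of_nonneg_of_nonpos hT0 hκΩ
      simp only
      linarith
    · simpa [h.wordPressure_zero] using hlogS
  obtain ⟨s, hs, hs0⟩ := intermediate_value_Icc' hT0 hcont h0
  simp only at hs0
  have key : ∀ x y : ℝ, 0 ≤ x → x < y → wordPressure ψ x = -x * κ * Ω →
      wordPressure ψ y ≠ -y * κ * Ω := by
    intro x y hx hxy h1 h2
    have h3 := h.wordPressure_le_of_le hx hxy.le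
    have h4 : (y - x) * Real.log r < 0 := mul_neg_of_pos_of_neg (by linarith) hr
    have h5 : (y - x) * (κ * Ω) ≤ 0 := mul_nonpos_of_nonneg_of_nonpos (by linarith) hκΩ
    nlinarith
  refine ⟨s, ⟨hs.1, by linarith⟩, fun y ⟨hy0, hy⟩ => ?_⟩
  rcases lt_trichotomy y s with hys | hys | hys
  · exact absurd (by linarith) (key y s hy0 hys hy)
  · exact hys
  · exact absurd hy (key s y hs.1 hys (by linarith))

end IsAlmostMultiplicative

/-! ### Occurrences of the target, overlaps and first hits. -/

section

variable {S : ℕ}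

theorem iterate_shift_apply (m : ℕ) (e : ℕ → Fin S) (n : ℕ) : shift^[m] e n = e (m + n) := by
  induction m generalizing e with
  | zero => simp
  | succ m ih =>
    rw [Function.iterate_succ_apply, ih]
    exact congrArg e (by omega)

/-- The first `k` digits of `t` occur in `e` at the position `m`. -/
def OccursAt (e t : ℕ → Fin S) (m k : ℕ) : Prop := ∀ i < k, e (m + i) = t i

theorem OccursAt.mono {e t : ℕ → Fin S} {m k l : ℕ} (h : OccursAt e t m k) (hl : l ≤ k) :
    OccursAt e t m l := fun i hi => h i (hi.trans_le hl)

theorem mem_hittingSet {a : ℕ → ℕ} {e t : ℕ → Fin S} :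
    e ∈ hittingSet a t ↔ ∃ N, ∀ n ≥ N, ∃ m ≤ n, OccursAt e t m (a n) := by
  simp only [hittingSet, eventuallyAlwaysHitting, mem_ofPred_eq, PiNat.cylinder,
    iterate_shift_apply]
  rfl

theorem hittingSet_mono {a b : ℕ → ℕ} {t : ℕ → Fin S} (hab : ∀ᶠ n in atTop, b n ≤ a n) :
    hittingSet a t ⊆ hittingSet b t := by
  intro e he
  rw [mem_hittingSet] at he ⊢
  obtain ⟨N, hN⟩ := he
  obtain ⟨N', hN'⟩ := eventually_atTop.1 hab
  refine ⟨max N N', fun n hn => ?_⟩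
  obtain ⟨m, hm, hocc⟩ := hN n (le_of_max_le_left hn)
  exact ⟨m, hm, hocc.mono (hN' n (le_of_max_le_right hn))⟩

theorem preOrbit_subset_hittingSet (a : ℕ → ℕ) (t : ℕ → Fin S) :
    preOrbit t ⊆ hittingSet a t := by
  rintro e ⟨k, rfl⟩
  rw [mem_hittingSet]
  exact ⟨k, fun n hn => ⟨k, hn, fun i _ => (iterate_shift_apply k e i).symm⟩⟩

theorem countable_preOrbit (t : ℕ → Fin S) : (preOrbit t).Countable := by
  have hinj : Function.Injective fun e : ℕ → Fin S => (firstDigits e 1, shift e) := by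
    intro e e' hee
    simp only [firstDigits, Prod.mk.injEq, List.range_succ, List.range_zero, List.nil_append,
      List.map_cons, List.map_nil, List.cons.injEq, and_true] at hee
    funext n
    cases n with
    | zero => exact hee.1
    | succ n => exact congrFun hee.2 n
  have hk : ∀ k : ℕ, {e : ℕ → Fin S | shift^[k] e = t}.Countable := by
    intro k
    induction k with
    | zero => exact (countable_singleton t).mono fun e he => he
    | succ k ih =>
      have : MapsTo (fun e : ℕ → Fin S => (firstDigits e 1, shift e))
          {e : ℕ → Fin S | shift^[k + 1] e = t}
          ((univ : Set (List (Fin S))) ×ˢ {e : ℕ → Fin S | shift^[k] e = t}) :=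
        fun e he => ⟨mem_univ _, he⟩
      exact this.countable_of_injOn hinj.injOn ((to_countable _).prod ih)
  have : preOrbit t = ⋃ k : ℕ, {e : ℕ → Fin S | shift^[k] e = t} := by
    ext e; simp [preOrbit]
  rw [this]
  exact countable_iUnion hk

/-- A long self-overlap of an admissible target is a period. -/
theorem exists_overlap_bound {t : ℕ → Fin S} (ht : t ∈ admissibleTargets S) :
    ∃ L, ∀ m, OccursAt t t m L → ∀ k, OccursAt t t m k := by
  obtain ⟨N, hN⟩ := ht
  refine ⟨N + 1, fun m hm k => ?_⟩
  suffices H : ∀ j, OccursAt t t m (N + 1 + j) from (H k).mono (by omega)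
  intro j
  induction j with
  | zero => exact hm
  | succ j ih =>
    intro i hi
    rcases Nat.lt_or_ge i (N + 1 + j) with hi' | hi'
    · exact ih i hi'
    obtain rfl : i = N + 1 + j := by omega
    by_contra hne
    -- If the overlap broke at this position n, putting the predicted digit there would turn the
    -- block from m to n into a prefix of t, which admissibility excludes. The starting length N + 1
    -- ensures n ≥ N and m < n.
    refine hN (m + (N + 1 + j)) (by omega) m (by omega) _ (Ne.symm hne) fun k hk => ?_
    rcases Nat.lt_or_ge k (N + 1 + j) with hk' | hk'
    · rw [Function.update_of_ne (by omega)]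
      exact ih k hk'
    · obtain rfl : k = N + 1 + j := by omega
      rw [Function.update_self]

/-- For large n the target length exceeds n + 1 + L, while the hits for n and n + 1 start at or
before n + 1. The two occurrences therefore overlap in at least L digits, their displacement is a
period of t, and both read the same infinite continuation from position n + 1 on. Chaining over n
identifies the whole tail of e with a tail of t. -/
theorem hittingSet_subset_preOrbit {t : ℕ → Fin S} (ht : t ∈ admissibleTargets S) {a : ℕ → ℕ}
    {v : ℝ} (hv : 1 < v) (ha : ∀ᶠ n in atTop, v * n ≤ a n) : hittingSet a t ⊆ preOrbit t := by
  obtain ⟨L, hL⟩ := exists_overlap_bound ht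
  intro e he
  obtain ⟨N, hN⟩ := mem_hittingSet.1 he
  obtain ⟨N₁, hN₁⟩ := eventually_atTop.1 ha
  obtain ⟨N₂, hN₂⟩ := exists_nat_ge ((L + 1) / (v - 1))
  set K := max N (max N₁ N₂) with hK
  have hlong : ∀ n ≥ K, n + 1 + L ≤ a n := by
    intro n hn
    have h1 := hN₁ n (by omega)
    have h2 : ((L : ℝ) + 1) / (v - 1) ≤ n := hN₂.trans (by exact_mod_cast (by omega : N₂ ≤ n))
    rw [div_le_iff₀ (by linarith)] at h2
    have : ((n + 1 + L : ℕ) : ℝ) ≤ a n := by push_cast; nlinarith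
    exact_mod_cast this
  have hp : ∀ n, ∃ m, n ≥ K → m ≤ n ∧ OccursAt e t m (a n) := by
    intro n
    by_cases hn : n ≥ K
    · obtain ⟨m, hm⟩ := hN n (by omega)
      exact ⟨m, fun _ => hm⟩
    · exact ⟨0, fun h => absurd h hn⟩
  choose p hp using hp
  -- consecutive occurrences predict the same continuation
  have hstep : ∀ n ≥ K, ∀ i, t (n - p n + (i + 1)) = t (n + 1 - p (n + 1) + i) := by
    intro n hn i
    obtain ⟨h1, h1'⟩ := hp n hn
    obtain ⟨h2, h2'⟩ := hp (n + 1) (by omega)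
    have hl1 := hlong n hn
    have hl2 := hlong (n + 1) (by omega)
    rcases le_total (p n) (p (n + 1)) with hle | hle
    · have := hL (p (n + 1) - p n) (fun j hj => by
        have e1 := h1' (p (n + 1) - p n + j) (by omega)
        have e2 := h2' j (by omega)
        rw [← e1, ← e2]
        exact congrArg e (by omega)) (n + 1 - p (n + 1) + i + 1) (n + 1 - p (n + 1) + i) (by omega)
      rw [← this]
      exact congrArg t (by omega)
    · have := hL (p n - p (n + 1)) (fun j hj => by
        have e1 := h2' (p n - p (n + 1) + j) (by omega)
        have e2 := h1' j (by omega)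
        rw [← e1, ← e2]
        exact congrArg e (by omega)) (n - p n + (i + 1) + 1) (n - p n + (i + 1)) (by omega)
      rw [← this]
      exact congrArg t (by omega)
  have htail : ∀ j i, t (K - p K + (j + i)) = t (K + j - p (K + j) + i) := by
    intro j
    induction j with
    | zero => intro i; simp
    | succ j ih =>
      intro i
      have := hstep (K + j) (by omega) i
      rw [show K + (j + 1) = K + j + 1 by omega, ← this, ← ih]
      exact congrArg t (by omega)
  have hval : ∀ j, e (K + j) = t (K - p K + j) := by
    intro j
    have h1 := htail j 0
    rw [add_zero] at h1
    rw [h1, add_zero, ← (hp (K + j) (by omega)).2 _ (by have := hlong (K + j) (by omega); omega)]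
    exact congrArg e (by have := (hp (K + j) (by omega)).1; omega)
  refine ⟨p K, funext fun i => ?_⟩
  rw [iterate_shift_apply]
  obtain ⟨h1, h2⟩ := hp K le_rfl
  rcases Nat.lt_or_ge i (a K) with hi | hi
  · exact h2 i hi
  · have := hlong K le_rfl
    have h3 := hval (p K + i - K)
    rw [show K + (p K + i - K) = p K + i by omega] at h3
    rw [h3]
    exact congrArg t (by omega)

/-- The first position at which the `n`-th target is hit. -/
noncomputable def firstHit (a : ℕ → ℕ) (t e : ℕ → Fin S) (n : ℕ) : ℕ :=
  sInf {m | OccursAt e t m (a n)}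

theorem firstHit_spec {a : ℕ → ℕ} {t e : ℕ → Fin S} {n m : ℕ} (h : OccursAt e t m (a n)) :
    OccursAt e t (firstHit a t e n) (a n) ∧ firstHit a t e n ≤ m :=
  ⟨Nat.sInf_mem (s := {m | OccursAt e t m (a n)}) ⟨m, h⟩, Nat.sInf_le h⟩

theorem eventually_firstHit {a : ℕ → ℕ} {t e : ℕ → Fin S} (he : e ∈ hittingSet a t) :
    ∀ᶠ n in atTop, OccursAt e t (firstHit a t e n) (a n) ∧ firstHit a t e n ≤ n := by
  obtain ⟨N, hN⟩ := mem_hittingSet.1 he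
  filter_upwards [eventually_ge_atTop N] with n hn
  obtain ⟨m, hm, hocc⟩ := hN n hn
  exact ⟨(firstHit_spec hocc).1, (firstHit_spec hocc).2.trans hm⟩

/-- Otherwise, by pigeonhole, one fixed position carries arbitrarily long prefixes of t, so the
sequence equals t from there on. -/
theorem tendsto_firstHit {a : ℕ → ℕ} {t e : ℕ → Fin S} (he : e ∈ hittingSet a t)
    (he' : e ∉ preOrbit t) (ha : Tendsto a atTop atTop) :
    Tendsto (firstHit a t e) atTop atTop := by
  rw [tendsto_atTop]
  by_contra! hb
  obtain ⟨B, hB⟩ := hb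
  have h1 : ∃ᶠ n in atTop, ∃ m < B, OccursAt e t m (a n) :=
    (hB.and_eventually (eventually_firstHit he)).mono
      fun n hn => ⟨_, hn.1, hn.2.1⟩
  have h2 : ∃ m, ∃ᶠ n in atTop, OccursAt e t m (a n) := by
    by_contra! hne
    have : ∀ᶠ n in atTop, ∀ m ∈ Finset.range B, ¬ OccursAt e t m (a n) := by
      rw [Finset.eventually_all]
      exact fun m _ => hne m
    obtain ⟨n, ⟨m, hm, hocc⟩, hn⟩ := (h1.and_eventually this).exists
    exact hn m (Finset.mem_range.2 hm) hocc
  obtain ⟨m, hm⟩ := h2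
  refine he' ⟨m, funext fun i => ?_⟩
  obtain ⟨n, hn, hi⟩ := (hm.and_eventually (ha.eventually_gt_atTop i)).exists
  rw [iterate_shift_apply]
  exact hn i hi

/-- The occurrence preceding a first hit ends, up to a bounded overlap, before that hit. -/
theorem firstHit_separated {a : ℕ → ℕ} {t e : ℕ → Fin S} {L : ℕ}
    (hL : ∀ m, OccursAt t t m L → ∀ k, OccursAt t t m k) {n x k : ℕ}
    (hn : OccursAt e t (firstHit a t e n) (a n)) (hx : OccursAt e t x k)
    (hxn : x < firstHit a t e n) (han : L ≤ a n) : x + k ≤ firstHit a t e n + L := by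
  by_contra! hlt
  set M := firstHit a t e n with hM
  -- An overlap longer than L makes M - x a period of t. The occurrence at x would then extend to
  -- the full target length, against the minimality of M.
  have hper := hL (M - x) fun i hi => by
    have e1 := hx (M - x + i) (by omega)
    have e2 := hn i (by omega)
    rw [← e1, ← e2]
    exact congrArg e (by omega)
  have : OccursAt e t x (a n) := by
    intro i hi
    rcases Nat.lt_or_ge i k with hik | hik
    · exact hx i hik
    · have e1 := hn (i - (M - x)) (by omega)
      have e2 := hper (i + 1) (i - (M - x)) (by omega)
      rw [← e2] at e1
      rw [show x + i = M + (i - (M - x)) by omega, e1]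
      exact congrArg t (by omega)
  exact absurd (firstHit_spec this).2 (by omega)

end

/-! ### Covers by words with prescribed blocks. -/

section

variable {S : ℕ}

theorem length_firstDigits (t : ℕ → Fin S) (n : ℕ) : (firstDigits t n).length = n := by
  simp [firstDigits]

theorem firstDigits_add (e : ℕ → Fin S) (m n : ℕ) :
    firstDigits e (m + n) = firstDigits e m ++ firstDigits (fun i => e (m + i)) n := by
  simp [firstDigits, List.range_add]

theorem firstDigits_eq_ofFn (e : ℕ → Fin S) (n : ℕ) :
    firstDigits e n = List.ofFn fun i : Fin n => e i := by
  refine List.ext_getElem (by simp [firstDigits]) fun i h1 h2 => by simp [firstDigits]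

theorem OccursAt.firstDigits_eq {e t : ℕ → Fin S} {m k : ℕ} (h : OccursAt e t m k) :
    firstDigits (fun i => e (m + i)) k = firstDigits t k :=
  List.map_congr_left fun i hi => h i (List.mem_range.1 hi)

/-- The words of length `n`. -/
def wordsOfLength (S n : ℕ) : Finset (List (Fin S)) :=
  Finset.univ.image (List.ofFn : (Fin n → Fin S) → List (Fin S))

theorem firstDigits_mem_wordsOfLength (e : ℕ → Fin S) (n : ℕ) :
    firstDigits e n ∈ wordsOfLength S n := by
  rw [firstDigits_eq_ofFn]
  exact Finset.mem_image_of_mem _ (Finset.mem_univ _)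

theorem length_of_mem_wordsOfLength {n : ℕ} {w : List (Fin S)} (hw : w ∈ wordsOfLength S n) :
    w.length = n := by
  obtain ⟨u, -, rfl⟩ := Finset.mem_image.1 hw
  simp

/-- The words of length `M` in which prefixes of `t` of the given lengths occur one after the
other, the last one being listed first. -/
def blockWords (t : ℕ → Fin S) : List ℕ → ℕ → Finset (List (Fin S))
  | [], M => wordsOfLength S M
  | l :: ls, M => (((Finset.range (M + 1)).filter (fun x => x + l ≤ M)).sigma
      (fun x => blockWords t ls x ×ˢ wordsOfLength S (M - (x + l)))).image
      (fun p => p.2.1 ++ (firstDigits t l ++ p.2.2))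

theorem length_of_mem_blockWords {t : ℕ → Fin S} {ls : List ℕ} {M : ℕ} {w : List (Fin S)}
    (hw : w ∈ blockWords t ls M) : w.length = M := by
  induction ls generalizing M w with
  | nil => exact length_of_mem_wordsOfLength hw
  | cons l ls ih =>
    obtain ⟨⟨x, u, v⟩, hp, rfl⟩ := Finset.mem_image.1 hw
    simp only [Finset.mem_sigma, Finset.mem_filter, Finset.mem_product] at hp
    obtain ⟨⟨-, hx⟩, hu, hv⟩ := hp
    simp only [List.length_append, length_firstDigits, ih hu, length_of_mem_wordsOfLength hv]
    omega

theorem firstDigits_mem_blockWords {t e : ℕ → Fin S} {ls : List ℕ} {M x l : ℕ}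
    (hx : firstDigits e x ∈ blockWords t ls x) (ho : OccursAt e t x l) (hM : x + l ≤ M) :
    firstDigits e M ∈ blockWords t (l :: ls) M := by
  refine Finset.mem_image.2 ⟨⟨x, firstDigits e x,
    firstDigits (fun i => e (x + l + i)) (M - (x + l))⟩, ?_, ?_⟩
  · simp only [Finset.mem_sigma, Finset.mem_filter, Finset.mem_range, Finset.mem_product]
    exact ⟨⟨by omega, hM⟩, hx, firstDigits_mem_wordsOfLength _ _⟩
  · simp only
    rw [← ho.firstDigits_eq, ← List.append_assoc, ← firstDigits_add, ← firstDigits_add]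
    congr 1; omega

namespace IsAlmostMultiplicative

variable {ψ : List (Fin S) → ℝ} {c b r : ℝ} (h : IsAlmostMultiplicative ψ c b r)
include h

theorem sum_wordsOfLength_le [NeZero S] {s Q : ℝ} (hs : 0 ≤ s) (hQ : wordPressure ψ s ≤ Q)
    (n : ℕ) : ∑ w ∈ wordsOfLength S n, ψ w ^ s ≤ c ^ (-s) * Real.exp (n * Q) := by
  refine (Finset.sum_image_le_of_nonneg fun w _ =>
    (Real.rpow_pos_of_pos (h.pos w) s).le).trans ?_
  refine (h.partitionSum_le_exp hs n).trans ?_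
  refine mul_le_mul_of_nonneg_left (Real.exp_le_exp.2 ?_) (Real.rpow_pos_of_pos h.c_pos _).le
  exact mul_le_mul_of_nonneg_left hQ (Nat.cast_nonneg n)

/-- Free digits contribute e^Q each and a block contributes its own ψ^s. The positions of k blocks
can be chosen in at most (M + 1)^k ways, and each of the k + 1 free stretches costs one constant
c^{-s}. For fixed k only the exponential matters. -/
theorem sum_blockWords_le [NeZero S] (t : ℕ → Fin S) {s Q : ℝ} (hs : 0 ≤ s)
    (hQ : wordPressure ψ s ≤ Q) (ls : List ℕ) (M : ℕ) :
    ∑ w ∈ blockWords t ls M, ψ w ^ s ≤ (c ^ (-s)) ^ (ls.length + 1) * (M + 1) ^ ls.length *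
      Real.exp (Q * (M - ls.sum) +
        s * (ls.map fun l => Real.log (ψ (firstDigits t l))).sum) := by
  have hC : 0 < c ^ (-s) := Real.rpow_pos_of_pos h.c_pos _
  induction ls generalizing M with
  | nil =>
    simpa [blockWords, mul_comm] using h.sum_wordsOfLength_le hs hQ M
  | cons l ls ih =>
    set A := (ls.map fun l => Real.log (ψ (firstDigits t l))).sum with hA
    set C := c ^ (-s) with hCdef
    set k := ls.length with hk
    refine (Finset.sum_image_le_of_nonneg fun w _ =>
      (Real.rpow_pos_of_pos (h.pos w) s).le).trans ?_
    rw [Finset.sum_sigma]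
    have hx : ∀ x ∈ (Finset.range (M + 1)).filter (fun x => x + l ≤ M),
        ∑ p ∈ blockWords t ls x ×ˢ wordsOfLength S (M - (x + l)),
          ψ (p.1 ++ (firstDigits t l ++ p.2)) ^ s ≤
        C ^ (k + 2) * (M + 1) ^ k * Real.exp (Q * (M - (l + ls.sum)) +
          s * (Real.log (ψ (firstDigits t l)) + A)) := by
      intro x hx
      have hxl := (Finset.mem_filter.1 hx).2
      rw [Finset.sum_product]
      calc ∑ u ∈ blockWords t ls x, ∑ w ∈ wordsOfLength S (M - (x + l)),
            ψ (u ++ (firstDigits t l ++ w)) ^ s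
          ≤ ∑ u ∈ blockWords t ls x, ∑ w ∈ wordsOfLength S (M - (x + l)),
            ψ u ^ s * ψ (firstDigits t l) ^ s * ψ w ^ s := by
            refine Finset.sum_le_sum fun u _ => Finset.sum_le_sum fun w _ => ?_
            rw [← Real.mul_rpow (h.pos _).le (h.pos _).le,
              ← Real.mul_rpow (mul_pos (h.pos _) (h.pos _)).le (h.pos _).le]
            refine Real.rpow_le_rpow (h.pos _).le ?_ hs
            refine (h.append_le _ _).trans ?_
            rw [mul_assoc]
            exact mul_le_mul_of_nonneg_left (h.append_le _ _) (h.pos _).le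
        _ = (∑ u ∈ blockWords t ls x, ψ u ^ s) * ψ (firstDigits t l) ^ s *
            ∑ w ∈ wordsOfLength S (M - (x + l)), ψ w ^ s := by
            rw [Finset.sum_mul, Finset.sum_mul_sum]
        _ ≤ (C ^ (k + 1) * (M + 1) ^ k * Real.exp (Q * (x - ls.sum) + s * A)) *
            ψ (firstDigits t l) ^ s * (C * Real.exp ((M - (x + l) : ℕ) * Q)) := by
            have hψ : 0 < ψ (firstDigits t l) ^ s := Real.rpow_pos_of_pos (h.pos _) s
            have hn : 0 ≤ ∑ w ∈ wordsOfLength S (M - (x + l)), ψ w ^ s :=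
              Finset.sum_nonneg fun w _ => (Real.rpow_pos_of_pos (h.pos w) s).le
            refine mul_le_mul (mul_le_mul_of_nonneg_right ((ih x).trans ?_) hψ.le)
              (h.sum_wordsOfLength_le hs hQ _) hn (by positivity)
            have : (x : ℝ) ≤ M := by exact_mod_cast (by omega : x ≤ M)
            gcongr
        _ = _ := by
            rw [Real.rpow_def_of_pos (h.pos _), Nat.cast_sub hxl]
            have : ∀ a b c d e f : ℝ, a * b * c * d * (e * f) = (a * e) * b * (c * d * f) := by
              intros; ring
            rw [this, ← Real.exp_add, ← Real.exp_add, ← pow_succ]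
            congr 2
            push_cast
            ring
    refine (Finset.sum_le_card_nsmul _ _ _ hx).trans ?_
    rw [nsmul_eq_mul]
    have hcard : (((Finset.range (M + 1)).filter (fun x => x + l ≤ M)).card : ℝ) ≤ M + 1 := by
      have := Finset.card_filter_le (Finset.range (M + 1)) (fun x => x + l ≤ M)
      rw [Finset.card_range] at this
      exact_mod_cast this
    refine (mul_le_mul_of_nonneg_right hcard (by positivity)).trans (le_of_eq ?_)
    simp only [List.length_cons, List.sum_cons, List.map_cons, Nat.cast_add]
    rw [← hk, ← hA]
    ring

end IsAlmostMultiplicative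

namespace ConformalIFS

variable {d : ℕ} (F : ConformalIFS d S) [Nontrivial (EuclideanSpace ℝ (Fin d))]

theorem ediam_image_word_le (w : List (Fin S)) :
    Metric.ediam (F.wordMap w '' closure F.U) ≤
      ENNReal.ofReal (F.derivNorm w * Metric.diam (closure F.U)) := by
  refine Metric.ediam_le fun x hx y hy => ?_
  obtain ⟨x, hx, rfl⟩ := hx
  obtain ⟨y, hy, rfl⟩ := hy
  rw [edist_dist]
  refine ENNReal.ofReal_le_ofReal ((F.dist_word_le w hx hy).trans ?_)
  exact mul_le_mul_of_nonneg_left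
    (Metric.dist_le_diam_of_mem F.isCompact_closure_U.isBounded hx hy) (F.derivNorm_pos w).le

/-- If the cylinders that infinitely often contain the points of a set have summable
`s`-th powers of diameters, then the set has dimension at most `s`. -/
theorem dimH_coding_le_of_summable (s : ℝ≥0) (W : ℕ → Finset (List (Fin S)))
    (hlen : ∀ M, ∀ w ∈ W M, M ≤ w.length)
    (hsum : Summable fun M => ∑ w ∈ W M, F.derivNorm w ^ (s : ℝ)) (X : Set (ℕ → Fin S))
    (hX : ∀ e ∈ X, ∃ᶠ M in atTop, ∃ w ∈ W M, firstDigits e w.length = w) :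
    dimH (F.coding '' X) ≤ s := by
  obtain ⟨c, b, r, h⟩ := F.exists_isAlmostMultiplicative
  set D := Metric.diam (closure F.U) with hD
  have hD0 : 0 ≤ D := Metric.diam_nonneg
  refine dimH_le_of_hausdorffMeasure_ne_top ?_
  have hr : Tendsto (fun n : ℕ => ENNReal.ofReal (r ^ n * D)) atTop (𝓝 0) := by
    have := (tendsto_pow_atTop_nhds_zero_of_lt_one h.r_pos.le h.r_lt_one).mul_const D
    rw [zero_mul] at this
    simpa using ENNReal.tendsto_ofReal this
  let g : ℕ → ℝ≥0∞ := fun M => ENNReal.ofReal (∑ w ∈ W M, F.derivNorm w ^ (s : ℝ)) *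
    ENNReal.ofReal (D ^ (s : ℝ))
  have hg : ∑' M, g M ≠ ∞ := by
    rw [ENNReal.tsum_mul_right]
    exact ENNReal.mul_ne_top (hsum.tsum_ofReal_ne_top) ENNReal.ofReal_ne_top
  -- The n-th cover consists of the cylinders of all words in `W M` with M ≥ n, indexed by k = M -
  -- n. Its s-sum is a tail of a convergent series, so the Hausdorff measure is even 0.
  have hbound := MeasureTheory.Measure.hausdorffMeasure_le_liminf_tsum (β := ℕ)
    (ι := fun n => Σ k : ℕ, W (k + n)) (s : ℝ) (F.coding '' X) (l := atTop)
    (fun n => ENNReal.ofReal (r ^ n * D)) hr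
    (fun n p => F.wordMap p.2.1 '' closure F.U)
    (Eventually.of_forall fun n p => by
      refine (F.ediam_image_word_le _).trans (ENNReal.ofReal_le_ofReal ?_)
      refine mul_le_mul_of_nonneg_right ((h.le_pow _).trans ?_) hD0
      have := hlen _ _ p.2.2
      exact pow_le_pow_of_le_one h.r_pos.le h.r_lt_one.le (by omega))
    (Eventually.of_forall fun n => by
      rintro _ ⟨e, he, rfl⟩
      obtain ⟨M, ⟨w, hw, hwe⟩, hM⟩ := ((hX e he).and_eventually (eventually_ge_atTop n)).exists
      refine mem_iUnion.2 ⟨⟨M - n, ⟨w, ?_⟩⟩, ?_⟩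
      · rwa [Nat.sub_add_cancel hM]
      · have := F.coding_mem_closure e w.length
        rwa [hwe] at this)
  have hle : ∀ n, ∑' p : (Σ k : ℕ, W (k + n)),
      Metric.ediam (F.wordMap p.2.1 '' closure F.U) ^ (s : ℝ) ≤ ∑' k, g (k + n) := by
    intro n
    rw [ENNReal.tsum_sigma']
    refine ENNReal.tsum_le_tsum fun k => ?_
    refine le_of_eq_of_le (Finset.tsum_subtype (W (k + n)) (fun w =>
      Metric.ediam (F.wordMap w '' closure F.U) ^ (s : ℝ))) ?_
    simp only [g]
    rw [ENNReal.ofReal_sum_of_nonneg fun w _ => (Real.rpow_pos_of_pos (h.pos w) _).le,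
      Finset.sum_mul]
    refine Finset.sum_le_sum fun w _ => ?_
    rw [← ENNReal.ofReal_mul (Real.rpow_pos_of_pos (h.pos w) _).le,
      ← Real.mul_rpow (h.pos w).le hD0,
      ← ENNReal.ofReal_rpow_of_nonneg (mul_nonneg (h.pos w).le hD0) s.coe_nonneg]
    exact ENNReal.rpow_le_rpow (F.ediam_image_word_le w) s.coe_nonneg
  have hzero : liminf (fun n => ∑' p : (Σ k : ℕ, W (k + n)),
      Metric.ediam (F.wordMap p.2.1 '' closure F.U) ^ (s : ℝ)) atTop = 0 :=
    (tendsto_of_tendsto_of_tendsto_of_le_of_le tendsto_const_nhds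
      (ENNReal.tendsto_sum_nat_add g hg) (fun _ => zero_le) hle).liminf_eq
  rw [hzero] at hbound
  exact ne_top_of_le_ne_top ENNReal.zero_ne_top hbound

/-- A set of sequences in which, at infinitely many positions `M`, a long prefix of `t` occurs
and is preceded by prescribed blocks has dimension at most `s` as soon as the cost of this
pattern is exponentially small. -/
theorem dimH_coding_le_of_blocks [NeZero S] (t : ℕ → Fin S) (s : ℝ≥0) {Q : ℝ}
    (hQ : wordPressure F.derivNorm s ≤ Q) (k : ℕ)
    (ls : ℕ → List ℕ) (hk : ∀ M, (ls M).length = k) (l : ℕ → ℕ) {γ : ℝ} (hγ : 0 < γ)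
    (hexp : ∀ᶠ M : ℕ in atTop, Q * (M - (ls M).sum) +
      s * ((ls M).map fun l => Real.log (F.derivNorm (firstDigits t l))).sum +
      s * Real.log (F.derivNorm (firstDigits t (l M))) ≤ -γ * M) (X : Set (ℕ → Fin S))
    (hX : ∀ e ∈ X, ∃ᶠ M in atTop,
      firstDigits e M ∈ blockWords t (ls M) M ∧ OccursAt e t M (l M)) :
    dimH (F.coding '' X) ≤ s := by
  obtain ⟨c, b, r, h⟩ := F.exists_isAlmostMultiplicative
  have hC : 0 < c ^ (-(s : ℝ)) := Real.rpow_pos_of_pos h.c_pos _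
  refine F.dimH_coding_le_of_summable s
    (fun M => (blockWords t (ls M) M).image (· ++ firstDigits t (l M))) ?_ ?_ X ?_
  · intro M w hw
    obtain ⟨u, hu, rfl⟩ := Finset.mem_image.1 hw
    rw [List.length_append, length_of_mem_blockWords hu]
    omega
  · have hgeom : Summable fun M : ℕ => (c ^ (-(s : ℝ))) ^ (k + 1) * Real.exp γ *
        (((M + 1 : ℕ) : ℝ) ^ k * Real.exp (-γ) ^ (M + 1)) := by
      have hlt : ‖Real.exp (-γ)‖ < 1 := by
        rw [Real.norm_eq_abs, abs_of_pos (Real.exp_pos _), Real.exp_lt_one_iff]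
        linarith
      have h0 : Summable fun n : ℕ => (n : ℝ) ^ k * Real.exp (-γ) ^ n :=
        summable_pow_mul_geometric_of_norm_lt_one k hlt
      exact ((summable_nat_add_iff (f := fun n : ℕ => (n : ℝ) ^ k * Real.exp (-γ) ^ n) 1).2
        h0).mul_left _
    refine Summable.of_norm_bounded_eventually_nat hgeom ?_
    filter_upwards [hexp] with M hM
    rw [Real.norm_of_nonneg (Finset.sum_nonneg fun w _ => (Real.rpow_pos_of_pos (h.pos w) _).le)]
    refine (Finset.sum_image_le_of_nonneg fun w _ =>
      (Real.rpow_pos_of_pos (h.pos w) _).le).trans ?_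
    calc ∑ u ∈ blockWords t (ls M) M, F.derivNorm (u ++ firstDigits t (l M)) ^ (s : ℝ)
        ≤ ∑ u ∈ blockWords t (ls M) M,
            F.derivNorm u ^ (s : ℝ) * F.derivNorm (firstDigits t (l M)) ^ (s : ℝ) := by
          refine Finset.sum_le_sum fun u _ => ?_
          rw [← Real.mul_rpow (h.pos _).le (h.pos _).le]
          exact Real.rpow_le_rpow (h.pos _).le (h.append_le _ _) s.coe_nonneg
      _ = (∑ u ∈ blockWords t (ls M) M, F.derivNorm u ^ (s : ℝ)) *
            F.derivNorm (firstDigits t (l M)) ^ (s : ℝ) := by rw [Finset.sum_mul]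
      _ ≤ ((c ^ (-(s : ℝ))) ^ (k + 1) * (M + 1) ^ k * Real.exp (Q * (M - (ls M).sum) +
            s * ((ls M).map fun l => Real.log (F.derivNorm (firstDigits t l))).sum)) *
            F.derivNorm (firstDigits t (l M)) ^ (s : ℝ) := by
          refine mul_le_mul_of_nonneg_right ?_ (Real.rpow_pos_of_pos (h.pos _) _).le
          have := h.sum_blockWords_le t s.coe_nonneg hQ (ls M) M
          rwa [hk] at this
      _ = (c ^ (-(s : ℝ))) ^ (k + 1) * (M + 1) ^ k * Real.exp (Q * (M - (ls M).sum) +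
            s * ((ls M).map fun l => Real.log (F.derivNorm (firstDigits t l))).sum +
            s * Real.log (F.derivNorm (firstDigits t (l M)))) := by
          rw [Real.rpow_def_of_pos (h.pos _), mul_assoc, ← Real.exp_add,
            mul_comm (Real.log _) (s : ℝ)]
      _ ≤ (c ^ (-(s : ℝ))) ^ (k + 1) * (M + 1) ^ k * Real.exp (-γ * M) := by
          gcongr
      _ = _ := by
          rw [← Real.exp_nat_mul]
          have : Real.exp (-γ * M) = Real.exp γ * Real.exp (((M + 1 : ℕ) : ℝ) * -γ) := by
            rw [← Real.exp_add]; congr 1; push_cast; ring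
          rw [this]; push_cast; ring
  · intro e he
    refine (hX e he).mono fun M ⟨h1, h2⟩ => ⟨_, Finset.mem_image_of_mem _ h1, ?_⟩
    simp only [List.length_append, length_firstDigits]
    rw [firstDigits_add, h2.firstDigits_eq]

end ConformalIFS

end

/-! ### Target words and chains of first hits. -/

section

variable {S : ℕ}

/-- The concatenation of the prefixes of `t` of lengths `g (n - 1), …, g 0`. -/
def prefixConcat (t : ℕ → Fin S) (g : ℕ → ℕ) (n : ℕ) : List (Fin S) :=
  ((List.range n).reverse.map fun j => firstDigits t (g j)).flatten

theorem prefixConcat_succ (t : ℕ → Fin S) (g : ℕ → ℕ) (n : ℕ) :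
    prefixConcat t g (n + 1) = firstDigits t (g n) ++ prefixConcat t g n := by
  simp [prefixConcat, List.range_succ]

theorem exists_prefixConcat_eq (t : ℕ → Fin S) (g : ℕ → ℕ) (J k : ℕ) :
    ∃ u : List (Fin S), u.length = ∑ i ∈ Finset.range k, g (J + i) ∧
      prefixConcat t g (J + k) = u ++ prefixConcat t g J := by
  induction k with
  | zero => exact ⟨[], by simp, by simp⟩
  | succ k ih =>
    obtain ⟨u, hu, he⟩ := ih
    refine ⟨firstDigits t (g (J + k)) ++ u, ?_, ?_⟩
    · rw [List.length_append, length_firstDigits, hu, Finset.sum_range_succ, add_comm]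
    · rw [← add_assoc, prefixConcat_succ, he, List.append_assoc]

/-- Past the index p the prefixes have length 0 and contribute nothing, so the list may be cut at or
prolonged to any convenient length without evaluating p. -/
theorem exists_targetWord_eq (t : ℕ → Fin S) {θ : ℝ} (hθ : 1 < θ) (v : ℝ) (M : ℕ) :
    ∃ n, targetWord t θ v M =
      prefixConcat t (fun j => ⌊v * M / θ ^ j⌋₊) n ++ firstDigits t ⌊θ * v * M⌋₊ ∧
      ∀ j ≥ n, ⌊v * M / θ ^ j⌋₊ = 0 := by
  refine ⟨_, rfl, fun j hj => ?_⟩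
  rw [Nat.floor_eq_zero]
  by_contra! hlt
  have hbdd : BddAbove {p : ℕ | 1 ≤ v * M / θ ^ p} := by
    obtain ⟨n, hn⟩ := pow_unbounded_of_one_lt (v * M) hθ
    refine ⟨n, fun p hp => ?_⟩
    have hpos : 0 < θ ^ p := by positivity
    have hp' : 1 ≤ v * M / θ ^ p := hp
    rw [le_div_iff₀ hpos, one_mul] at hp'
    exact ((pow_lt_pow_iff_right₀ hθ).1 (hp'.trans_lt hn)).le
  have := le_csSup hbdd (show j ∈ {p : ℕ | 1 ≤ v * M / θ ^ p} from hlt)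
  omega

theorem sum_div_pow_le {θ : ℝ} (hθ : 1 < θ) {y : ℝ} (hy : 0 ≤ y) (n : ℕ) :
    ∑ i ∈ Finset.range n, y / θ ^ i ≤ y * (θ / (θ - 1)) := by
  have h1 : ∑ i ∈ Finset.range n, y / θ ^ i = y * ∑ i ∈ Finset.range n, (θ⁻¹) ^ i := by
    rw [Finset.mul_sum]
    exact Finset.sum_congr rfl fun i _ => by rw [inv_pow, div_eq_mul_inv]
  have h0 : θ⁻¹ < 1 := inv_lt_one_of_one_lt₀ hθ
  have hp : 0 < θ⁻¹ := by positivity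
  have h2 : ∑ i ∈ Finset.range n, (θ⁻¹) ^ i ≤ (1 - θ⁻¹)⁻¹ := by
    rw [← tsum_geometric_of_lt_one hp.le h0]
    exact (summable_geometric_of_lt_one hp.le h0).sum_le_tsum _ fun i _ => by positivity
  have h3 : (1 - θ⁻¹)⁻¹ = θ / (θ - 1) := by
    have : θ ≠ 0 := by positivity
    have : θ - 1 ≠ 0 := by linarith
    field_simp
  rw [h1, ← h3]
  exact mul_le_mul_of_nonneg_left h2 hy

namespace IsAlmostMultiplicative

variable {ψ : List (Fin S) → ℝ} {c b r : ℝ} (h : IsAlmostMultiplicative ψ c b r)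
include h

theorem log_prefixConcat_le (t : ℕ → Fin S) (g : ℕ → ℕ) (n : ℕ) :
    Real.log (ψ (prefixConcat t g n)) ≤
      ∑ j ∈ Finset.range n, Real.log (ψ (firstDigits t (g j))) := by
  induction n with
  | zero => simp [prefixConcat, h.nil]
  | succ n ih =>
    rw [prefixConcat_succ, Finset.sum_range_succ]
    have := h.log_append_le (firstDigits t (g n)) (prefixConcat t g n)
    linarith

theorem le_log_prefixConcat (t : ℕ → Fin S) (g : ℕ → ℕ) (n : ℕ) :
    ∑ j ∈ Finset.range n, Real.log (ψ (firstDigits t (g j))) + n * Real.log c ≤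
      Real.log (ψ (prefixConcat t g n)) := by
  induction n with
  | zero => simp [prefixConcat, h.nil]
  | succ n ih =>
    rw [prefixConcat_succ, Finset.sum_range_succ]
    have := h.le_log_append (firstDigits t (g n)) (prefixConcat t g n)
    push_cast
    linarith

/-- Comparing prefixes of `t` of different lengths. -/
theorem log_firstDigits_le (t : ℕ → Fin S) {l g : ℕ} {D : ℝ} (hD : 0 ≤ D) (hg : (g : ℝ) ≤ l + D) :
    Real.log (ψ (firstDigits t l)) ≤
      Real.log (ψ (firstDigits t g)) + D * (-Real.log b) + (-Real.log c) := by
  have hc := h.log_c_nonpos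
  have hb := h.log_b_neg
  rcases le_total g l with hgl | hlg
  · obtain ⟨k, rfl⟩ := Nat.exists_eq_add_of_le hgl
    rw [firstDigits_add]
    have := h.log_append_le_left (firstDigits t g) (firstDigits (fun i => t (g + i)) k)
    nlinarith
  · obtain ⟨k, rfl⟩ := Nat.exists_eq_add_of_le hlg
    rw [firstDigits_add]
    have h1 := h.le_log_append (firstDigits t l) (firstDigits (fun i => t (l + i)) k)
    have h2 := h.le_log (firstDigits (fun i => t (l + i)) k)
    rw [length_firstDigits] at h2
    have hk : (k : ℝ) ≤ D := by push_cast at hg; linarith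
    nlinarith

theorem log_targetWord_le (t : ℕ → Fin S) {θ v : ℝ} (hθ : 1 < θ) (M J : ℕ) :
    Real.log (ψ (targetWord t θ v M)) ≤
      ∑ j ∈ Finset.range J, Real.log (ψ (firstDigits t ⌊v * M / θ ^ j⌋₊)) +
        Real.log (ψ (firstDigits t ⌊θ * v * M⌋₊)) := by
  obtain ⟨n, hn, hzero⟩ := exists_targetWord_eq t hθ v M
  rw [hn]
  refine (h.log_append_le _ _).trans (add_le_add_left ((h.log_prefixConcat_le _ _ _).trans ?_) _)
  calc ∑ j ∈ Finset.range n, Real.log (ψ (firstDigits t ⌊v * M / θ ^ j⌋₊))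
      = ∑ j ∈ Finset.range (max n J), Real.log (ψ (firstDigits t ⌊v * M / θ ^ j⌋₊)) := by
        refine Finset.sum_subset (Finset.range_mono (le_max_left _ _)) fun j _ hj => ?_
        rw [hzero j (by simpa using hj)]
        simp [firstDigits, h.nil]
    _ ≤ _ := by
        have hsub : Finset.range J ⊆ Finset.range (max n J) :=
          Finset.range_mono (le_max_right _ _)
        rw [← Finset.sum_sdiff hsub]
        have : ∑ j ∈ Finset.range (max n J) \ Finset.range J,
            Real.log (ψ (firstDigits t ⌊v * M / θ ^ j⌋₊)) ≤ 0 :=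
          Finset.sum_nonpos fun j _ => h.log_nonpos _
        linarith

/-- Splitting every block would cost a constant c for each of about log M blocks. Only the J longest
are split off; the remaining ones are one word of length at most vM/θ^J · θ/(θ-1), estimated crudely
by powers of b. The error per M is then small once J is large. -/
theorem le_log_targetWord (t : ℕ → Fin S) {θ v : ℝ} (hθ : 1 < θ) (hv : 0 ≤ v) (M J : ℕ) :
    ∑ j ∈ Finset.range J, Real.log (ψ (firstDigits t ⌊v * M / θ ^ j⌋₊)) +
        Real.log (ψ (firstDigits t ⌊θ * v * M⌋₊)) + (J + 2) * Real.log c +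
        v * M / θ ^ J * (θ / (θ - 1)) * Real.log b ≤
      Real.log (ψ (targetWord t θ v M)) := by
  obtain ⟨n, hn, hzero⟩ := exists_targetWord_eq t hθ v M
  have hc := h.log_c_nonpos
  have hb := h.log_b_neg
  have hθ1 : 0 < θ - 1 := by linarith
  rw [hn]
  set g : ℕ → ℕ := fun j => ⌊v * M / θ ^ j⌋₊ with hg
  have h1 := h.le_log_append (prefixConcat t g n) (firstDigits t ⌊θ * v * M⌋₊)
  have hE : 0 ≤ v * M / θ ^ J * (θ / (θ - 1)) := by positivity
  have hE' := mul_nonpos_of_nonneg_of_nonpos hE hb.le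
  rcases le_total n J with hnJ | hJn
  · have h2 := h.le_log_prefixConcat t g n
    have h3 : ∑ j ∈ Finset.range n, Real.log (ψ (firstDigits t (g j))) =
        ∑ j ∈ Finset.range J, Real.log (ψ (firstDigits t (g j))) := by
      refine Finset.sum_subset (Finset.range_mono hnJ) fun j _ hj => ?_
      have : g j = 0 := hzero j (by simpa using hj)
      rw [this]
      simp [firstDigits, h.nil]
    have h4 : (n : ℝ) ≤ J := by exact_mod_cast hnJ
    have h5 : (J : ℝ) * Real.log c ≤ n * Real.log c := mul_le_mul_of_nonpos_right h4 hc
    linarith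
  · obtain ⟨k, rfl⟩ := Nat.exists_eq_add_of_le hJn
    obtain ⟨u, hu, he⟩ := exists_prefixConcat_eq t g J k
    have h2 := h.le_log_prefixConcat t g J
    rw [he] at h1 ⊢
    have h3 := h.le_log_append u (prefixConcat t g J)
    have h4 := h.le_log u
    have h5 : (u.length : ℝ) ≤ v * M / θ ^ J * (θ / (θ - 1)) := by
      rw [hu]
      push_cast
      refine le_trans (Finset.sum_le_sum fun i _ => ?_)
        (sum_div_pow_le hθ (y := v * M / θ ^ J) (by positivity) k)
      rw [div_div, ← pow_add]
      exact Nat.floor_le (by positivity)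
    have h6 := mul_le_mul_of_nonpos_right h5 hb.le
    linarith

end IsAlmostMultiplicative

/-- The lengths of the last `A` blocks before a first hit at position `y`, for targets of
length about `v' n` and first hits whose ratio is at most `θ`. -/
noncomputable def blockLengths (v' θ : ℝ) (L A : ℕ) (y : ℝ) : List ℕ :=
  (List.range A).map fun j => ⌊v' * y / θ ^ j⌋₊ - L

theorem blockLengths_succ {v' θ : ℝ} {L A : ℕ} {y : ℝ} :
    blockLengths v' θ L (A + 1) y = (⌊v' * y⌋₊ - L) :: blockLengths v' θ L A (y / θ) := by
  simp only [blockLengths, List.range_succ_eq_map, List.map_cons, List.map_map, pow_zero, div_one]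
  congr 1
  refine List.map_congr_left fun j _ => ?_
  simp only [Function.comp_apply, Nat.succ_eq_add_one]
  congr 2
  rw [pow_succ', mul_div_assoc, mul_div_assoc, div_div]

theorem list_sum_map_range {α : Type*} [AddCommMonoid α] (f : ℕ → α) (n : ℕ) :
    ((List.range n).map f).sum = ∑ j ∈ Finset.range n, f j := by
  induction n with
  | zero => simp
  | succ n ih => rw [List.range_succ, Finset.sum_range_succ]; simp [ih]

/-- The hit x of target M - 1 lies strictly before M and carries a prefix of length at least v'M.
After shortening by L this prefix ends at or before M. The ratio bound for n = M - 1 reads M ≤ θx,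
so the same argument continues from x. Allowing any y ≤ M closes the induction, since y/θ ≤ x. -/
theorem exists_mem_blockWords {t e : ℕ → Fin S} {a : ℕ → ℕ} {L : ℕ}
    (hL : ∀ m, OccursAt t t m L → ∀ k, OccursAt t t m k) (he : e ∈ hittingSet a t)
    {v' θ : ℝ} (hv' : 0 < v') (hθ : 1 < θ) (ha : ∀ᶠ n : ℕ in atTop, v' * (n + 1) ≤ a n)
    (hratio : ∀ᶠ n : ℕ in atTop, (n + 1 : ℝ) ≤ θ * firstHit a t e n) (A : ℕ) :
    ∃ T : ℕ, ∀ n ≥ T, T ≤ firstHit a t e n → ∀ y : ℝ, 0 ≤ y → y ≤ firstHit a t e n →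
      firstDigits e (firstHit a t e n) ∈
        blockWords t (blockLengths v' θ L A y) (firstHit a t e n) := by
  have haL : ∀ᶠ n : ℕ in atTop, L ≤ a n := by
    filter_upwards [ha, eventually_ge_atTop ⌈L / v'⌉₊] with n hn hn2
    have h1 := Nat.ceil_le.1 hn2
    rw [div_le_iff₀ hv'] at h1
    have : (L : ℝ) ≤ a n := by nlinarith
    exact_mod_cast this
  obtain ⟨N, hN⟩ := eventually_atTop.1
    ((eventually_firstHit he).and (ha.and (hratio.and haL)))
  induction A with
  | zero => exact ⟨0, fun n _ _ y _ _ => firstDigits_mem_wordsOfLength _ _⟩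
  | succ A ih =>
    obtain ⟨T, hT⟩ := ih
    -- This threshold makes the eventual properties hold at both n and M - 1, and gives M - 1 ≥ T
    -- and x ≥ M/θ ≥ T, as the induction hypothesis requires.
    refine ⟨max (N + 1) (⌈θ * T⌉₊ + 1 + T), fun n hn hM y hy0 hy => ?_⟩
    set M := firstHit a t e n with hMdef
    have hM1 : N + 1 ≤ M := (le_max_left _ _).trans hM
    have hM2 : ⌈θ * T⌉₊ + 1 + T ≤ M := (le_max_right _ _).trans hM
    obtain ⟨⟨hocc, hle⟩, han, hrn, hLn⟩ := hN n (by have := le_max_left (N + 1) (⌈θ * T⌉₊ + 1 + T); omega)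
    obtain ⟨⟨hocc', hle'⟩, han', hrn', hLn'⟩ := hN (M - 1) (by omega)
    set x := firstHit a t e (M - 1) with hxdef
    have hcast : ((M - 1 : ℕ) : ℝ) + 1 = M := by
      rw [Nat.cast_sub (by omega)]; simp
    rw [hcast] at hrn' han'
    have hxM : x < M := by omega
    have hTx : T ≤ x := by
      have h1 : θ * T ≤ M := (Nat.le_ceil _).trans (by exact_mod_cast (by omega : ⌈θ * T⌉₊ ≤ M))
      have h2 : θ * (T : ℝ) ≤ θ * x := h1.trans hrn'
      exact_mod_cast le_of_mul_le_mul_left h2 (by linarith)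
    have hmem := hT (M - 1) (by omega) hTx (y / θ) (by positivity) (by
      rw [div_le_iff₀ (by linarith)]; linarith)
    rw [blockLengths_succ]
    have hfl : ⌊v' * y⌋₊ ≤ a (M - 1) := by
      refine Nat.floor_le_of_le (le_trans ?_ han')
      exact mul_le_mul_of_nonneg_left hy hv'.le
    have hsep := firstHit_separated hL hocc (hocc'.mono hfl) hxM hLn
    exact firstDigits_mem_blockWords hmem (hocc'.mono (by omega)) (by omega)

namespace ConformalIFS

variable {d : ℕ} (F : ConformalIFS d S) [Nontrivial (EuclideanSpace ℝ (Fin d))]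

/-- The dimension of the sequences whose first hits have ratios that are eventually at most `θ`
and infinitely often at least `θ'`. -/
theorem dimH_coding_le_of_ratio [NeZero S] {t : ℕ → Fin S} {a : ℕ → ℕ} {L : ℕ}
    (hL : ∀ m, OccursAt t t m L → ∀ k, OccursAt t t m k) (s : ℝ≥0) {Q : ℝ}
    (hQ : wordPressure F.derivNorm s ≤ Q) {v' θ θ' γ : ℝ} (hv' : 0 < v') (hθ : 1 < θ)
    (hγ : 0 < γ) (ha : ∀ᶠ n : ℕ in atTop, v' * (n + 1) ≤ a n) (A : ℕ)
    (hexp : ∀ᶠ M : ℕ in atTop, Q * (M - (blockLengths v' θ L A M).sum) +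
      s * ((blockLengths v' θ L A M).map
        fun l => Real.log (F.derivNorm (firstDigits t l))).sum +
      s * Real.log (F.derivNorm (firstDigits t ⌊v' * (θ' * M)⌋₊)) ≤ -γ * M)
    (X : Set (ℕ → Fin S))
    (hX : ∀ e ∈ X, e ∈ hittingSet a t ∧ e ∉ preOrbit t ∧
      (A = 0 ∨ ∀ᶠ n : ℕ in atTop, (n + 1 : ℝ) ≤ θ * firstHit a t e n) ∧
      ∃ᶠ n : ℕ in atTop, θ' * firstHit a t e n ≤ n + 1) :
    dimH (F.coding '' X) ≤ s := by
  refine F.dimH_coding_le_of_blocks t s hQ A (fun M => blockLengths v' θ L A M)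
    (fun M => by simp [blockLengths]) (fun M => ⌊v' * (θ' * M)⌋₊) hγ hexp X fun e he => ?_
  obtain ⟨hit, hpre, hup, hlow⟩ := hX e he
  have hatop : Tendsto a atTop atTop := by
    have h1 : Tendsto (fun n : ℕ => v' * ((n : ℝ) + 1)) atTop atTop :=
      (tendsto_atTop_add_const_right _ 1 tendsto_natCast_atTop_atTop).const_mul_atTop hv'
    exact tendsto_natCast_atTop_iff.1 (tendsto_atTop_mono' _ ha h1)
  have htend := tendsto_firstHit hit hpre hatop
  obtain ⟨T, hT⟩ : ∃ T : ℕ, ∀ n ≥ T, T ≤ firstHit a t e n →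
      firstDigits e (firstHit a t e n) ∈ blockWords t
        (blockLengths v' θ L A (firstHit a t e n)) (firstHit a t e n) := by
    rcases hup with rfl | hup
    · exact ⟨0, fun n _ _ => firstDigits_mem_wordsOfLength _ _⟩
    · obtain ⟨T, hT⟩ := exists_mem_blockWords hL hit hv' hθ ha hup A
      exact ⟨T, fun n h1 h2 => hT n h1 h2 _ (Nat.cast_nonneg _) le_rfl⟩
  -- Infinitely many n yield infinitely many M, because the first hits tend to infinity.
  refine htend.frequently (p := fun M : ℕ => firstDigits e M ∈
    blockWords t (blockLengths v' θ L A M) M ∧ OccursAt e t M ⌊v' * (θ' * M)⌋₊) ?_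
  refine (hlow.and_eventually ((eventually_firstHit hit).and (ha.and
    ((eventually_ge_atTop T).and (htend.eventually_ge_atTop T))))).mono ?_
  rintro n ⟨hn, ⟨hocc, -⟩, han, hnT, hMT⟩
  refine ⟨hT n hnT hMT, hocc.mono (Nat.floor_le_of_le (le_trans ?_ han))⟩
  exact mul_le_mul_of_nonneg_left hn hv'.le

end ConformalIFS

end

/-! ### Exponents of the covers and the upper bound. -/

section

variable {S : ℕ}

theorem sum_inv_pow_eq {θ : ℝ} (hθ : 1 < θ) (A : ℕ) :
    ∑ j ∈ Finset.range A, 1 / θ ^ j = (1 - (θ⁻¹) ^ A) * (θ / (θ - 1)) := by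
  have h1 : θ - 1 ≠ 0 := by linarith
  have h0 : θ ≠ 0 := by positivity
  induction A with
  | zero => simp
  | succ A ih =>
    rw [Finset.sum_range_succ, ih, pow_succ, inv_pow, one_div]
    field_simp
    ring

theorem tendsto_sum_inv_pow {θ : ℝ} (hθ : 1 < θ) :
    Tendsto (fun A : ℕ => ∑ j ∈ Finset.range A, 1 / θ ^ j) atTop (𝓝 (θ / (θ - 1))) := by
  have h := (tendsto_pow_atTop_nhds_zero_of_lt_one (inv_nonneg.2 (by linarith : (0 : ℝ) ≤ θ))
    (inv_lt_one_of_one_lt₀ hθ)).const_sub 1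
  have := h.mul_const (θ / (θ - 1))
  rw [sub_zero, one_mul] at this
  exact this.congr fun A => (sum_inv_pow_eq hθ A).symm

theorem le_blockLengths_sum {v' θ : ℝ} (L A M : ℕ) :
    v' * (∑ j ∈ Finset.range A, 1 / θ ^ j) * M - A * (L + 1) ≤
      ((blockLengths v' θ L A M).sum : ℝ) := by
  rw [blockLengths, list_sum_map_range]
  push_cast
  have : v' * (∑ j ∈ Finset.range A, 1 / θ ^ j) * M - A * (L + 1) =
      ∑ j ∈ Finset.range A, (v' * M / θ ^ j - (L + 1)) := by
    rw [Finset.sum_sub_distrib, Finset.sum_const, Finset.card_range, nsmul_eq_mul,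
      Finset.mul_sum, Finset.sum_mul]
    congr 1
    exact Finset.sum_congr rfl fun j _ => by ring
  rw [this]
  refine Finset.sum_le_sum fun j _ => ?_
  have h1 := (Nat.lt_floor_add_one (v' * M / θ ^ j)).le
  have h2 : (⌊v' * M / θ ^ j⌋₊ : ℝ) ≤ ((⌊v' * M / θ ^ j⌋₊ - L : ℕ) : ℝ) + L := by
    exact_mod_cast (by omega : ⌊v' * M / θ ^ j⌋₊ ≤ (⌊v' * M / θ ^ j⌋₊ - L) + L)
  linarith

theorem eventually_mul_add_le {E K : ℝ} (hE : E < 0) :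
    ∀ᶠ M : ℕ in atTop, E * M + K ≤ -(-E / 2) * M := by
  filter_upwards [eventually_ge_atTop ⌈K / (-E / 2)⌉₊] with M hM
  have h1 := Nat.ceil_le.1 hM
  rw [div_le_iff₀ (by linarith)] at h1
  linarith

namespace IsAlmostMultiplicative

variable {ψ : List (Fin S) → ℝ} {c b r : ℝ} (h : IsAlmostMultiplicative ψ c b r)
include h

theorem log_firstDigits_floor_le (t : ℕ → Fin S) (x : ℝ) :
    Real.log (ψ (firstDigits t ⌊x⌋₊)) ≤ (x - 1) * Real.log r := by
  have h1 := h.log_le (firstDigits t ⌊x⌋₊)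
  rw [length_firstDigits] at h1
  refine h1.trans (mul_le_mul_of_nonpos_right ?_ h.log_r_neg.le)
  have := (Nat.lt_floor_add_one x).le
  linarith

/-- The cost of a pattern when only the last block is taken into account. -/
theorem exponent_le_of_last_block (t : ℕ → Fin S) {s Q v' θ θ' : ℝ} (hs : 0 ≤ s) (hQ : 0 ≤ Q)
    (L A : ℕ)
    (hneg : Q * (1 - v' * ∑ j ∈ Finset.range A, 1 / θ ^ j) + s * (v' * θ' * Real.log r) < 0) :
    ∃ γ > 0, ∀ᶠ M : ℕ in atTop, Q * (M - (blockLengths v' θ L A M).sum) +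
      s * ((blockLengths v' θ L A M).map
        fun l => Real.log (ψ (firstDigits t l))).sum +
      s * Real.log (ψ (firstDigits t ⌊v' * (θ' * M)⌋₊)) ≤ -γ * M := by
  set σ := ∑ j ∈ Finset.range A, 1 / θ ^ j with hσ
  refine ⟨_, div_pos (neg_pos.2 hneg) two_pos, ?_⟩
  filter_upwards [eventually_mul_add_le (K := Q * (A * (L + 1)) + s * (-Real.log r)) hneg] with M hM
  refine le_trans ?_ hM
  have h1 := le_blockLengths_sum (v' := v') (θ := θ) L A M
  have h2 : ((blockLengths v' θ L A M).map
      fun l => Real.log (ψ (firstDigits t l))).sum ≤ 0 := by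
    rw [blockLengths, List.map_map, list_sum_map_range]
    exact Finset.sum_nonpos fun j _ => h.log_nonpos _
  have h3 := h.log_firstDigits_floor_le t (v' * (θ' * M))
  have h4 := mul_le_mul_of_nonneg_left h1 hQ
  have h5 := mul_nonpos_of_nonneg_of_nonpos hs h2
  have h6 := mul_le_mul_of_nonneg_left h3 hs
  rw [← hσ] at h4
  linarith

/-- The cost of a pattern, compared with the word that defines `Ω`. -/
theorem exists_exponent_le (t : ℕ → Fin S) {s Q v θ θ' Ω : ℝ} (hs : 0 ≤ s) (hQ : 0 ≤ Q)
    (hv : 0 < v) (hθ : 1 < θ) (hθ' : 0 ≤ θ') (hθθ' : θ' ≤ θ)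
    (hΩ : ∀ η > 0, ∀ᶠ M : ℕ in atTop, Real.log (ψ (targetWord t θ v M)) ≤ (Ω + η) * M)
    (hneg : Q * ((θ - θ * v - 1) / (θ - 1)) + s * Ω + s * (-Real.log b) * v * (θ - θ') < 0)
    (L : ℕ) :
    ∃ v' > 0, v' < v ∧ ∃ A : ℕ, ∃ γ > 0, ∀ᶠ M : ℕ in atTop,
      Q * (M - (blockLengths v' θ L A M).sum) +
      s * ((blockLengths v' θ L A M).map
        fun l => Real.log (ψ (firstDigits t l))).sum +
      s * Real.log (ψ (firstDigits t ⌊v' * (θ' * M)⌋₊)) ≤ -γ * M := by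
  set B := -Real.log b with hB
  set Cc := -Real.log c with hCc
  have hB0 : 0 < B := by have := h.log_b_neg; linarith
  have hCc0 : 0 ≤ Cc := by have := h.log_c_nonpos; linarith
  have hθ1 : 0 < θ - 1 := by linarith
  set σ : ℕ → ℝ := fun A => ∑ j ∈ Finset.range A, 1 / θ ^ j with hσ
  -- The cost per M for A blocks and v' = v - τ. Besides the free digits and Ω it contains the
  -- errors from shortening the earlier blocks (τσ), from replacing the last block of ratio θ by one
  -- of ratio θ', and from the tail of the target word beyond A blocks. As A → ∞ with τ = 0 it tends
  -- to the negative quantity in `hneg`, so A is fixed first and τ is taken small afterwards.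
  let f : ℕ → ℝ → ℝ := fun A τ => Q * (1 - (v - τ) * σ A) + s * (Ω + τ) + s * B * (τ * σ A) +
    s * B * (θ * v - (v - τ) * θ') + s * B * (v * (θ⁻¹) ^ A * (θ / (θ - 1)))
  obtain ⟨A, hA⟩ : ∃ A, f A 0 < 0 := by
    have hpow := tendsto_pow_atTop_nhds_zero_of_lt_one
      (inv_nonneg.2 (by linarith : (0 : ℝ) ≤ θ)) (inv_lt_one_of_one_lt₀ hθ)
    have h1 : Tendsto (fun A => f A 0) atTop (𝓝 (Q * (1 - (v - 0) * (θ / (θ - 1))) + s * (Ω + 0) +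
        s * B * (0 * (θ / (θ - 1))) + s * B * (θ * v - (v - 0) * θ') +
        s * B * (v * 0 * (θ / (θ - 1))))) := by
      have hσt := tendsto_sum_inv_pow hθ
      exact ((((((hσt.const_mul _).const_sub 1).const_mul Q).add_const _).add
        ((hσt.const_mul 0).const_mul _)).add_const _).add
        (((hpow.const_mul v).mul_const _).const_mul _)
    refine (h1.eventually_lt_const ?_).exists
    have : 1 - (v - 0) * (θ / (θ - 1)) = (θ - θ * v - 1) / (θ - 1) := by field_simp; ring
    rw [this]
    linarith
  obtain ⟨τ, hτ0, hτv, hfτ⟩ : ∃ τ, 0 < τ ∧ τ < v ∧ f A τ < 0 := by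
    have hcont : Continuous (f A) := by simp only [f]; fun_prop
    have h1 : ∀ᶠ τ in 𝓝[>] (0 : ℝ), f A τ < 0 :=
      (hcont.continuousAt.eventually_lt_const hA).filter_mono nhdsWithin_le_nhds
    have h2 : ∀ᶠ τ in 𝓝[>] (0 : ℝ), τ ∈ Ioo 0 v := Ioo_mem_nhdsGT hv
    obtain ⟨τ, h3, h4⟩ := (h1.and h2).exists
    exact ⟨τ, h4.1, h4.2, h3⟩
  set K := Q * (A * (L + 1)) + s * (B * (A * (L + 1)) + A * Cc) + s * (B + Cc) +
    s * ((A + 2) * Cc) with hK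
  refine ⟨v - τ, by linarith, by linarith, A, _, div_pos (neg_pos.2 hfτ) two_pos, ?_⟩
  filter_upwards [eventually_mul_add_le (K := K) hfτ, hΩ τ hτ0] with M hM hΩM
  refine le_trans ?_ hM
  have h1 := le_blockLengths_sum (v' := v - τ) (θ := θ) L A M
  have h2 : ((blockLengths (v - τ) θ L A M).map
      fun l => Real.log (ψ (firstDigits t l))).sum ≤
      ∑ j ∈ Finset.range A, Real.log (ψ (firstDigits t ⌊v * M / θ ^ j⌋₊)) +
        B * (τ * σ A * M + A * (L + 1)) + A * Cc := by
    rw [blockLengths, List.map_map, list_sum_map_range]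
    have : B * (τ * σ A * M + A * (L + 1)) + A * Cc = ∑ j ∈ Finset.range A,
        ((τ * M / θ ^ j + (L + 1)) * B + Cc) := by
      rw [Finset.sum_add_distrib, ← Finset.sum_mul, Finset.sum_add_distrib, Finset.sum_const,
        Finset.sum_const, Finset.card_range, nsmul_eq_mul, nsmul_eq_mul, hσ]
      simp only
      rw [Finset.mul_sum, Finset.sum_mul,
        Finset.sum_congr rfl fun j _ => show τ * (1 / θ ^ j) * M = τ * M / θ ^ j by ring]
      ring
    rw [add_assoc, this, ← Finset.sum_add_distrib]
    refine Finset.sum_le_sum fun j _ => ?_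
    rw [← add_assoc]
    refine h.log_firstDigits_le t (by positivity) ?_
    have h3 := (Nat.lt_floor_add_one ((v - τ) * M / θ ^ j)).le
    have h4 : (⌊(v - τ) * M / θ ^ j⌋₊ : ℝ) ≤ ((⌊(v - τ) * M / θ ^ j⌋₊ - L : ℕ) : ℝ) + L := by
      exact_mod_cast (by omega : ⌊(v - τ) * M / θ ^ j⌋₊ ≤ (⌊(v - τ) * M / θ ^ j⌋₊ - L) + L)
    have h5 : (⌊v * M / θ ^ j⌋₊ : ℝ) ≤ v * M / θ ^ j := Nat.floor_le (by positivity)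
    have h6 : v * M / θ ^ j = (v - τ) * M / θ ^ j + τ * M / θ ^ j := by ring
    linarith
  have h3 : Real.log (ψ (firstDigits t ⌊(v - τ) * (θ' * M)⌋₊)) ≤
      Real.log (ψ (firstDigits t ⌊θ * v * M⌋₊)) + ((θ * v - (v - τ) * θ') * M + 1) * B + Cc := by
    have hnn : 0 ≤ (θ * v - (v - τ) * θ') * M := by
      refine mul_nonneg ?_ (Nat.cast_nonneg M)
      nlinarith
    refine h.log_firstDigits_le t (by linarith) ?_
    have h4 := (Nat.lt_floor_add_one ((v - τ) * (θ' * M))).le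
    have h5 : (⌊θ * v * M⌋₊ : ℝ) ≤ θ * v * M := Nat.floor_le (by positivity)
    linarith
  have h4 := h.le_log_targetWord t hθ hv.le M A
  have h5 : v * M / θ ^ A * (θ / (θ - 1)) * Real.log b =
      -(B * (v * (θ⁻¹) ^ A * (θ / (θ - 1))) * M) := by
    rw [hB, inv_pow]; ring
  have h6 := mul_le_mul_of_nonneg_left h1 hQ
  have h7 := mul_le_mul_of_nonneg_left (add_le_add h2 h3) hs
  have h8 := mul_le_mul_of_nonneg_left (h4.trans hΩM) hs
  rw [h5] at h8
  have h9 : Real.log c = -Cc := by rw [hCc]; ring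
  rw [h9] at h8
  simp only [f, hK, hσ] at h6 h7 h8 ⊢
  linarith

end IsAlmostMultiplicative

namespace ConformalIFS

variable {d : ℕ} (F : ConformalIFS d S) [Nontrivial (EuclideanSpace ℝ (Fin d))]

theorem eventually_mul_succ_le {a : ℕ → ℕ} {v v' : ℝ}
    (ha : Tendsto (fun n : ℕ => (a n : ℝ) / n) atTop (𝓝 v)) (hv' : v' < v) :
    ∀ᶠ n : ℕ in atTop, v' * (n + 1) ≤ a n := by
  have h1 : Tendsto (fun n : ℕ => (a n : ℝ) / n - v' * (1 / n)) atTop (𝓝 (v - v' * 0)) :=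
    ha.sub (tendsto_one_div_atTop_nhds_zero_nat.const_mul v')
  filter_upwards [h1.eventually_const_le (by linarith : v' < v - v' * 0),
    eventually_gt_atTop 0] with n hn hn0
  have hn' : (0 : ℝ) < n := by exact_mod_cast hn0
  have h2 : (a n : ℝ) / n - v' * (1 / n) = (a n - v') / n := by ring
  rw [h2, le_div_iff₀ hn'] at hn
  linarith

/-- The upper bound for the dimension, from a uniform bound on the costs. -/
theorem dimH_coding_hittingSet_le [NeZero S] {t : ℕ → Fin S} (ht : t ∈ admissibleTargets S)
    {a : ℕ → ℕ} {v : ℝ} (hv : v ∈ Ioo (0 : ℝ) 1)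
    (ha : Tendsto (fun n : ℕ => (a n : ℝ) / n) atTop (𝓝 v)) {s : ℝ≥0} (hs : 0 < s) {Q : ℝ}
    (hQ0 : 0 ≤ Q) (hQ : wordPressure F.derivNorm s ≤ Q) (Ω : ℝ → ℝ)
    (hΩ : ∀ θ > 1 / (1 - v), ∀ η > 0, ∀ᶠ M : ℕ in atTop,
      Real.log (F.derivNorm (targetWord t θ v M)) ≤ (Ω θ + η) * M) {g : ℝ} (hg : 0 < g)
    (hneg : ∀ θ > 1 / (1 - v), Q * ((θ - θ * v - 1) / (θ - 1)) + s * Ω θ ≤ -g) :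
    dimH (F.coding '' hittingSet a t) ≤ s := by
  obtain ⟨c, b, r, h⟩ := F.exists_isAlmostMultiplicative
  obtain ⟨hv0, hv1⟩ := hv
  obtain ⟨L, hL⟩ := exists_overlap_bound ht
  have hs' : (0 : ℝ) < s := hs
  have hr := h.log_r_neg
  have hb := h.log_b_neg
  have hcrit : 1 < 1 / (1 - v) := by rw [lt_div_iff₀ (by linarith)]; linarith
  -- the least ratio
  obtain ⟨θ₀, hθ₀, hlow⟩ : ∃ θ₀ > 1 / (1 - v),
      Q * (1 - v * (θ₀ / (θ₀ - 1))) + s * (v * 1 * Real.log r) < 0 := by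
    have hc : ContinuousAt (fun θ : ℝ => Q * (1 - v * (θ / (θ - 1))) +
        s * (v * 1 * Real.log r)) (1 / (1 - v)) := by
      have : 1 / (1 - v) - 1 ≠ 0 := by linarith
      fun_prop (disch := assumption)
    -- At θ = 1/(1-v) the blocks fill everything, vθ/(θ-1) = 1, and no free digits remain. The final
    -- block then makes the exponent negative, and this persists slightly beyond.
    have hval : Q * (1 - v * (1 / (1 - v) / (1 / (1 - v) - 1))) +
        s * (v * 1 * Real.log r) < 0 := by
      have h1 : v * (1 / (1 - v) / (1 / (1 - v) - 1)) = 1 := by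
        have : 1 - v ≠ 0 := by linarith
        have h2 : 1 / (1 - v) - 1 = v / (1 - v) := by field_simp; ring
        rw [h2]; field_simp
      rw [h1, sub_self, mul_zero, zero_add, mul_one]
      exact mul_neg_of_pos_of_neg hs' (mul_neg_of_pos_of_neg hv0 hr)
    obtain ⟨θ, h1, h2⟩ := (((hc.eventually_lt_const hval).filter_mono
      nhdsWithin_le_nhds).and (self_mem_nhdsWithin (s := Ioi (1 / (1 - v))))).exists
    exact ⟨θ, h2, h1⟩
  have hθ₀1 : 1 < θ₀ := hcrit.trans hθ₀
  -- Width of the ratio windows: replacing θ' by θ within one window costs s(-log b)vε = g/2, which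
  -- the uniform gap g absorbs.
  set ε : ℝ := g / (2 * (s * (-Real.log b) * v)) with hε
  have hden : 0 < (s : ℝ) * (-Real.log b) * v := by
    have : 0 < -Real.log b := by linarith
    positivity
  have hε0 : 0 < ε := by positivity
  have hεg : s * (-Real.log b) * v * ε < g := by
    have : s * (-Real.log b) * v * ε = g / 2 := by
      have key : ∀ D : ℝ, D ≠ 0 → D * (g / (2 * D)) = g / 2 := fun D hD => by field_simp
      exact key _ hden.ne'
    linarith
  let Θ : ℕ → ℝ := fun q => θ₀ + q * ε
  have hΘ₀ : ∀ q, θ₀ ≤ Θ q := fun q => le_add_of_nonneg_right (by positivity)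
  have hΘcrit : ∀ q, 1 / (1 - v) < Θ q := fun q => hθ₀.trans_le (hΘ₀ q)
  have hΘ1 : ∀ q, 1 < Θ q := fun q => hcrit.trans (hΘcrit q)
  let H : Set (ℕ → Fin S) := hittingSet a t \ preOrbit t
  let up : ℝ → Set (ℕ → Fin S) := fun θ =>
    {e | ∀ᶠ n : ℕ in atTop, (n + 1 : ℝ) ≤ θ * firstHit a t e n}
  let lo : ℝ → Set (ℕ → Fin S) := fun θ =>
    {e | ∃ᶠ n : ℕ in atTop, θ * firstHit a t e n ≤ n + 1}
  -- Sorting by the least q with ratios eventually at most `Θ q`: q = 0, q ≥ 1 (where `Θ (q - 1)` is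
  -- reached infinitely often), or no such q.
  have hcover : hittingSet a t ⊆ preOrbit t ∪ ((H ∩ up (Θ 0)) ∪
      ((⋃ q : ℕ, H ∩ (up (Θ (q + 1)) ∩ lo (Θ q))) ∪ (H ∩ ⋂ q : ℕ, lo (Θ q)))) := by
    intro e he
    by_cases hpre : e ∈ preOrbit t
    · exact Or.inl hpre
    have hH : e ∈ H := ⟨he, hpre⟩
    have hlo : ∀ q, e ∉ up (Θ q) → e ∈ lo (Θ q) := fun q hq => by
      have hq' : ¬ ∀ᶠ n : ℕ in atTop, (n + 1 : ℝ) ≤ Θ q * firstHit a t e n := hq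
      exact (not_eventually.1 hq').mono fun n hn => (not_le.1 hn).le
    by_cases hex : ∃ q, e ∈ up (Θ q)
    · classical
      by_cases h0 : Nat.find hex = 0
      · exact Or.inr (Or.inl ⟨hH, h0 ▸ Nat.find_spec hex⟩)
      · obtain ⟨q, hq⟩ := Nat.exists_eq_succ_of_ne_zero h0
        refine Or.inr (Or.inr (Or.inl (mem_iUnion.2 ⟨q, hH, ?_, ?_⟩)))
        · have := Nat.find_spec hex
          rwa [hq] at this
        · exact hlo q (Nat.find_min hex (by omega))
    · push Not at hex
      exact Or.inr (Or.inr (Or.inr ⟨hH, mem_iInter.2 fun q => hlo q (hex q)⟩))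
  refine (dimH_mono (image_mono hcover)).trans ?_
  rw [image_union, image_union, image_union, image_iUnion, dimH_union, dimH_union, dimH_union,
    dimH_iUnion]
  refine max_le ?_ (max_le ?_ (max_le (iSup_le fun q => ?_) ?_))
  · rw [((countable_preOrbit t).image _).dimH_zero]
    exact zero_le
  · -- small ratios
    obtain ⟨A, τ, hτ0, hτv, hneg'⟩ : ∃ A : ℕ, ∃ τ, 0 < τ ∧ τ < v ∧
        Q * (1 - τ * ∑ j ∈ Finset.range A, 1 / θ₀ ^ j) + s * (τ * 1 * Real.log r) < 0 := by
      have h1 : Tendsto (fun A : ℕ => Q * (1 - v * ∑ j ∈ Finset.range A, 1 / θ₀ ^ j) +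
          s * (v * 1 * Real.log r)) atTop (𝓝 (Q * (1 - v * (θ₀ / (θ₀ - 1))) +
          s * (v * 1 * Real.log r))) :=
        ((((tendsto_sum_inv_pow hθ₀1).const_mul v).const_sub 1).const_mul Q).add_const _
      obtain ⟨A, hA⟩ := (h1.eventually_lt_const hlow).exists
      have hcont : Continuous fun τ : ℝ => Q * (1 - τ * ∑ j ∈ Finset.range A, 1 / θ₀ ^ j) +
          s * (τ * 1 * Real.log r) := by fun_prop
      have h2 : ∀ᶠ τ in 𝓝[<] v, Q * (1 - τ * ∑ j ∈ Finset.range A, 1 / θ₀ ^ j) +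
          s * (τ * 1 * Real.log r) < 0 :=
        (hcont.continuousAt.eventually_lt_const hA).filter_mono nhdsWithin_le_nhds
      have h3 : ∀ᶠ τ in 𝓝[<] v, τ ∈ Ioo 0 v := Ioo_mem_nhdsLT hv0
      obtain ⟨τ, h4, h5⟩ := (h2.and h3).exists
      exact ⟨A, τ, h5.1, h5.2, h4⟩
    obtain ⟨γ, hγ, hexp⟩ := h.exponent_le_of_last_block t (θ := θ₀) hs'.le hQ0 L A hneg'
    refine F.dimH_coding_le_of_ratio hL s hQ hτ0 hθ₀1 hγ (eventually_mul_succ_le ha hτv) A hexp _ ?_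
    rintro e ⟨⟨hit, hpre⟩, hup⟩
    refine ⟨hit, hpre, Or.inr ?_, ?_⟩
    · have : Θ 0 = θ₀ := by simp [Θ]
      rw [this] at hup
      exact hup
    -- Here θ' = 1, which costs nothing because target n is hit no later than n.
    · refine ((eventually_firstHit hit).mono fun n hn => ?_).frequently
      have : (firstHit a t e n : ℝ) ≤ n := by exact_mod_cast hn.2
      linarith
  · -- intermediate ratios
    have hd : Θ (q + 1) - Θ q = ε := by simp only [Θ]; push_cast; ring
    have hcost : Q * ((Θ (q + 1) - Θ (q + 1) * v - 1) / (Θ (q + 1) - 1)) + s * Ω (Θ (q + 1)) +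
        s * (-Real.log b) * v * (Θ (q + 1) - Θ q) < 0 := by
      rw [hd]
      have := hneg _ (hΘcrit (q + 1))
      linarith
    obtain ⟨v', hv'0, hv'v, A, γ, hγ, hexp⟩ := h.exists_exponent_le t hs'.le hQ0 hv0 (hΘ1 (q + 1))
      (by linarith [hΘ1 q]) (by linarith) (hΩ _ (hΘcrit (q + 1))) hcost L
    refine F.dimH_coding_le_of_ratio hL s hQ hv'0 (hΘ1 (q + 1)) hγ
      (eventually_mul_succ_le ha hv'v) A hexp _ ?_
    rintro e ⟨⟨hit, hpre⟩, hup, hlo⟩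
    exact ⟨hit, hpre, Or.inr hup, hlo⟩
  · -- unbounded ratios
    obtain ⟨q, hq⟩ := exists_nat_gt (Q / (s * (v / 2) * ε * (-Real.log r)))
    have hpos : 0 < s * (v / 2) * ε * (-Real.log r) := by
      have : 0 < -Real.log r := by linarith
      positivity
    rw [div_lt_iff₀ hpos] at hq
    -- No earlier blocks are used (A = 0). For q this large, the final prefix of length about
    -- (v/2)`Θ q`·M alone outweighs QM.
    have hneg' : Q * (1 - v / 2 * ∑ j ∈ Finset.range 0, 1 / θ₀ ^ j) +
        s * (v / 2 * Θ q * Real.log r) < 0 := by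
      simp only [Finset.range_zero, Finset.sum_empty, mul_zero, sub_zero, mul_one, Θ]
      have : s * (v / 2) * θ₀ * (-Real.log r) > 0 := by
        have : 0 < -Real.log r := by linarith
        positivity
      nlinarith
    obtain ⟨γ, hγ, hexp⟩ := h.exponent_le_of_last_block t (θ := θ₀) hs'.le hQ0 L 0 hneg'
    refine F.dimH_coding_le_of_ratio hL s hQ (half_pos hv0) hθ₀1 hγ
      (eventually_mul_succ_le ha (by linarith)) 0 hexp _ ?_
    rintro e ⟨⟨hit, hpre⟩, hlo⟩
    exact ⟨hit, hpre, Or.inl rfl, mem_iInter.1 hlo q⟩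

end ConformalIFS

end

/-! ### Gibbs measures on words and sequences with planted prefixes. -/

section

variable {S : ℕ}

theorem sum_rpow_take_le [NeZero S] {ψ : List (Fin S) → ℝ} {c b r : ℝ}
    (h : IsAlmostMultiplicative ψ c b r) {s : ℝ} (hs : 0 ≤ s) {N j : ℕ} (hj : j ≤ N)
    (u : List (Fin S)) :
    ∑ w : Fin N → Fin S, (if (List.ofFn w).take j = u then ψ (List.ofFn w) ^ s else 0) ≤
      ψ u ^ s * partitionSum ψ s (N - j) := by
  obtain ⟨k, rfl⟩ := Nat.exists_eq_add_of_le hj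
  rw [sum_append_words (fun w => if w.take j = u then ψ w ^ s else 0), Nat.add_sub_cancel_left]
  have htake : ∀ (p : Fin j → Fin S) (q : Fin k → Fin S),
      (List.ofFn p ++ List.ofFn q).take j = List.ofFn p := fun p q =>
    List.take_left' (by simp)
  simp only [htake]
  by_cases hu : ∃ p : Fin j → Fin S, List.ofFn p = u
  · obtain ⟨p, rfl⟩ := hu
    rw [Finset.sum_eq_single p]
    · simp only [if_true]
      rw [partitionSum, Finset.mul_sum]
      refine Finset.sum_le_sum fun q _ => ?_
      rw [← Real.mul_rpow (h.pos _).le (h.pos _).le]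
      exact Real.rpow_le_rpow (h.pos _).le (h.append_le _ _) hs
    · intro p' _ hp'
      simp [List.ofFn_injective.ne hp']
    · simp
  · push Not at hu
    simp only [hu, if_false, Finset.sum_const_zero]
    exact mul_nonneg (Real.rpow_pos_of_pos (h.pos _) _).le (h.partitionSum_pos _ _).le

/-- The probability measure on the words of length `N` that gives to `w` a mass proportional to
`ψ(w)^s`. -/
noncomputable def gibbsMeasure (ψ : List (Fin S) → ℝ) (s : ℝ) (N : ℕ) :
    MeasureTheory.Measure (Fin N → Fin S) :=
  ∑ w : Fin N → Fin S, ENNReal.ofReal (ψ (List.ofFn w) ^ s / partitionSum ψ s N) •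
    MeasureTheory.Measure.dirac w

theorem gibbsMeasure_apply {ψ : List (Fin S) → ℝ} (hψ : ∀ w, 0 < ψ w)
    (s : ℝ) (N : ℕ) (p : (Fin N → Fin S) → Prop) [DecidablePred p] :
    gibbsMeasure ψ s N {w | p w} = ENNReal.ofReal
      ((∑ w : Fin N → Fin S, if p w then ψ (List.ofFn w) ^ s else 0) / partitionSum ψ s N) := by
  have hpos : ∀ w : List (Fin S), 0 ≤ ψ w ^ s := fun w => (Real.rpow_pos_of_pos (hψ w) s).le
  have hZ : 0 ≤ partitionSum ψ s N := Finset.sum_nonneg fun w _ => hpos _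
  rw [gibbsMeasure, MeasureTheory.Measure.coe_finsetSum, Finset.sum_apply, Finset.sum_div,
    ENNReal.ofReal_sum_of_nonneg fun w _ => by split_ifs; exacts [div_nonneg (hpos _) hZ, by simp]]
  refine Finset.sum_congr rfl fun w _ => ?_
  rw [MeasureTheory.Measure.smul_apply, MeasureTheory.Measure.dirac_apply, smul_eq_mul]
  by_cases hw : p w
  · rw [indicator_of_mem (by exact hw)]
    simp [hw]
  · rw [indicator_of_notMem (by exact hw)]
    simp [hw]

theorem isProbabilityMeasure_gibbsMeasure [NeZero S] {ψ : List (Fin S) → ℝ} {c b r : ℝ}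
    (h : IsAlmostMultiplicative ψ c b r) (s : ℝ) (N : ℕ) :
    MeasureTheory.IsProbabilityMeasure (gibbsMeasure ψ s N) := by
  constructor
  have : (univ : Set (Fin N → Fin S)) = {w | True} := by simp
  rw [this, gibbsMeasure_apply h.pos]
  simp only [if_true]
  change ENNReal.ofReal (partitionSum ψ s N / partitionSum ψ s N) = 1
  rw [div_self (h.partitionSum_pos s N).ne', ENNReal.ofReal_one]

/-- Completing u to length N multiplies its weight by at most the partition sum for N - j. The
two-sided bounds on partition sums leave ψ(u)^s e^{-jP} with the single constant c^{-s}, independent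
of N. -/
theorem gibbsMeasure_take_le [NeZero S] {ψ : List (Fin S) → ℝ} {c b r : ℝ}
    (h : IsAlmostMultiplicative ψ c b r) {s : ℝ} (hs : 0 ≤ s) {N j : ℕ} (hj : j ≤ N)
    (u : List (Fin S)) :
    gibbsMeasure ψ s N {w | (List.ofFn w).take j = u} ≤ ENNReal.ofReal
      (Real.exp (s * (-Real.log c) + s * Real.log (ψ u) - j * wordPressure ψ s)) := by
  rw [gibbsMeasure_apply h.pos]
  refine ENNReal.ofReal_le_ofReal ?_
  rw [div_le_iff₀ (h.partitionSum_pos s N)]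
  have h1 := h.exp_le_partitionSum hs N
  have h2 := h.partitionSum_le_exp hs (N - j)
  refine (sum_rpow_take_le h hs hj u).trans ?_
  calc ψ u ^ s * partitionSum ψ s (N - j)
      ≤ ψ u ^ s * (c ^ (-s) * Real.exp ((N - j : ℕ) * wordPressure ψ s)) :=
        mul_le_mul_of_nonneg_left h2 (Real.rpow_pos_of_pos (h.pos _) _).le
    _ = Real.exp (s * (-Real.log c) + s * Real.log (ψ u) - j * wordPressure ψ s) *
          Real.exp (N * wordPressure ψ s) := by
        rw [Real.rpow_def_of_pos (h.pos u), Real.rpow_def_of_pos h.c_pos, ← Real.exp_add,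
          ← Real.exp_add, ← Real.exp_add, Nat.cast_sub hj]
        congr 1; ring
    _ ≤ _ := mul_le_mul_of_nonneg_left h1 (Real.exp_pos _).le

/-! ### Sequences made of free segments and prefixes of `t` -/

section Segments

variable (t : ℕ → Fin S) (n l : ℕ → ℕ)

/-- The concatenation of the first `m` segments, each one a free word followed by a prefix
of `t`. -/
def segmentWord (x : ∀ m, Fin (n m) → Fin S) : ℕ → List (Fin S)
  | 0 => []
  | m + 1 => segmentWord x m ++ (List.ofFn (x m) ++ firstDigits t (l m))

/-- The length of the first `m` segments. -/
def segmentStart (m : ℕ) : ℕ := ∑ j ∈ Finset.range m, (n j + l j)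

/-- The sequence with the given free words. -/
def segmentSeq [NeZero S] (x : ∀ m, Fin (n m) → Fin S) (i : ℕ) : Fin S :=
  (segmentWord t n l x (i + 1)).getD i 0

variable {t n l}

theorem segmentStart_succ (m : ℕ) :
    segmentStart n l (m + 1) = segmentStart n l m + (n m + l m) := Finset.sum_range_succ _ _

theorem length_segmentWord (x : ∀ m, Fin (n m) → Fin S) (m : ℕ) :
    (segmentWord t n l x m).length = segmentStart n l m := by
  induction m with
  | zero => rfl
  | succ m ih => simp [segmentWord, segmentStart_succ, ih, length_firstDigits]

theorem le_segmentStart (hn : ∀ m, 1 ≤ n m) (m : ℕ) : m ≤ segmentStart n l m := by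
  induction m with
  | zero => exact Nat.zero_le _
  | succ m ih => rw [segmentStart_succ]; have := hn m; omega

theorem segmentWord_prefix (x : ∀ m, Fin (n m) → Fin S) {m k : ℕ} (hmk : m ≤ k) :
    segmentWord t n l x m <+: segmentWord t n l x k := by
  induction k, hmk using Nat.le_induction with
  | base => exact List.prefix_rfl
  | succ k _ ih => exact ih.trans (List.prefix_append _ _)

theorem segmentWord_congr {x y : ∀ m, Fin (n m) → Fin S} {m : ℕ} (hxy : ∀ j < m, x j = y j) :
    segmentWord t n l x m = segmentWord t n l y m := by
  induction m with
  | zero => rfl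
  | succ m ih =>
    rw [segmentWord, segmentWord, ih fun j hj => hxy j (by omega), hxy m (by omega)]

theorem eq_of_segmentWord_eq {x y : ∀ m, Fin (n m) → Fin S} {m : ℕ}
    (hxy : segmentWord t n l x m = segmentWord t n l y m) : ∀ j < m, x j = y j := by
  induction m with
  | zero => exact fun j hj => absurd hj (Nat.not_lt_zero j)
  | succ m ih =>
    rw [segmentWord, segmentWord] at hxy
    have h1 := List.append_inj hxy (by rw [length_segmentWord, length_segmentWord])
    intro j hj
    rcases Nat.lt_succ_iff_lt_or_eq.1 hj with hj | rfl
    · exact ih h1.1 j hj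
    · exact List.ofFn_injective (List.append_inj_left h1.2 (by simp))

variable [NeZero S]

theorem firstDigits_segmentSeq (hn : ∀ m, 1 ≤ n m) (x : ∀ m, Fin (n m) → Fin S) {N m : ℕ}
    (hN : N ≤ segmentStart n l m) :
    firstDigits (segmentSeq t n l x) N = (segmentWord t n l x m).take N := by
  refine List.ext_getElem (by simp [length_firstDigits, length_segmentWord, hN])
    fun i h1 h2 => ?_
  rw [length_firstDigits] at h1
  simp only [firstDigits, List.getElem_map, List.getElem_range, List.getElem_take, segmentSeq]
  have hi : i < (segmentWord t n l x (i + 1)).length := by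
    rw [length_segmentWord]; have := le_segmentStart (l := l) hn (i + 1); omega
  rw [List.getD_eq_getElem _ _ hi]
  rcases le_total (i + 1) m with hle | hle
  · exact (segmentWord_prefix x hle).getElem hi
  · exact ((segmentWord_prefix x hle).getElem (by rw [length_segmentWord]; omega)).symm

theorem occursAt_segmentSeq (hn : ∀ m, 1 ≤ n m) (x : ∀ m, Fin (n m) → Fin S) (m : ℕ) :
    OccursAt (segmentSeq t n l x) t (segmentStart n l m + n m) (l m) := by
  have h1 := firstDigits_segmentSeq (t := t) (l := l) hn x (le_refl (segmentStart n l (m + 1)))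
  rw [List.take_of_length_le (by rw [length_segmentWord]), segmentWord, segmentStart_succ,
    ← add_assoc, firstDigits_add, ← List.append_assoc] at h1
  have h2 := List.append_inj_right h1 (by simp [length_firstDigits, length_segmentWord])
  intro i hi
  have h3 := congrArg (fun L : List (Fin S) => L[i]?) h2
  simpa [firstDigits, hi] using h3

end Segments

namespace IsAlmostMultiplicative

variable {ψ : List (Fin S) → ℝ} {c b r : ℝ} (h : IsAlmostMultiplicative ψ c b r)
include h

theorem le_log_segmentWord (t : ℕ → Fin S) (n l : ℕ → ℕ) (x : ∀ m, Fin (n m) → Fin S) (m : ℕ) :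
    ∑ j ∈ Finset.range m, (Real.log (ψ (List.ofFn (x j))) + Real.log (ψ (firstDigits t (l j)))) +
      2 * m * Real.log c ≤ Real.log (ψ (segmentWord t n l x m)) := by
  induction m with
  | zero => simp [segmentWord, h.nil]
  | succ m ih =>
    rw [segmentWord, Finset.sum_range_succ]
    have h1 := h.le_log_append (segmentWord t n l x m) (List.ofFn (x m) ++ firstDigits t (l m))
    have h2 := h.le_log_append (List.ofFn (x m)) (firstDigits t (l m))
    push_cast
    linarith

/-- The distribution of independent free words. -/
theorem infinitePi_gibbsMeasure_le [NeZero S] (t : ℕ → Fin S) {n l : ℕ → ℕ} (hn : ∀ m, 1 ≤ n m)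
    {s : ℝ} (hs : 0 ≤ s) (hP : 0 ≤ wordPressure ψ s) {C δ : ℝ} (hδ : 0 ≤ δ)
    (hC0 : 3 * (s * (-Real.log c)) ≤ C)
    (hC : ∀ k : ℕ, (3 * k + 6) * (s * (-Real.log c)) +
      ∑ m ∈ Finset.range (k + 1),
        (-s * Real.log (ψ (firstDigits t (l m))) - wordPressure ψ s * n m) ≤
      C + δ * (segmentStart n l k + n k : ℕ))
    (y : ∀ m, Fin (n m) → Fin S) (N : ℕ) :
    MeasureTheory.Measure.infinitePi (fun m => gibbsMeasure ψ s (n m))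
      {x | firstDigits (segmentSeq t n l x) N = firstDigits (segmentSeq t n l y) N} ≤
      ENNReal.ofReal (Real.exp (C + δ * N +
        s * Real.log (ψ (firstDigits (segmentSeq t n l y) N)))) := by
  have hprob : ∀ m, MeasureTheory.IsProbabilityMeasure (gibbsMeasure ψ s (n m)) := fun m =>
    isProbabilityMeasure_gibbsMeasure h s (n m)
  set P := wordPressure ψ s with hPdef
  set Cc := s * (-Real.log c) with hCc
  have hCc0 : 0 ≤ Cc := mul_nonneg hs (by linarith [h.log_c_nonpos])
  obtain ⟨k, hk1, hk2⟩ : ∃ k, segmentStart n l k ≤ N ∧ N < segmentStart n l (k + 1) := by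
    have hex : ∃ k, N < segmentStart n l k := ⟨N + 1, by
      have := le_segmentStart (l := l) hn (N + 1); omega⟩
    classical
    have hf := Nat.find_spec hex
    have h0 : Nat.find hex ≠ 0 := by
      intro h0
      rw [h0] at hf
      simp [segmentStart] at hf
    obtain ⟨k, hk⟩ := Nat.exists_eq_succ_of_ne_zero h0
    exact ⟨k, not_lt.1 (Nat.find_min hex (by omega)), by rw [hk] at hf; exact hf⟩
  -- The prefix of length N consists of k full segments, j digits of the next free word, and i
  -- digits of the block after it. If i > 0, the free word is complete.
  set j := min (n k) (N - segmentStart n l k) with hj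
  set i := N - (segmentStart n l k + j) with hi
  have hjn : j ≤ n k := min_le_left _ _
  have hjN : segmentStart n l k + j ≤ N := by omega
  rw [segmentStart_succ] at hk2
  set u := (List.ofFn (y k)).take j with hu
  -- the shape of the prefixes
  have hshape : ∀ x : ∀ m, Fin (n m) → Fin S,
      firstDigits (segmentSeq t n l x) (segmentStart n l k + j) =
        segmentWord t n l x k ++ (List.ofFn (x k)).take j := by
    intro x
    rw [firstDigits_segmentSeq hn x (m := k + 1) (by rw [segmentStart_succ]; omega), segmentWord,
      List.take_append, length_segmentWord, Nat.add_sub_cancel_left,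
      List.take_of_length_le (by rw [length_segmentWord]; omega),
      List.take_append_of_le_length (by simpa using hjn)]
  have hword : firstDigits (segmentSeq t n l y) N =
      segmentWord t n l y k ++ (u ++ firstDigits t i) := by
    rw [show N = segmentStart n l k + j + i by omega, firstDigits_add, hshape, List.append_assoc]
    congr 2
    rcases Nat.eq_zero_or_pos i with h0 | h0
    · rw [h0]; rfl
    · have hjk : j = n k := by omega
      rw [hjk]
      exact ((occursAt_segmentSeq (t := t) (l := l) hn y k).mono (by omega)).firstDigits_eq
  -- the cylinder is contained in a box
  have hsub : {x | firstDigits (segmentSeq t n l x) N = firstDigits (segmentSeq t n l y) N} ⊆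
      (↑(Finset.range (k + 1)) : Set ℕ).pi (fun m => {w : Fin (n m) → Fin S |
        (List.ofFn w).take (if m < k then n m else j) =
          (List.ofFn (y m)).take (if m < k then n m else j)}) := by
    intro x hx m hm
    have hx' : firstDigits (segmentSeq t n l x) (segmentStart n l k + j) =
        firstDigits (segmentSeq t n l y) (segmentStart n l k + j) := by
      have hx0 : firstDigits (segmentSeq t n l x) N = firstDigits (segmentSeq t n l y) N := hx
      rw [show N = segmentStart n l k + j + i by omega, firstDigits_add,
        firstDigits_add (segmentSeq t n l y)] at hx0
      exact List.append_inj_left hx0 (by simp [length_firstDigits])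
    rw [hshape, hshape] at hx'
    have h1 := List.append_inj hx' (by rw [length_segmentWord, length_segmentWord])
    simp only [Finset.coe_range, mem_Iio] at hm
    rcases Nat.lt_succ_iff_lt_or_eq.1 hm with hmk | rfl
    · have := eq_of_segmentWord_eq h1.1 m hmk
      simp [this]
    · simpa using h1.2
  refine (MeasureTheory.measure_mono hsub).trans ?_
  rw [MeasureTheory.Measure.infinitePi_pi _ fun m _ => MeasurableSet.of_discrete,
    Finset.prod_range_succ]
  have hlast : gibbsMeasure ψ s (n k) {w : Fin (n k) → Fin S |
        (List.ofFn w).take (if k < k then n k else j) =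
          (List.ofFn (y k)).take (if k < k then n k else j)} ≤
      ENNReal.ofReal (Real.exp (Cc + s * Real.log (ψ u) - j * P)) := by
    simp only [lt_irrefl, if_false]
    exact gibbsMeasure_take_le h hs hjn u
  have hfirst : ∏ m ∈ Finset.range k, gibbsMeasure ψ s (n m) {w : Fin (n m) → Fin S |
        (List.ofFn w).take (if m < k then n m else j) =
          (List.ofFn (y m)).take (if m < k then n m else j)} ≤
      ENNReal.ofReal (Real.exp (∑ m ∈ Finset.range k,
        (Cc + s * Real.log (ψ (List.ofFn (y m))) - n m * P))) := by
    rw [Real.exp_sum, ENNReal.ofReal_prod_of_nonneg fun m _ => (Real.exp_pos _).le]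
    refine Finset.prod_le_prod' fun m hm => ?_
    simp only [Finset.mem_range.1 hm, if_true]
    have := gibbsMeasure_take_le h hs (le_refl (n m)) ((List.ofFn (y m)).take (n m))
    have e : (List.ofFn (y m)).take (n m) = List.ofFn (y m) := List.take_of_length_le (by simp)
    rw [e] at this ⊢
    exact this
  refine (mul_le_mul' hfirst hlast).trans ?_
  rw [← ENNReal.ofReal_mul (Real.exp_pos _).le, ← Real.exp_add]
  refine ENNReal.ofReal_le_ofReal (Real.exp_le_exp.2 ?_)
  rw [hword]
  have h1 := h.le_log_append (segmentWord t n l y k) (u ++ firstDigits t i)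
  have h2 := h.le_log_append u (firstDigits t i)
  have h3 := h.le_log_segmentWord t n l y k
  have h4 : s * (∑ j ∈ Finset.range k, (Real.log (ψ (List.ofFn (y j))) +
      Real.log (ψ (firstDigits t (l j)))) + Real.log (ψ u) + Real.log (ψ (firstDigits t i))) +
      s * ((2 * k + 2) * Real.log c) ≤
      s * Real.log (ψ (segmentWord t n l y k ++ (u ++ firstDigits t i))) := by
    rw [← mul_add]
    exact mul_le_mul_of_nonneg_left (by linarith) hs
  set E := s * Real.log (ψ (segmentWord t n l y k ++ (u ++ firstDigits t i))) with hE
  have hsum1 : ∑ m ∈ Finset.range k, (Cc + s * Real.log (ψ (List.ofFn (y m))) - n m * P) =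
      k * Cc + s * (∑ m ∈ Finset.range k, Real.log (ψ (List.ofFn (y m)))) -
        P * ∑ m ∈ Finset.range k, (n m : ℝ) := by
    rw [Finset.sum_sub_distrib, Finset.sum_add_distrib, Finset.sum_const, Finset.card_range,
      nsmul_eq_mul, Finset.mul_sum, Finset.mul_sum]
    congr 1
    exact Finset.sum_congr rfl fun m _ => mul_comm _ _
  have hR : ∀ k, ∑ m ∈ Finset.range k,
      (-s * Real.log (ψ (firstDigits t (l m))) - P * n m) =
      -s * (∑ m ∈ Finset.range k, Real.log (ψ (firstDigits t (l m)))) -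
        P * ∑ m ∈ Finset.range k, (n m : ℝ) := by
    intro k
    rw [Finset.sum_sub_distrib, Finset.mul_sum, Finset.mul_sum]
  rw [hsum1]
  rw [Finset.sum_add_distrib] at h4
  have hlogc : s * ((2 * k + 2) * Real.log c) = -((2 * k + 2) * Cc) := by rw [hCc]; ring
  rw [hlogc] at h4
  -- The worst places are the starts of planted blocks, where `hC` already charges for the whole
  -- block. A prefix ending in a free word of index at least 1 uses `hC` for the previous block,
  -- where the constants add up to exactly 3k + 6. In the first free word `hC0` suffices. A prefix
  -- reaching into block k uses `hC k`, as a partial block contracts no more than the full one.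
  rcases Nat.eq_zero_or_pos i with hi0 | hi0
  · -- the prefix ends in a free word
    have hz : Real.log (ψ (firstDigits t i)) = 0 := by
      rw [hi0]; simp [firstDigits, h.nil]
    rw [hz] at h4
    have hjP : 0 ≤ j * P := by positivity
    cases k with
    | zero =>
      simp only [Finset.range_zero, Finset.sum_empty, Nat.cast_zero] at h4 ⊢
      have : 0 ≤ δ * N := by positivity
      linarith
    | succ k =>
      have h5 := hC k
      rw [hR] at h5
      have h6 : ((segmentStart n l k + n k : ℕ) : ℝ) ≤ N := by
        rw [segmentStart_succ] at hk1
        exact_mod_cast (by omega : segmentStart n l k + n k ≤ N)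
      have h7 := mul_le_mul_of_nonneg_left h6 hδ
      push_cast at h4 h5 ⊢
      push_cast at h7
      linarith
  · -- the prefix ends inside a block
    have hjk : j = n k := by omega
    have h5 := hC k
    rw [hR, Finset.sum_range_succ, Finset.sum_range_succ] at h5
    have h6 : ((segmentStart n l k + n k : ℕ) : ℝ) ≤ N := by
      exact_mod_cast (by omega : segmentStart n l k + n k ≤ N)
    have h7 := mul_le_mul_of_nonneg_left h6 hδ
    have h8 : Real.log (ψ (firstDigits t (l k))) ≤ Real.log (ψ (firstDigits t i)) := by
      obtain ⟨q, hq⟩ := Nat.exists_eq_add_of_le (show i ≤ l k by omega)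
      rw [hq, firstDigits_add]
      exact h.log_append_le_left _ _
    have h9 := mul_le_mul_of_nonneg_left h8 hs
    rw [hjk]
    push_cast at h5 h7
    linarith

end IsAlmostMultiplicative

end

/-! ### The mass distribution principle for the coding map. -/

section

variable {S : ℕ}

theorem Set.finite_of_forall_finset_card_le {α : Type*} {T : Set α} {K : ℝ}
    (h : ∀ T' : Finset α, (↑T' : Set α) ⊆ T → (T'.card : ℝ) ≤ K) : T.Finite := by
  by_contra hinf
  obtain ⟨T', hT', hcard⟩ := Set.Infinite.exists_subset_card_eq hinf (⌊K⌋₊ + 1)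
  have h1 := h T' hT'
  have h2 := Nat.lt_floor_add_one K
  rw [hcard] at h1
  push_cast at h1
  linarith

namespace ConformalIFS

variable {d : ℕ} (F : ConformalIFS d S)

/-- The coding map is continuous along every map under which the first digits depend
continuously on the parameter. -/
theorem continuous_coding_comp {X : Type*} [TopologicalSpace X] {φ : X → ℕ → Fin S}
    (hφ : ∀ x N, ∀ᶠ y in 𝓝 x, firstDigits (φ y) N = firstDigits (φ x) N) :
    Continuous fun x => F.coding (φ x) := by
  obtain ⟨u, hu0, hd⟩ := F.exists_dist_word
  rw [continuous_iff_continuousAt]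
  intro x
  rw [ContinuousAt, tendsto_iff_dist_tendsto_zero, Metric.tendsto_nhds]
  intro ε hε
  obtain ⟨N, hN⟩ := ((tendsto_order.1 hu0).2 ε hε).exists
  filter_upwards [hφ x N] with y hy
  rw [Real.dist_0_eq_abs, abs_of_nonneg dist_nonneg]
  refine (hd (φ x) N _ ?_ _ (F.coding_mem_closure (φ x) N)).trans_lt hN
  rw [← hy]
  exact F.coding_mem_closure (φ y) N

variable [Nontrivial (EuclideanSpace ℝ (Fin d))] {F}

/-- The mass distribution principle for cylinders. -/
theorem le_dimH_coding_range (hF : F.OpenSetCondition) {X : Type*} [MeasurableSpace X]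
    (P : MeasureTheory.Measure X) [MeasureTheory.IsProbabilityMeasure P] {φ : X → ℕ → Fin S}
    (hmeas : Measurable fun x => F.coding (φ x)) {s : ℝ≥0} (hs : 0 < s) {K : ℝ} (hK : 0 < K)
    (hcyl : ∀ y N, P {x | firstDigits (φ x) N = firstDigits (φ y) N} ≤
      ENNReal.ofReal (K * F.derivNorm (firstDigits (φ y) N) ^ (s : ℝ))) :
    (s : ℝ≥0∞) ≤ dimH (F.coding '' range φ) := by
  obtain ⟨c, b, r, h⟩ := F.exists_isAlmostMultiplicative
  have hc := h.c_pos
  have hb := h.b_pos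
  have hs' : (0 : ℝ) < s := hs
  obtain ⟨N₀, hN₀⟩ := F.exists_card_bound hF (mul_pos hc hb)
  set N₁ := max N₀ 1 with hN₁
  have hN₁0 : 0 < N₁ := lt_max_of_lt_right one_pos
  -- the main estimate
  have hmain : ∀ ρ : ℝ, 0 < ρ → ρ ≤ 1 → ∀ A : Set (EuclideanSpace ℝ (Fin d)),
      (∀ x ∈ A, ∀ y ∈ A, dist x y ≤ ρ) →
      P ((fun x => F.coding (φ x)) ⁻¹' A) ≤ ENNReal.ofReal (N₁ * K * ρ ^ (s : ℝ)) := by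
    intro ρ hρ hρ1 A hA
    have hex : ∀ y : X, ∃ N, F.derivNorm (firstDigits (φ y) N) ≤ ρ := by
      intro y
      obtain ⟨N, hN⟩ := ((tendsto_pow_atTop_nhds_zero_of_lt_one h.r_pos.le
        h.r_lt_one).eventually_le_const hρ).exists
      refine ⟨N, (h.le_pow _).trans ?_⟩
      rwa [length_firstDigits]
    classical
    -- Stopping words: the shortest prefix whose norm is at most ρ. Minimality bounds the norm below
    -- by cbρ and makes distinct stopping words incomparable, as `exists_card_bound` needs.
    let w : X → List (Fin S) := fun y => firstDigits (φ y) (Nat.find (hex y))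
    have hw1 : ∀ y, F.derivNorm (w y) ≤ ρ := fun y => Nat.find_spec (hex y)
    have hw2 : ∀ y, c * b * ρ ≤ F.derivNorm (w y) := by
      intro y
      rcases Nat.eq_zero_or_pos (Nat.find (hex y)) with h0 | h0
      · have : w y = [] := by simp only [w]; rw [h0]; rfl
        rw [this, h.nil]
        have := h.c_le_one
        have := h.b_lt_one
        have h1 : c * b ≤ 1 := by nlinarith
        nlinarith [mul_pos hc hb]
      · obtain ⟨N, hN⟩ := Nat.exists_eq_succ_of_ne_zero h0.ne'
        have h1 := Nat.find_min (hex y) (m := N) (by omega)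
        have h2 : w y = firstDigits (φ y) N ++ firstDigits (fun i => φ y (N + i)) 1 := by
          simp only [w]
          rw [hN, Nat.succ_eq_add_one, firstDigits_add]
        have h3 := h.pow_le (firstDigits (fun i => φ y (N + i)) 1)
        rw [length_firstDigits, pow_one] at h3
        rw [h2]
        refine le_trans ?_ (h.le_append _ _)
        rw [mul_assoc, mul_comm b]
        exact mul_le_mul_of_nonneg_left (mul_le_mul (not_le.1 h1).le h3 hb.le (h.pos _).le) hc.le
    have hanti : ∀ x y, w x ≠ w y → ¬ w x <+: w y := by
      intro x y hne hpre
      have hlen := hpre.length_le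
      simp only [w, length_firstDigits] at hlen
      rcases hlen.lt_or_eq with hlt | heq
      · refine Nat.find_min (hex y) hlt ?_
        obtain ⟨k, hk⟩ := Nat.exists_eq_add_of_le hlen
        have h1 : firstDigits (φ y) (Nat.find (hex x)) = w x := by
          have h2 := hpre
          simp only [w] at h2
          rw [hk, firstDigits_add] at h2
          have h3 := List.prefix_of_prefix_length_le h2 (List.prefix_append _ _)
            (by simp [length_firstDigits])
          exact (h3.eq_of_length (by simp [length_firstDigits])).symm
        rw [h1]
        exact hw1 x
      · exact hne (hpre.eq_of_length (by simp only [w, length_firstDigits]; exact heq))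
    let T : Set (List (Fin S)) := w '' ((fun x => F.coding (φ x)) ⁻¹' A)
    have hcard : ∀ T' : Finset (List (Fin S)), (↑T' : Set (List (Fin S))) ⊆ T →
        (T'.card : ℝ) ≤ N₀ := by
      intro T' hT'
      refine hN₀ ρ hρ A hA T' ?_ ?_
      · intro u hu v hv huv
        obtain ⟨x, -, rfl⟩ := hT' hu
        obtain ⟨y, -, rfl⟩ := hT' hv
        exact hanti x y huv
      · intro u hu
        obtain ⟨x, hx, rfl⟩ := hT' hu
        exact ⟨hw2 x, hw1 x, _, hx, F.coding_mem_closure _ _⟩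
    have hfin : T.Finite := Set.finite_of_forall_finset_card_le hcard
    have hsub : (fun x => F.coding (φ x)) ⁻¹' A ⊆
        ⋃ u ∈ hfin.toFinset, {x | firstDigits (φ x) u.length = u} := by
      intro x hx
      refine mem_iUnion₂.2 ⟨w x, hfin.mem_toFinset.2 (mem_image_of_mem w hx), ?_⟩
      simp only [mem_ofPred_eq, w, length_firstDigits]
    calc P ((fun x => F.coding (φ x)) ⁻¹' A)
        ≤ P (⋃ u ∈ hfin.toFinset, {x | firstDigits (φ x) u.length = u}) :=
          MeasureTheory.measure_mono hsub
      _ ≤ ∑ u ∈ hfin.toFinset, P {x | firstDigits (φ x) u.length = u} :=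
          MeasureTheory.measure_biUnion_finset_le _ _
      _ ≤ ∑ u ∈ hfin.toFinset, ENNReal.ofReal (K * ρ ^ (s : ℝ)) := by
          refine Finset.sum_le_sum fun u hu => ?_
          obtain ⟨y, -, rfl⟩ := hfin.mem_toFinset.1 hu
          have h1 := hcyl y (Nat.find (hex y))
          have h2 : (w y).length = Nat.find (hex y) := length_firstDigits _ _
          rw [h2]
          refine h1.trans (ENNReal.ofReal_le_ofReal (mul_le_mul_of_nonneg_left ?_ hK.le))
          exact Real.rpow_le_rpow (h.pos _).le (hw1 y) hs'.le
      _ = ENNReal.ofReal (hfin.toFinset.card * (K * ρ ^ (s : ℝ))) := by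
          rw [Finset.sum_const, nsmul_eq_mul, ENNReal.ofReal_mul (Nat.cast_nonneg _),
            ENNReal.ofReal_natCast]
      _ ≤ _ := by
          refine ENNReal.ofReal_le_ofReal ?_
          have h1 := (hcard hfin.toFinset (by simp)).trans (le_max_left N₀ 1)
          have h2 : 0 ≤ K * ρ ^ (s : ℝ) := by positivity
          rw [mul_assoc]
          exact mul_le_mul_of_nonneg_right h1 h2
  set ν := P.map fun x => F.coding (φ x) with hν
  set C : ℝ≥0∞ := ENNReal.ofReal (N₁ * K) with hC
  have hC0 : C ≠ 0 := by rw [hC, Ne, ENNReal.ofReal_eq_zero, not_le]; positivity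
  have hCtop : C ≠ ∞ := ENNReal.ofReal_ne_top
  -- Passing to closures keeps the diameter and makes the sets measurable for the image measure.
  have hle : C⁻¹ • ν ≤ MeasureTheory.Measure.hausdorffMeasure (s : ℝ) := by
    refine MeasureTheory.Measure.le_hausdorffMeasure _ _ 1 one_pos fun A hA => ?_
    rw [MeasureTheory.Measure.smul_apply, smul_eq_mul, ENNReal.inv_mul_le_iff hC0 hCtop]
    rw [← Metric.ediam_closure] at hA ⊢
    refine (MeasureTheory.measure_mono subset_closure).trans ?_
    rw [hν, MeasureTheory.Measure.map_apply hmeas isClosed_closure.measurableSet]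
    set D := Metric.ediam (closure A) with hD
    have hDtop : D ≠ ∞ := ne_top_of_le_ne_top ENNReal.one_ne_top hA
    have hdist : ∀ x ∈ closure A, ∀ y ∈ closure A, dist x y ≤ D.toReal := by
      intro x hx y hy
      rw [dist_edist]
      exact ENNReal.toReal_mono hDtop (Metric.edist_le_ediam_of_mem hx hy)
    have hD1 : D.toReal ≤ 1 := by
      have := ENNReal.toReal_mono ENNReal.one_ne_top hA
      simpa using this
    have hbig : ∀ ρ : ℝ, 0 < ρ → D.toReal ≤ ρ → ρ ≤ 1 →
        P ((fun x => F.coding (φ x)) ⁻¹' closure A) ≤ C * ENNReal.ofReal ρ ^ (s : ℝ) := by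
      intro ρ hρ hDρ hρ1
      refine (hmain ρ hρ hρ1 _ fun x hx y hy => (hdist x hx y hy).trans hDρ).trans ?_
      rw [ENNReal.ofReal_rpow_of_pos hρ, hC, ENNReal.ofReal_mul (by positivity)]
    -- A set of diameter 0 is not covered by the estimate at ρ = 0, so ρ ↓ 0 is used instead.
    rcases eq_or_lt_of_le (ENNReal.toReal_nonneg (a := D)) with h0 | hpos
    · have hD0 : D = 0 := by
        rcases (ENNReal.toReal_eq_zero_iff D).1 h0.symm with h1 | h1
        · exact h1
        · exact absurd h1 hDtop
      rw [hD0, ENNReal.zero_rpow_of_pos hs', mul_zero]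
      have hlim : Tendsto (fun ρ : ℝ => C * ENNReal.ofReal ρ ^ (s : ℝ)) (𝓝[>] 0)
          (𝓝 (C * ENNReal.ofReal 0 ^ (s : ℝ))) := by
        refine ENNReal.Tendsto.const_mul ?_ (Or.inr hCtop)
        exact ((ENNReal.continuous_rpow_const.comp ENNReal.continuous_ofReal).tendsto 0).mono_left
          nhdsWithin_le_nhds
      rw [ENNReal.ofReal_zero, ENNReal.zero_rpow_of_pos hs', mul_zero] at hlim
      refine ge_of_tendsto hlim ?_
      filter_upwards [Ioc_mem_nhdsGT (zero_lt_one' ℝ)] with ρ hρ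
      exact hbig ρ hρ.1 (by rw [← h0]; exact hρ.1.le) hρ.2
    · have := hbig D.toReal hpos le_rfl hD1
      rwa [ENNReal.ofReal_toReal hDtop] at this
  refine le_dimH_of_hausdorffMeasure_ne_zero fun hzero => ?_
  have h1 := hle (F.coding '' range φ)
  rw [hzero, MeasureTheory.Measure.smul_apply, smul_eq_mul, nonpos_iff_eq_zero, mul_eq_zero] at h1
  rcases h1 with h1 | h1
  · exact ENNReal.inv_ne_zero.2 hCtop h1
  -- The image of the range need not be measurable; the inequality for the outer measure suffices.
  · have h2 := MeasureTheory.Measure.le_map_apply (μ := P) hmeas.aemeasurable (F.coding '' range φ)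
    have h3 : (fun x => F.coding (φ x)) ⁻¹' (F.coding '' range φ) = univ :=
      eq_univ_of_forall fun x => mem_image_of_mem _ (mem_range_self x)
    rw [h3, MeasureTheory.measure_univ, ← hν, h1] at h2
    exact absurd h2 (by simp)

/-- The dimension of the set of sequences with independent free segments. -/
theorem le_dimH_coding_range_segmentSeq [NeZero S] (hF : F.OpenSetCondition) (t : ℕ → Fin S)
    {c b r : ℝ} (h : IsAlmostMultiplicative F.derivNorm c b r)
    {n l : ℕ → ℕ} (hn : ∀ m, 1 ≤ n m) {s : ℝ} (hP : 0 ≤ wordPressure F.derivNorm s)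
    {C : ℝ} {η : ℝ≥0} (hη : 0 < η) (hηs : (η : ℝ) < s)
    (hC0 : 3 * (s * (-Real.log c)) ≤ C)
    (hC : ∀ k : ℕ, (3 * k + 6) * (s * (-Real.log c)) +
      ∑ m ∈ Finset.range (k + 1),
        (-s * Real.log (F.derivNorm (firstDigits t (l m))) - wordPressure F.derivNorm s * n m) ≤
      C + η * (-Real.log r) * (segmentStart n l k + n k : ℕ)) :
    ENNReal.ofReal (s - η) ≤ dimH (F.coding '' range (segmentSeq t n l)) := by
  have hη' : (0 : ℝ) < η := hη
  have hprob : ∀ m, MeasureTheory.IsProbabilityMeasure (gibbsMeasure F.derivNorm s (n m)) :=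
    fun m => isProbabilityMeasure_gibbsMeasure h s (n m)
  have hcont : Continuous fun x : (∀ m, Fin (n m) → Fin S) => F.coding (segmentSeq t n l x) := by
    refine F.continuous_coding_comp fun x N => ?_
    have hopen : IsOpen ((↑(Finset.range N) : Set ℕ).pi fun m => ({x m} : Set (Fin (n m) → Fin S))) :=
      isOpen_set_pi (Finset.finite_toSet _) fun m _ => isOpen_discrete _
    filter_upwards [hopen.mem_nhds fun m _ => rfl] with y hy
    rw [firstDigits_segmentSeq hn y (le_segmentStart hn N),
      firstDigits_segmentSeq hn x (le_segmentStart hn N)]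
    rw [segmentWord_congr fun j hj => hy j (by simpa using hj)]
  have hr := h.log_r_neg
  refine le_dimH_coding_range (s := (s - η).toNNReal) hF
    (MeasureTheory.Measure.infinitePi fun m => gibbsMeasure F.derivNorm s (n m))
    hcont.measurable (Real.toNNReal_pos.2 (by linarith)) (Real.exp_pos C) fun y N => ?_
  have hδ : 0 ≤ (η : ℝ) * (-Real.log r) := mul_nonneg hη'.le (by linarith)
  refine (h.infinitePi_gibbsMeasure_le t hn (by linarith) hP hδ hC0 hC y N).trans
    (ENNReal.ofReal_le_ofReal ?_)
  rw [Real.coe_toNNReal _ (by linarith), Real.rpow_def_of_pos (h.pos _), ← Real.exp_add]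
  refine Real.exp_le_exp.2 ?_
  -- The error e^{δN} with δ = η(-log r) is absorbed by lowering the exponent from s to s - η, since
  -- log ψ ≤ N log r on words of length N.
  have h1 := h.log_le (firstDigits (segmentSeq t n l y) N)
  rw [length_firstDigits] at h1
  nlinarith [mul_le_mul_of_nonneg_left h1 hη'.le]

end ConformalIFS

end

/-! ### Geometrically growing segments and the lower bound. -/

section

variable {S : ℕ}

theorem sum_pow_range {θ : ℝ} (hθ : 1 < θ) (k : ℕ) :
    ∑ m ∈ Finset.range k, θ ^ m = (θ ^ k - 1) / (θ - 1) :=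
  geom_sum_eq hθ.ne' k

namespace IsAlmostMultiplicative

variable {ψ : List (Fin S) → ℝ} {c b r : ℝ} (h : IsAlmostMultiplicative ψ c b r)
include h

/-- Geometrically growing segments whose blocks are compared with the word that defines `Ω`. -/
theorem exists_segments (t : ℕ → Fin S) {s v θ Ω P δ : ℝ} (hs : 0 ≤ s) (hv : v ∈ Ioo (0 : ℝ) 1)
    (hθ : 1 / (1 - v) < θ) (hP0 : 0 ≤ P) (hP : P = -s * ((θ - 1) / (θ - θ * v - 1)) * Ω)
    (hΩ0 : Ω ≤ 0)
    (hΩ : ∀ η > 0, ∀ᶠ M : ℕ in atTop, (Ω - η) * M ≤ Real.log (ψ (targetWord t θ v M)))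
    (hδ : 0 < δ) : ∃ v' > v, ∃ (n l : ℕ → ℕ) (C : ℝ), (∀ m, 1 ≤ n m) ∧
      (∀ k : ℕ, (3 * k + 6) * (s * (-Real.log c)) + ∑ m ∈ Finset.range (k + 1),
        (-s * Real.log (ψ (firstDigits t (l m))) - P * n m) ≤
          C + δ * (segmentStart n l k + n k : ℕ)) ∧
      (∀ k, v' * θ ^ (k + 1) ≤ l k) ∧
      ∀ k, ((segmentStart n l k + n k : ℕ) : ℝ) ≤ θ ^ k + 2 * (k + 1) := by
  obtain ⟨hv0, hv1⟩ := hv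
  set B := -Real.log b with hB
  set Cc := -Real.log c with hCc
  have hB0 : 0 < B := by have := h.log_b_neg; linarith
  have hCc0 : 0 ≤ Cc := by have := h.log_c_nonpos; linarith
  have hcrit : 1 < θ * (1 - v) := by
    rwa [div_lt_iff₀ (by linarith)] at hθ
  have hθ1 : 1 < θ := by nlinarith
  have hθ0 : 0 < θ := by linarith
  have hθm : 0 < θ - 1 := by linarith
  set K := s * B * (θ ^ 2 / (θ - 1)) + P * (θ / (θ - 1)) with hK
  have hK0 : 0 ≤ K := by positivity
  -- Excess of v' over v. The first bound keeps the extra cost of the longer blocks below δ/4, the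
  -- second keeps a positive density of free digits.
  set τ := min (δ / (4 * (K + 1))) ((θ * (1 - v) - 1) / (2 * θ)) with hτ
  have hτ0 : 0 < τ := lt_min (by positivity) (div_pos (by linarith) (by positivity))
  have hτK : τ * K ≤ δ / 4 := by
    have h1 : τ ≤ δ / (4 * (K + 1)) := min_le_left _ _
    rw [le_div_iff₀ (by positivity)] at h1
    nlinarith
  have hτα : τ * θ < θ * (1 - v) - 1 := by
    have h1 : τ ≤ (θ * (1 - v) - 1) / (2 * θ) := min_le_right _ _
    rw [le_div_iff₀ (by positivity)] at h1
    nlinarith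
  set η := δ / (4 * (s + 1)) with hη
  have hη0 : 0 < η := by positivity
  have hsη : s * η ≤ δ / 4 := by
    have : s * η = δ / 4 * (s / (s + 1)) := by rw [hη]; field_simp
    rw [this]
    have : s / (s + 1) ≤ 1 := by rw [div_le_one (by positivity)]; linarith
    nlinarith
  set v' := v + τ with hv'
  -- With n_m ≈ αθ^m and l_m ≈ v'θ^{m+1}, this is the density that puts the start of block k at θ^k
  -- up to lower order; see `hαβ` and `hgeo`.
  set α := (θ - 1 - v' * θ) / θ with hα
  have hα0 : 0 < α := div_pos (by rw [hv']; nlinarith) hθ0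
  let n : ℕ → ℕ := fun m => ⌈α * θ ^ m⌉₊
  let l : ℕ → ℕ := fun m => ⌈v' * θ ^ (m + 1)⌉₊
  have hv'0 : 0 < v' := by linarith
  have hn1 : ∀ m, α * θ ^ m ≤ n m := fun m => Nat.le_ceil _
  have hn2 : ∀ m, (n m : ℝ) ≤ α * θ ^ m + 1 := fun m => (Nat.ceil_lt_add_one (by positivity)).le
  have hl1 : ∀ m, v' * θ ^ (m + 1) ≤ l m := fun m => Nat.le_ceil _
  have hl2 : ∀ m, (l m : ℝ) ≤ v' * θ ^ (m + 1) + 1 := fun m =>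
    (Nat.ceil_lt_add_one (by positivity)).le
  have hαβ : (α + v' * θ) / (θ - 1) + α = 1 := by rw [hα]; field_simp; ring
  have hgeo : ∀ k : ℕ, ∑ m ∈ Finset.range k, (α * θ ^ m + v' * θ ^ (m + 1)) + α * θ ^ k =
      θ ^ k - (α + v' * θ) / (θ - 1) := by
    intro k
    have h1 : ∑ m ∈ Finset.range k, (α * θ ^ m + v' * θ ^ (m + 1)) =
        (α + v' * θ) / (θ - 1) * (θ ^ k - 1) := by
      rw [div_mul_eq_mul_div, mul_div_assoc, ← sum_pow_range hθ1, Finset.mul_sum]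
      exact Finset.sum_congr rfl fun m _ => by ring
    rw [h1]
    have h2 : α = 1 - (α + v' * θ) / (θ - 1) := by linarith
    calc _ = (α + v' * θ) / (θ - 1) * (θ ^ k - 1) + (1 - (α + v' * θ) / (θ - 1)) * θ ^ k := by
          rw [← h2]
      _ = _ := by ring
  have hpos1 : ∀ k : ℕ, θ ^ k - (α + v' * θ) / (θ - 1) ≤ ((segmentStart n l k + n k : ℕ) : ℝ) := by
    intro k
    rw [← hgeo, segmentStart]
    push_cast
    exact add_le_add (Finset.sum_le_sum fun m _ => add_le_add (hn1 m) (hl1 m)) (hn1 k)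
  have hpos2 : ∀ k : ℕ, ((segmentStart n l k + n k : ℕ) : ℝ) ≤ θ ^ k + 2 * (k + 1) := by
    intro k
    have h1 : ((segmentStart n l k + n k : ℕ) : ℝ) ≤
        ∑ m ∈ Finset.range k, ((α * θ ^ m + v' * θ ^ (m + 1)) + 2) + (α * θ ^ k + 1) := by
      rw [segmentStart]
      push_cast
      exact add_le_add (Finset.sum_le_sum fun m _ => by linarith [hn2 m, hl2 m]) (hn2 k)
    rw [Finset.sum_add_distrib, Finset.sum_const, Finset.card_range, nsmul_eq_mul] at h1
    have h2 := hgeo k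
    have h3 : 0 ≤ (α + v' * θ) / (θ - 1) := by positivity
    linarith
  -- the cost of the first segments
  let X : ℕ → ℝ := fun k => (3 * k + 6) * (s * Cc) + ∑ m ∈ Finset.range (k + 1),
    (-s * Real.log (ψ (firstDigits t (l m))) - P * n m)
  -- The pressure equation at work: the entropy of the free digits before θ^k equals the cost -sΩθ^k
  -- of the planted blocks, up to a term of order τ.
  have hPκ : P * ((θ - 1 - v' * θ) / (θ - 1)) = -s * Ω - P * τ * (θ / (θ - 1)) := by
    have h1 : θ - θ * v - 1 ≠ 0 := by nlinarith
    have h2 : P * ((θ - θ * v - 1) / (θ - 1)) = -s * Ω := by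
      have e : ∀ D E : ℝ, D ≠ 0 → E ≠ 0 → -s * (E / D) * Ω * (D / E) = -s * Ω :=
        fun D E hD hE => by field_simp
      rw [hP, e _ _ h1 hθm.ne']
    rw [← h2, hv']
    field_simp
    ring
  set a₁ := 3 * (s * Cc) + s * (2 * B) + s * Cc with ha₁
  set a₂ := 6 * (s * Cc) + s * (η - Ω) + s * (2 * B) + 3 * (s * Cc) + P * (α / (θ - 1)) with ha₂
  have hX : ∀ᶠ k : ℕ in atTop, X k ≤ (δ / 2) * θ ^ k + (a₁ + s * Cc) * k + a₂ := by
    have hceil : Tendsto (fun k : ℕ => ⌈θ ^ k⌉₊) atTop atTop :=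
      tendsto_nat_ceil_atTop.comp (tendsto_pow_atTop_atTop_of_one_lt hθ1)
    filter_upwards [hceil.eventually (hΩ η hη0)] with k hk
    set M := ⌈θ ^ k⌉₊ with hM
    have hM1 : θ ^ k ≤ M := Nat.le_ceil _
    have hM2 : (M : ℝ) ≤ θ ^ k + 1 := (Nat.ceil_lt_add_one (by positivity)).le
    have h1 := h.log_targetWord_le t (v := v) hθ1 M k
    have hcomp : ∀ (m g : ℕ), v * θ ^ (m + 1) - 1 ≤ g →
        Real.log (ψ (firstDigits t g)) ≤
          Real.log (ψ (firstDigits t (l m))) + (τ * θ ^ (m + 1) + 2) * B + Cc := by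
      intro m g hg
      refine h.log_firstDigits_le t (by positivity) ?_
      have := hl2 m
      rw [hv'] at this
      linarith
    have h2 : ∑ j ∈ Finset.range k, Real.log (ψ (firstDigits t ⌊v * M / θ ^ j⌋₊)) ≤
        ∑ m ∈ Finset.range k,
          (Real.log (ψ (firstDigits t (l m))) + (τ * θ ^ (m + 1) + 2) * B + Cc) := by
      -- The target word for M = ⌈θ^k⌉ indexes its prefixes from the longest, the segments from the
      -- shortest. After reflection, index m has length about vθ^{m+1} on both sides, and the last
      -- prefix ⌊θvM⌋ matches block k.
      rw [← Finset.sum_range_reflect]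
      refine Finset.sum_le_sum fun m hm => hcomp m _ ?_
      have hmk := Finset.mem_range.1 hm
      have h3 := (Nat.lt_floor_add_one (v * M / θ ^ (k - 1 - m))).le
      have h4 : v * θ ^ (m + 1) ≤ v * M / θ ^ (k - 1 - m) := by
        rw [le_div_iff₀ (by positivity), mul_assoc, ← pow_add,
          show m + 1 + (k - 1 - m) = k by omega]
        exact mul_le_mul_of_nonneg_left hM1 hv0.le
      linarith
    have h3 : Real.log (ψ (firstDigits t ⌊θ * v * M⌋₊)) ≤
        Real.log (ψ (firstDigits t (l k))) + (τ * θ ^ (k + 1) + 2) * B + Cc := by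
      refine hcomp k _ ?_
      have h4 := (Nat.lt_floor_add_one (θ * v * M)).le
      have h5 : v * θ ^ (k + 1) ≤ θ * v * M := by
        rw [pow_succ]
        have := mul_le_mul_of_nonneg_left hM1 (mul_pos hθ0 hv0).le
        linarith
      linarith
    have h4 : (Ω - η) * M ≤ ∑ m ∈ Finset.range (k + 1),
        (Real.log (ψ (firstDigits t (l m))) + (τ * θ ^ (m + 1) + 2) * B + Cc) := by
      rw [Finset.sum_range_succ]
      linarith
    have h5 : ∑ m ∈ Finset.range (k + 1),
        (Real.log (ψ (firstDigits t (l m))) + (τ * θ ^ (m + 1) + 2) * B + Cc) =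
        ∑ m ∈ Finset.range (k + 1), Real.log (ψ (firstDigits t (l m))) +
          τ * B * θ * ((θ ^ (k + 1) - 1) / (θ - 1)) + (k + 1) * (2 * B + Cc) := by
      rw [← sum_pow_range hθ1, Finset.mul_sum, ← Finset.sum_add_distrib]
      have : ((k : ℝ) + 1) * (2 * B + Cc) = ∑ m ∈ Finset.range (k + 1), (2 * B + Cc) := by
        rw [Finset.sum_const, Finset.card_range, nsmul_eq_mul]; push_cast; ring
      rw [this, ← Finset.sum_add_distrib]
      exact Finset.sum_congr rfl fun m _ => by ring
    rw [h5] at h4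
    have h6 : P * (α * ((θ ^ (k + 1) - 1) / (θ - 1))) ≤
        P * ∑ m ∈ Finset.range (k + 1), (n m : ℝ) := by
      refine mul_le_mul_of_nonneg_left ?_ hP0
      rw [← sum_pow_range hθ1, Finset.mul_sum]
      exact Finset.sum_le_sum fun m _ => hn1 m
    have h7 : P * (α * ((θ ^ (k + 1) - 1) / (θ - 1))) =
        (-s * Ω - P * τ * (θ / (θ - 1))) * θ ^ k - P * (α / (θ - 1)) := by
      rw [← hPκ, hα, pow_succ]
      field_simp
    have h8 : s * (η - Ω) * M ≤ s * (η - Ω) * (θ ^ k + 1) :=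
      mul_le_mul_of_nonneg_left hM2 (mul_nonneg hs (by linarith))
    have h9 : s * (τ * B * θ * ((θ ^ (k + 1) - 1) / (θ - 1))) ≤
        τ * (s * B * (θ ^ 2 / (θ - 1))) * θ ^ k := by
      have e : τ * (s * B * (θ ^ 2 / (θ - 1))) * θ ^ k -
          s * (τ * B * θ * ((θ ^ (k + 1) - 1) / (θ - 1))) = s * τ * B * θ / (θ - 1) := by
        rw [pow_succ]; field_simp; ring
      have : 0 ≤ s * τ * B * θ / (θ - 1) := by positivity
      linarith
    have h10 := mul_le_mul_of_nonneg_left h4 hs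
    have h11 : X k = (3 * k + 6) * (s * Cc) +
        (-s * ∑ m ∈ Finset.range (k + 1), Real.log (ψ (firstDigits t (l m))) -
          P * ∑ m ∈ Finset.range (k + 1), (n m : ℝ)) := by
      simp only [X]
      rw [Finset.sum_sub_distrib, Finset.mul_sum, Finset.mul_sum]
    have h12 : (s * η + τ * K) * θ ^ k ≤ (δ / 2) * θ ^ k :=
      mul_le_mul_of_nonneg_right (by linarith) (by positivity)
    have hkCc : 0 ≤ s * Cc * k := by positivity
    have hsCc : 0 ≤ s * Cc := by positivity
    rw [hK] at h12
    rw [h11, ha₁, ha₂]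
    linarith
  have hlin : ∀ᶠ k : ℕ in atTop, (a₁ + s * Cc) * k ≤ (δ / 2) * θ ^ k := by
    have h1 : Tendsto (fun k : ℕ => (a₁ + s * Cc) * ((k : ℝ) ^ 1 / θ ^ k)) atTop
        (𝓝 ((a₁ + s * Cc) * 0)) := (tendsto_pow_const_div_const_pow_of_one_lt 1 hθ1).const_mul _
    rw [mul_zero] at h1
    filter_upwards [h1.eventually_le_const (half_pos hδ)] with k hk
    rwa [pow_one, ← mul_div_assoc, div_le_iff₀ (by positivity)] at hk
  -- The cost is controlled only for large k. An eventually bounded sequence is bounded above, and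
  -- that bound is the constant C.
  have hbdd : BddAbove (range fun k : ℕ => X k - δ * (segmentStart n l k + n k : ℕ)) := by
    have : IsBoundedUnder (· ≤ ·) atTop
        fun k : ℕ => X k - δ * (segmentStart n l k + n k : ℕ) := by
      refine ⟨a₂ + δ * ((α + v' * θ) / (θ - 1)), ?_⟩
      rw [eventually_map]
      filter_upwards [hX, hlin] with k h1 h2
      have h3 := mul_le_mul_of_nonneg_left (hpos1 k) hδ.le
      linarith
    exact this.bddAbove_range
  obtain ⟨C, hC⟩ := hbdd
  refine ⟨v', by linarith, n, l, C, fun m => Nat.one_le_ceil_iff.2 (by positivity), fun k => ?_,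
    hl1, hpos2⟩
  have := hC (mem_range_self k)
  simp only [X] at this
  linarith

end IsAlmostMultiplicative

/-- Sequences whose blocks grow geometrically are eventually always hitting. -/
theorem range_segmentSeq_subset_hittingSet [NeZero S] {t : ℕ → Fin S} {a : ℕ → ℕ} {v v' θ : ℝ}
    (hv : 0 < v) (hθ : 1 < θ) (hv' : v < v')
    (ha : Tendsto (fun n : ℕ => (a n : ℝ) / n) atTop (𝓝 v))
    {n l : ℕ → ℕ} (hn : ∀ m, 1 ≤ n m) (hl : ∀ k, v' * θ ^ (k + 1) ≤ l k)
    (hpos : ∀ k, ((segmentStart n l k + n k : ℕ) : ℝ) ≤ θ ^ k + 2 * (k + 1)) :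
    range (segmentSeq t n l) ⊆ hittingSet a t := by
  rintro _ ⟨x, rfl⟩
  rw [mem_hittingSet]
  obtain ⟨v₁, hv₁, hv₁'⟩ := exists_between hv'
  have ha₁ : ∀ᶠ i : ℕ in atTop, (a i : ℝ) ≤ v₁ * i := by
    filter_upwards [ha.eventually_le_const hv₁, eventually_gt_atTop 0] with i hi hi0
    rwa [div_le_iff₀ (by exact_mod_cast hi0)] at hi
  have hlen : ∀ᶠ k : ℕ in atTop, v₁ * (θ ^ k + 2 * (k + 1)) ≤ v' * θ ^ k := by
    have h1 : Tendsto (fun k : ℕ => v₁ * (1 + 2 * ((k : ℝ) ^ 1 / θ ^ k + (θ⁻¹) ^ k))) atTop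
        (𝓝 (v₁ * (1 + 2 * (0 + 0)))) :=
      ((((tendsto_pow_const_div_const_pow_of_one_lt 1 hθ).add
        (tendsto_pow_atTop_nhds_zero_of_lt_one (inv_nonneg.2 (by linarith : (0 : ℝ) ≤ θ))
          (inv_lt_one_of_one_lt₀ hθ))).const_mul 2).const_add 1).const_mul v₁
    filter_upwards [h1.eventually_le_const (by linarith : v₁ * (1 + 2 * (0 + 0)) < v')] with k hk
    have hp : 0 < θ ^ k := by positivity
    have h2 := mul_le_mul_of_nonneg_right hk hp.le
    have h3 : v₁ * (1 + 2 * ((k : ℝ) ^ 1 / θ ^ k + (θ⁻¹) ^ k)) * θ ^ k =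
        v₁ * (θ ^ k + 2 * (k + 1)) := by
      rw [inv_pow]; field_simp
    linarith
  obtain ⟨N₁, hN₁⟩ := eventually_atTop.1 ha₁
  obtain ⟨K, hK⟩ := eventually_atTop.1 hlen
  -- Start of the k-th planted prefix. It serves every target i in [q k, q (k+1)), because l k ≥
  -- v'θ^{k+1} exceeds a i for all such i once k is large.
  let q : ℕ → ℕ := fun k => segmentStart n l k + n k
  have hqmono : Monotone q := monotone_nat_of_le_succ fun k => by
    simp only [q, segmentStart_succ]; omega
  have hqge : ∀ k, k ≤ q k := fun k => (le_segmentStart hn k).trans (Nat.le_add_right _ _)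
  refine ⟨max N₁ (q K), fun i hi => ?_⟩
  have hiK : q K ≤ i := (le_max_right _ _).trans hi
  obtain ⟨k, hKk, hk1, hk2⟩ : ∃ k ≥ K, q k ≤ i ∧ i < q (k + 1) := by
    have hex : ∃ k, i < q k := ⟨i + 1, by have := hqge (i + 1); omega⟩
    classical
    have hf := Nat.find_spec hex
    have h0 : K < Nat.find hex := by
      by_contra! hle
      have := hqmono hle
      omega
    obtain ⟨k, hk⟩ := Nat.exists_eq_succ_of_ne_zero (by omega : Nat.find hex ≠ 0)
    exact ⟨k, by omega, not_lt.1 (Nat.find_min hex (by omega)), by rw [hk] at hf; exact hf⟩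
  refine ⟨q k, hk1, (occursAt_segmentSeq hn x k).mono ?_⟩
  have h1 := hN₁ i ((le_max_left _ _).trans hi)
  have h2 : (i : ℝ) ≤ θ ^ (k + 1) + 2 * ((k + 1 : ℕ) + 1) :=
    le_trans (by exact_mod_cast hk2.le) (hpos (k + 1))
  have h3 := hK (k + 1) (by omega)
  have h4 : (a i : ℝ) ≤ l k := by
    have := mul_le_mul_of_nonneg_left h2 (by linarith : (0 : ℝ) ≤ v₁)
    linarith [hl k]
  exact_mod_cast h4

namespace ConformalIFS

variable {d : ℕ} {F : ConformalIFS d S} [Nontrivial (EuclideanSpace ℝ (Fin d))]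

/-- The lower bound for the dimension. -/
theorem le_dimH_coding_hittingSet [NeZero S] (hF : F.OpenSetCondition) (t : ℕ → Fin S)
    {a : ℕ → ℕ} {v : ℝ} (hv : v ∈ Ioo (0 : ℝ) 1)
    (ha : Tendsto (fun n : ℕ => (a n : ℝ) / n) atTop (𝓝 v)) {s θ Ω : ℝ} (hs : 0 ≤ s)
    (hθ : 1 / (1 - v) < θ)
    (hP : wordPressure F.derivNorm s = -s * ((θ - 1) / (θ - θ * v - 1)) * Ω) (hΩ0 : Ω ≤ 0)
    (hΩ : ∀ η > 0, ∀ᶠ M : ℕ in atTop,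
      (Ω - η) * M ≤ Real.log (F.derivNorm (targetWord t θ v M))) :
    ENNReal.ofReal s ≤ dimH (F.coding '' hittingSet a t) := by
  obtain ⟨c, b, r, h⟩ := F.exists_isAlmostMultiplicative
  have hcrit : 1 < θ * (1 - v) := by
    rwa [div_lt_iff₀ (by linarith [hv.2])] at hθ
  have hθ1 : 1 < θ := by nlinarith [hv.1, hv.2]
  have hP0 : 0 ≤ wordPressure F.derivNorm s := by
    rw [hP, neg_mul, neg_mul]
    have h1 : 0 ≤ (θ - 1) / (θ - θ * v - 1) := div_nonneg (by linarith) (by linarith)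
    have := mul_nonpos_of_nonneg_of_nonpos (mul_nonneg hs h1) hΩ0
    linarith
  have key : ∀ η : ℝ, 0 < η → η < s →
      ENNReal.ofReal (s - η) ≤ dimH (F.coding '' hittingSet a t) := by
    intro η hη hηs
    have hδ : 0 < η * (-Real.log r) := mul_pos hη (by linarith [h.log_r_neg])
    obtain ⟨v', hv', n, l, C, hn, hC, hl, hpos⟩ :=
      h.exists_segments t hs hv hθ hP0 hP hΩ0 hΩ hδ
    have h1 := le_dimH_coding_range_segmentSeq (η := ⟨η, hη.le⟩) (s := s)
      (C := max C (3 * (s * (-Real.log c)))) hF t h hn hP0 hη hηs (le_max_right _ _)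
      (fun k => (hC k).trans (add_le_add_left (le_max_left _ _) _))
    exact h1.trans (dimH_mono (image_mono
      (range_segmentSeq_subset_hittingSet hv.1 hθ1 hv' ha hn hl hpos)))
  rcases hs.eq_or_lt with rfl | hs0
  · simp
  have hlim : Tendsto (fun η : ℝ => ENNReal.ofReal (s - η)) (𝓝[>] 0) (𝓝 (ENNReal.ofReal (s - 0))) :=
    (ENNReal.continuous_ofReal.comp (continuous_const.sub continuous_id)).continuousAt.mono_left
      nhdsWithin_le_nhds
  rw [sub_zero] at hlim
  refine le_of_tendsto hlim ?_
  filter_upwards [Ioo_mem_nhdsGT hs0] with η hη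
  exact key η hη.1 hη.2

end ConformalIFS

end

/-! ### Bounds for the rates Ω⁺ and Ω⁻. -/

namespace ConformalIFS

variable {d S : ℕ} {F : ConformalIFS d S}

section Rate

variable {c b r : ℝ} (h : IsAlmostMultiplicative F.derivNorm c b r) (t : ℕ → Fin S) {v θ : ℝ}
include h

theorem log_derivNorm_targetWord_le (hθ : 1 < θ) (M : ℕ) :
    Real.log (F.derivNorm (targetWord t θ v M)) ≤ (θ * v * M - 1) * Real.log r := by
  have h1 := h.log_targetWord_le t (v := v) hθ M 0
  rw [Finset.range_zero, Finset.sum_empty, zero_add] at h1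
  exact h1.trans (h.log_firstDigits_floor_le t _)

/-- The word has at most θvM + vMθ/(θ-1) digits, and each contributes at least log b; log c is paid
only twice. -/
theorem le_log_derivNorm_targetWord (hv : 0 ≤ v) (hθ : 1 < θ) (M : ℕ) :
    (θ * v + v * (θ / (θ - 1))) * Real.log b * M + 2 * Real.log c ≤
      Real.log (F.derivNorm (targetWord t θ v M)) := by
  have h1 := h.le_log_targetWord t hθ hv M 0
  rw [Finset.range_zero, Finset.sum_empty, zero_add, pow_zero, div_one, Nat.cast_zero,
    zero_add] at h1
  have h2 := h.le_log (firstDigits t ⌊θ * v * M⌋₊)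
  rw [length_firstDigits] at h2
  have h3 : θ * v * M * Real.log b ≤ ⌊θ * v * M⌋₊ * Real.log b :=
    mul_le_mul_of_nonpos_right (Nat.floor_le (by positivity)) h.log_b_neg.le
  linarith

theorem abs_targetRate_le (hv : 0 ≤ v) (hθ : 1 < θ) (M : ℕ) : |F.targetRate t θ v M| ≤
    (θ * v + v * (θ / (θ - 1))) * (-Real.log b) + 2 * (-Real.log c) := by
  have hb := h.log_b_neg
  have hc := h.log_c_nonpos
  have hθ1 : 0 < θ - 1 := by linarith
  have hC : 0 ≤ (θ * v + v * (θ / (θ - 1))) * (-Real.log b) :=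
    mul_nonneg (by positivity) (by linarith)
  rcases Nat.eq_zero_or_pos M with rfl | hM
  · simp only [targetRate, Nat.cast_zero, div_zero, abs_zero]
    linarith
  have hM1 : (1 : ℝ) ≤ M := by exact_mod_cast hM
  have h1 := le_log_derivNorm_targetWord h t hv hθ M
  have h2 := h.log_nonpos (targetWord t θ v M)
  rw [targetRate, abs_div, abs_of_nonpos h2, abs_of_nonneg (by positivity : (0 : ℝ) ≤ M),
    div_le_iff₀ (by linarith)]
  nlinarith

theorem isBoundedUnder_targetRate (hv : 0 ≤ v) (hθ : 1 < θ) :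
    IsBoundedUnder (· ≤ ·) atTop (F.targetRate t θ v) ∧
      IsBoundedUnder (· ≥ ·) atTop (F.targetRate t θ v) :=
  ⟨⟨_, eventually_map.2 (Eventually.of_forall fun M =>
    (abs_le.1 (abs_targetRate_le h t hv hθ M)).2)⟩,
   ⟨_, eventually_map.2 (Eventually.of_forall fun M =>
    (abs_le.1 (abs_targetRate_le h t hv hθ M)).1)⟩⟩

/-- The last prefix, of length about θvM, already gives this contraction. The factor θ is what
forces dimension 0 as v tends to 1. -/
theorem omegaSup_le (hv : 0 ≤ v) (hθ : 1 < θ) :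
    F.omegaSup t θ v ≤ θ * v * Real.log r := by
  have hlim : Tendsto (fun M : ℕ => θ * v * Real.log r - Real.log r * (1 / (M : ℝ))) atTop
      (𝓝 (θ * v * Real.log r - Real.log r * 0)) :=
    (tendsto_one_div_atTop_nhds_zero_nat.const_mul _).const_sub _
  rw [mul_zero, sub_zero] at hlim
  rw [← hlim.limsup_eq]
  refine limsup_le_limsup ?_ (isBoundedUnder_targetRate h t hv hθ).2.isCoboundedUnder_le
    hlim.isBoundedUnder_le
  filter_upwards [eventually_gt_atTop 0] with M hM
  have hM' : (0 : ℝ) < M := by exact_mod_cast hM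
  rw [targetRate, div_le_iff₀ hM']
  refine (log_derivNorm_targetWord_le h t hθ M).trans (le_of_eq ?_)
  field_simp

theorem le_omegaInf (hv : 0 ≤ v) (hθ : 1 < θ) :
    (θ * v + v * (θ / (θ - 1))) * Real.log b ≤ F.omegaInf t θ v := by
  have hlim : Tendsto (fun M : ℕ => (θ * v + v * (θ / (θ - 1))) * Real.log b +
      2 * Real.log c * (1 / (M : ℝ))) atTop
      (𝓝 ((θ * v + v * (θ / (θ - 1))) * Real.log b + 2 * Real.log c * 0)) :=
    (tendsto_one_div_atTop_nhds_zero_nat.const_mul _).const_add _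
  rw [mul_zero, add_zero] at hlim
  rw [← hlim.liminf_eq]
  refine liminf_le_liminf ?_ hlim.isBoundedUnder_ge
    (isBoundedUnder_targetRate h t hv hθ).1.isCoboundedUnder_ge
  filter_upwards [eventually_gt_atTop 0] with M hM
  have hM' : (0 : ℝ) < M := by exact_mod_cast hM
  rw [targetRate, le_div_iff₀ hM']
  refine le_trans (le_of_eq ?_) (le_log_derivNorm_targetWord h t hv hθ M)
  rw [add_mul, mul_assoc (2 * Real.log c), one_div_mul_cancel hM'.ne', mul_one]

theorem omegaInf_le_omegaSup (hv : 0 ≤ v) (hθ : 1 < θ) :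
    F.omegaInf t θ v ≤ F.omegaSup t θ v :=
  liminf_le_limsup (isBoundedUnder_targetRate h t hv hθ).1 (isBoundedUnder_targetRate h t hv hθ).2

theorem omegaSup_nonpos (hv : 0 ≤ v) (hθ : 1 < θ) : F.omegaSup t θ v ≤ 0 :=
  (omegaSup_le h t hv hθ).trans
    (mul_nonpos_of_nonneg_of_nonpos (by positivity) h.log_r_neg.le)

theorem omegaInf_nonpos (hv : 0 ≤ v) (hθ : 1 < θ) : F.omegaInf t θ v ≤ 0 :=
  (omegaInf_le_omegaSup h t hv hθ).trans (omegaSup_nonpos h t hv hθ)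

theorem eventually_log_le (hv : 0 ≤ v) (hθ : 1 < θ) {η : ℝ} (hη : 0 < η) :
    ∀ᶠ M : ℕ in atTop,
      Real.log (F.derivNorm (targetWord t θ v M)) ≤ (F.omegaSup t θ v + η) * M := by
  have := eventually_lt_of_limsup_lt (b := F.omegaSup t θ v + η)
    (show limsup (F.targetRate t θ v) atTop < _ by rw [← omegaSup]; linarith)
    (isBoundedUnder_targetRate h t hv hθ).1
  filter_upwards [this, eventually_gt_atTop 0] with M hM hM0
  rw [targetRate, div_lt_iff₀ (by exact_mod_cast hM0)] at hM
  exact hM.le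

theorem eventually_le_log (hv : 0 ≤ v) (hθ : 1 < θ) {η : ℝ} (hη : 0 < η) :
    ∀ᶠ M : ℕ in atTop,
      (F.omegaInf t θ v - η) * M ≤ Real.log (F.derivNorm (targetWord t θ v M)) := by
  have := eventually_lt_of_lt_liminf (b := F.omegaInf t θ v - η)
    (show _ < liminf (F.targetRate t θ v) atTop by rw [← omegaInf]; linarith)
    (isBoundedUnder_targetRate h t hv hθ).2
  filter_upwards [this, eventually_gt_atTop 0] with M hM hM0
  rw [targetRate, lt_div_iff₀ (by exact_mod_cast hM0)] at hM
  exact hM.le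

theorem existsUnique_isPressureSolution [NeZero S] {Ω : ℝ} (hθ : 1 < θ)
    (hκ : 0 < θ - θ * v - 1) (hΩ : Ω ≤ 0) : ∃! s : ℝ, F.IsPressureSolution θ v Ω s :=
  h.existsUnique_pressure_eq (div_nonneg (by linarith) hκ.le) hΩ

theorem isPressureSolution_pressureSolution [NeZero S] {Ω : ℝ} (hθ : 1 < θ)
    (hκ : 0 < θ - θ * v - 1) (hΩ : Ω ≤ 0) :
    F.IsPressureSolution θ v Ω (F.pressureSolution θ v Ω) :=
  Classical.epsilon_spec (existsUnique_isPressureSolution h hθ hκ hΩ).exists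

end Rate

/-! ### From pressure solutions to dimensions, and the boundary rates. -/

theorem one_lt_of_critical {v θ : ℝ} (hv : v ∈ Ioo (0 : ℝ) 1) (hθ : 1 / (1 - v) < θ) :
    1 < θ ∧ 0 < θ - θ * v - 1 := by
  obtain ⟨hv0, hv1⟩ := hv
  rw [div_lt_iff₀ (by linarith)] at hθ
  constructor <;> nlinarith

theorem dimH_coding_le_attractor (X : Set (ℕ → Fin S)) :
    dimH (F.coding '' X) ≤ dimH F.attractor := by
  refine dimH_mono ?_
  rintro _ ⟨e, -, rfl⟩
  exact F.coding_mem_attractor e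

variable [Nontrivial (EuclideanSpace ℝ (Fin d))] [NeZero S]

/-- Above the supremum s₀ the cost must be negative uniformly in θ. Raising s to s₀ + ε lowers it by
at least ε(-Ω⁺), and Ω⁺ ≤ θv log r ≤ v log r for every θ, whence the gap g = εv(-log r). The value Q
is the pressure cut off at 0, since the cover estimates require Q ≥ 0. -/
theorem dimH_coding_le_iSup {t : ℕ → Fin S} (ht : t ∈ admissibleTargets S) {a : ℕ → ℕ} {v : ℝ}
    (hv : v ∈ Ioo (0 : ℝ) 1) (ha : Tendsto (fun n : ℕ => (a n : ℝ) / n) atTop (𝓝 v)) :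
    dimH (F.coding '' hittingSet a t) ≤ ⨆ θ ∈ Ioi (1 / (1 - v)),
      ENNReal.ofReal (F.pressureSolution θ v (F.omegaSup t θ v)) := by
  obtain ⟨c, b, r, h⟩ := F.exists_isAlmostMultiplicative
  have hr := h.log_r_neg
  set s₀ := ⨆ θ ∈ Ioi (1 / (1 - v)),
      ENNReal.ofReal (F.pressureSolution θ v (F.omegaSup t θ v)) with hs₀
  refine ENNReal.le_of_forall_pos_le_add fun ε hε htop => ?_
  have hε' : (0 : ℝ) < ε := hε
  have hv0 := hv.1
  set s : ℝ≥0 := s₀.toNNReal + ε with hs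
  have hs_eq : (s : ℝ≥0∞) = s₀ + ε := by
    rw [hs, ENNReal.coe_add, ENNReal.coe_toNNReal htop.ne]
  rw [← hs_eq]
  have hs_real : (s : ℝ) = s₀.toReal + ε := by rw [hs]; rfl
  have hs₀0 : 0 ≤ s₀.toReal := ENNReal.toReal_nonneg
  have hs' : 0 < s := by
    have : (0 : ℝ) < s := by linarith
    exact this
  refine F.dimH_coding_hittingSet_le ht hv ha hs' (le_max_right (wordPressure F.derivNorm s) 0)
    (le_max_left _ _) (fun θ => F.omegaSup t θ v)
    (fun θ hθ η hη => eventually_log_le h t hv.1.le (one_lt_of_critical hv hθ).1 hη)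
    (g := ε * (v * (-Real.log r))) (mul_pos hε' (mul_pos hv.1 (by linarith))) fun θ hθ => ?_
  obtain ⟨hθ1, hκ⟩ := one_lt_of_critical hv hθ
  have hΩ := omegaSup_le h t hv.1.le hθ1
  have hΩ0 := omegaSup_nonpos h t hv.1.le hθ1
  set Ω := F.omegaSup t θ v with hΩdef
  set σ := F.pressureSolution θ v Ω with hσ
  obtain ⟨hσ0, hσP⟩ : 0 ≤ σ ∧ wordPressure F.derivNorm σ = -σ * ((θ - 1) / (θ - θ * v - 1)) * Ω :=
    isPressureSolution_pressureSolution h hθ1 hκ hΩ0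
  have hσs : σ ≤ s₀.toReal := by
    have h1 : ENNReal.ofReal σ ≤ s₀ := le_iSup₂ (f := fun θ (_ : θ ∈ Ioi (1 / (1 - v))) =>
      ENNReal.ofReal (F.pressureSolution θ v (F.omegaSup t θ v))) θ hθ
    have h2 := ENNReal.toReal_mono htop.ne h1
    rwa [ENNReal.toReal_ofReal hσ0] at h2
  have hΩv : Ω ≤ v * Real.log r := by
    have : θ * (v * Real.log r) ≤ 1 * (v * Real.log r) :=
      mul_le_mul_of_nonpos_right hθ1.le (mul_neg_of_pos_of_neg hv.1 hr).le
    linarith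
  have hinv : 0 < (θ - θ * v - 1) / (θ - 1) := div_pos hκ (by linarith)
  have h1 := h.wordPressure_le_of_le hσ0 (show σ ≤ s by linarith)
  have h2 : (s - σ) * Real.log r ≤ 0 := mul_nonpos_of_nonneg_of_nonpos (by linarith) hr.le
  have h3 : wordPressure F.derivNorm σ * ((θ - θ * v - 1) / (θ - 1)) = -σ * Ω := by
    have e : ∀ D E : ℝ, D ≠ 0 → E ≠ 0 → -σ * (E / D) * Ω * (D / E) = -σ * Ω :=
      fun D E hD hE => by field_simp
    rw [hσP, e _ _ hκ.ne' (by linarith)]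
  have h4 : max (wordPressure F.derivNorm s) 0 * ((θ - θ * v - 1) / (θ - 1)) ≤ -σ * Ω := by
    rw [← h3]
    refine mul_le_mul_of_nonneg_right (max_le (by linarith) ?_) hinv.le
    refine nonneg_of_mul_nonneg_left ?_ hinv
    rw [h3]
    have := mul_nonpos_of_nonneg_of_nonpos hσ0 hΩ0
    linarith
  have h5 : (s - σ) * Ω ≤ ε * Ω := mul_le_mul_of_nonpos_right (by linarith) hΩ0
  have h6 := mul_le_mul_of_nonneg_left hΩv hε'.le
  simp only [ge_iff_le]
  linarith

theorem ofReal_pressureSolution_le (hF : F.OpenSetCondition) (t : ℕ → Fin S) {a : ℕ → ℕ} {v θ : ℝ}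
    (hv : v ∈ Ioo (0 : ℝ) 1) (ha : Tendsto (fun n : ℕ => (a n : ℝ) / n) atTop (𝓝 v))
    (hθ : 1 / (1 - v) < θ) :
    ENNReal.ofReal (F.pressureSolution θ v (F.omegaInf t θ v)) ≤
      dimH (F.coding '' hittingSet a t) := by
  obtain ⟨c, b, r, h⟩ := F.exists_isAlmostMultiplicative
  obtain ⟨hθ1, hκ⟩ := one_lt_of_critical hv hθ
  have hΩ0 := omegaInf_nonpos h t hv.1.le hθ1
  obtain ⟨hσ0, hσP⟩ := isPressureSolution_pressureSolution h hθ1 hκ hΩ0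
  exact le_dimH_coding_hittingSet hF t hv ha hσ0 hθ hσP hΩ0
    fun η hη => eventually_le_log h t hv.1.le hθ1 hη

/-- The zero of the pressure bounds the dimension of the attractor. -/
theorem dimH_attractor_le {s₀ : ℝ} (hs₀ : 0 ≤ s₀) (hP : wordPressure F.derivNorm s₀ = 0) :
    dimH F.attractor ≤ ENNReal.ofReal s₀ := by
  obtain ⟨c, b, r, h⟩ := F.exists_isAlmostMultiplicative
  refine ENNReal.le_of_forall_pos_le_add fun ε hε _ => ?_
  have hε' : (0 : ℝ) < ε := hε
  have hs : (s₀.toNNReal + ε : ℝ≥0) = ENNReal.ofReal s₀ + ε := by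
    rw [ENNReal.coe_add]; rfl
  rw [← hs]
  have hreal : ((s₀.toNNReal + ε : ℝ≥0) : ℝ) = s₀ + ε := by
    rw [NNReal.coe_add, Real.coe_toNNReal _ hs₀]
  have hneg : wordPressure F.derivNorm ((s₀.toNNReal + ε : ℝ≥0) : ℝ) < 0 := by
    rw [hreal]
    have h1 := h.wordPressure_add_le hs₀ hε'.le
    have h2 := mul_neg_of_pos_of_neg hε' h.log_r_neg
    linarith
  have hsub : F.attractor ⊆ F.coding '' univ := fun x hx => by
    obtain ⟨e, he⟩ := F.exists_coding_eq hx
    exact ⟨e, mem_univ _, he⟩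
  refine (dimH_mono hsub).trans (F.dimH_coding_le_of_summable _ (fun M => wordsOfLength S M)
    (fun M w hw => (length_of_mem_wordsOfLength hw).ge) ?_ univ fun e _ =>
      Frequently.of_forall fun M => ⟨_, firstDigits_mem_wordsOfLength e M, ?_⟩)
  · refine Summable.of_nonneg_of_le
      (fun M => Finset.sum_nonneg fun w _ => (Real.rpow_pos_of_pos (h.pos w) _).le)
      (fun M => h.sum_wordsOfLength_le (NNReal.coe_nonneg _) le_rfl M) ?_
    refine Summable.mul_left _ ?_
    simp_rw [Real.exp_nat_mul]
    exact summable_geometric_of_lt_one (Real.exp_pos _).le (Real.exp_lt_one_iff.2 hneg)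
  · rw [length_firstDigits]

/-- The set contains the hitting set for lengths ⌈τn⌉ with any small τ > 0. Taking θ = 2 there, Ω⁻ ≥
4τ log b, so the pressure solution is at least s₀ - Kτ, where s₀ is the zero of P. Since s₀ bounds
the dimension of the attractor from above, letting τ → 0 suffices. -/
theorem dimH_attractor_le_of_rate_zero (hF : F.OpenSetCondition) (t : ℕ → Fin S) {a : ℕ → ℕ}
    (ha : Tendsto (fun n : ℕ => (a n : ℝ) / n) atTop (𝓝 0)) :
    dimH F.attractor ≤ dimH (F.coding '' hittingSet a t) := by
  obtain ⟨c, b, r, h⟩ := F.exists_isAlmostMultiplicative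
  have hr := h.log_r_neg
  have hb := h.log_b_neg
  obtain ⟨s₀, ⟨hs₀, hP₀⟩, -⟩ := h.existsUnique_pressure_eq (κ := 0) (Ω := 0) le_rfl le_rfl
  rw [mul_zero] at hP₀
  refine (dimH_attractor_le hs₀ hP₀).trans ?_
  set K := 8 * s₀ * (-Real.log b) / (-Real.log r) with hK
  have key : ∀ τ ∈ Ioo (0 : ℝ) (1 / 4),
      ENNReal.ofReal (s₀ - K * τ) ≤ dimH (F.coding '' hittingSet a t) := by
    rintro τ ⟨hτ0, hτ1⟩
    have hv : τ ∈ Ioo (0 : ℝ) 1 := ⟨hτ0, by linarith⟩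
    have hθ : 1 / (1 - τ) < 2 := by rw [div_lt_iff₀ (by linarith)]; linarith
    obtain ⟨hθ1, hκ⟩ := one_lt_of_critical hv hθ
    have hbt : Tendsto (fun n : ℕ => ((⌈τ * n⌉₊ : ℕ) : ℝ) / n) atTop (𝓝 τ) :=
      (tendsto_nat_ceil_mul_div_atTop hτ0.le).comp tendsto_natCast_atTop_atTop
    have hsub : hittingSet (fun n : ℕ => ⌈τ * n⌉₊) t ⊆ hittingSet a t := by
      refine hittingSet_mono ?_
      filter_upwards [ha.eventually_le_const hτ0, eventually_gt_atTop 0] with n hn hn0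
      rw [div_le_iff₀ (by exact_mod_cast hn0)] at hn
      exact_mod_cast hn.trans (Nat.le_ceil _)
    refine le_trans (le_trans (ENNReal.ofReal_le_ofReal ?_)
      (ofReal_pressureSolution_le hF t hv hbt hθ)) (dimH_mono (image_mono hsub))
    have hΩ0 := omegaInf_nonpos h t hτ0.le hθ1
    have hΩ := le_omegaInf h t hτ0.le hθ1
    set Ω := F.omegaInf t 2 τ
    obtain ⟨hσ0, hσP⟩ : 0 ≤ F.pressureSolution 2 τ Ω ∧
        wordPressure F.derivNorm (F.pressureSolution 2 τ Ω) = -F.pressureSolution 2 τ Ω *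
          ((2 - 1) / (2 - 2 * τ - 1)) * Ω := isPressureSolution_pressureSolution h hθ1 hκ hΩ0
    set σ := F.pressureSolution 2 τ Ω
    have hK0 : 0 ≤ K := div_nonneg (mul_nonneg (by positivity) (by linarith)) (by linarith)
    rcases le_total s₀ σ with hle | hle
    · nlinarith
    have h1 := h.wordPressure_le_of_le hσ0 hle
    rw [hP₀] at h1
    have h2 : (2 - 1 : ℝ) / (2 - 2 * τ - 1) ≤ 2 := by
      rw [div_le_iff₀ (by linarith)]; linarith
    have h3 : wordPressure F.derivNorm σ ≤ σ * 2 * (-Ω) := by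
      rw [hσP]
      have := mul_le_mul_of_nonneg_left h2 (mul_nonneg hσ0 (by linarith : 0 ≤ -Ω))
      linarith
    have h4 : -Ω ≤ 4 * τ * (-Real.log b) := by
      have : (2 * τ + τ * (2 / (2 - 1))) * Real.log b = 4 * τ * Real.log b := by
        rw [show (2 : ℝ) / (2 - 1) = 2 by norm_num]; ring
      linarith
    have h5 : σ * 2 * (-Ω) ≤ s₀ * 2 * (4 * τ * (-Real.log b)) :=
      mul_le_mul (by linarith) h4 (by linarith) (by positivity)
    have h6 : (s₀ - σ) * (-Real.log r) ≤ K * τ * (-Real.log r) := by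
      have : K * τ * (-Real.log r) = s₀ * 2 * (4 * τ * (-Real.log b)) := by
        have e : ∀ D E : ℝ, E ≠ 0 → 8 * s₀ * D / E * τ * E = s₀ * 2 * (4 * τ * D) :=
          fun D E hE => by field_simp; ring
        rw [hK, e _ _ (by linarith)]
      linarith
    have := le_of_mul_le_mul_right h6 (by linarith)
    linarith
  have hlim : Tendsto (fun τ : ℝ => ENNReal.ofReal (s₀ - K * τ)) (𝓝[>] 0)
      (𝓝 (ENNReal.ofReal (s₀ - K * 0))) :=
    (ENNReal.continuous_ofReal.comp (by fun_prop : Continuous fun τ : ℝ => s₀ - K * τ)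
      ).continuousAt.mono_left nhdsWithin_le_nhds
  rw [mul_zero, sub_zero] at hlim
  refine le_of_tendsto hlim ?_
  filter_upwards [Ioo_mem_nhdsGT (by norm_num : (0 : ℝ) < 1 / 4)] with τ hτ
  exact key τ hτ

/-- The set is contained in the hitting set for lengths ⌊τn⌋ with τ < 1. There θ > 1/(1-τ) makes -Ω⁺
≥ θτ(-log r) large, while the pressure is at most log S, so every solution is at most K(1-τ),
uniformly in θ. -/
theorem dimH_coding_eq_zero_of_rate_one {t : ℕ → Fin S} (ht : t ∈ admissibleTargets S) {a : ℕ → ℕ}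
    (ha : Tendsto (fun n : ℕ => (a n : ℝ) / n) atTop (𝓝 1)) :
    dimH (F.coding '' hittingSet a t) = 0 := by
  obtain ⟨c, b, r, h⟩ := F.exists_isAlmostMultiplicative
  have hr := h.log_r_neg
  have hlogS : 0 ≤ Real.log S := Real.log_natCast_nonneg S
  set K := 2 * Real.log S / (-Real.log r) with hK
  have key : ∀ τ ∈ Ioo (1 / 2 : ℝ) 1,
      dimH (F.coding '' hittingSet a t) ≤ ENNReal.ofReal (K * (1 - τ)) := by
    rintro τ ⟨hτ0, hτ1⟩
    have hv : τ ∈ Ioo (0 : ℝ) 1 := ⟨by linarith, hτ1⟩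
    have hbt : Tendsto (fun n : ℕ => ((⌊τ * n⌋₊ : ℕ) : ℝ) / n) atTop (𝓝 τ) :=
      (tendsto_nat_floor_mul_div_atTop hv.1.le).comp tendsto_natCast_atTop_atTop
    have hsub : hittingSet a t ⊆ hittingSet (fun n : ℕ => ⌊τ * n⌋₊) t := by
      refine hittingSet_mono ?_
      filter_upwards [ha.eventually_const_le hτ1, eventually_gt_atTop 0] with n hn hn0
      rw [le_div_iff₀ (by exact_mod_cast hn0)] at hn
      exact Nat.floor_le_of_le hn
    refine (dimH_mono (image_mono hsub)).trans ((dimH_coding_le_iSup ht hv hbt).trans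
      (iSup₂_le fun θ hθ => ENNReal.ofReal_le_ofReal ?_))
    obtain ⟨hθ1, hκ⟩ := one_lt_of_critical hv hθ
    have hΩ0 := omegaSup_nonpos h t hv.1.le hθ1
    have hΩ := omegaSup_le h t hv.1.le hθ1
    set Ω := F.omegaSup t θ τ
    obtain ⟨hσ0, hσP⟩ : 0 ≤ F.pressureSolution θ τ Ω ∧
        wordPressure F.derivNorm (F.pressureSolution θ τ Ω) = -F.pressureSolution θ τ Ω *
          ((θ - 1) / (θ - θ * τ - 1)) * Ω := isPressureSolution_pressureSolution h hθ1 hκ hΩ0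
    set σ := F.pressureSolution θ τ Ω
    have h1 := h.wordPressure_le_of_le le_rfl hσ0
    rw [h.wordPressure_zero, sub_zero] at h1
    have h2 : 1 ≤ (θ - 1) / (θ - θ * τ - 1) := by
      rw [le_div_iff₀ hκ]; nlinarith [hv.1]
    have h3 : σ * (-Ω) ≤ wordPressure F.derivNorm σ := by
      rw [hσP]
      have := mul_le_mul_of_nonneg_left h2 (mul_nonneg hσ0 (by linarith : 0 ≤ -Ω))
      linarith
    have h4 : 1 < θ * (1 - τ) := by linarith
    have h5 : σ * Real.log r ≤ 0 := mul_nonpos_of_nonneg_of_nonpos hσ0 hr.le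
    have h6 : σ * (θ * τ * (-Real.log r)) ≤ Real.log S := by
      have := mul_le_mul_of_nonneg_left hΩ hσ0
      linarith
    have hρ : 0 < -Real.log r := by linarith
    have h7 : σ * (-Real.log r) ≤ 2 * Real.log S * (1 - τ) := by
      have h8 : σ * (-Real.log r) * (1 / 2) ≤ σ * (-Real.log r) * (θ * (1 - τ) * τ) := by
        refine mul_le_mul_of_nonneg_left ?_ (by positivity)
        nlinarith
      have h9 := mul_le_mul_of_nonneg_right h6 (by linarith : 0 ≤ 1 - τ)
      nlinarith
    rw [hK, div_mul_eq_mul_div, le_div_iff₀ hρ]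
    exact h7
  have hlim : Tendsto (fun τ : ℝ => ENNReal.ofReal (K * (1 - τ))) (𝓝[<] 1)
      (𝓝 (ENNReal.ofReal (K * (1 - 1)))) :=
    (ENNReal.continuous_ofReal.comp (by fun_prop : Continuous fun τ : ℝ => K * (1 - τ))
      ).continuousAt.mono_left nhdsWithin_le_nhds
  rw [sub_self, mul_zero, ENNReal.ofReal_zero] at hlim
  refine le_antisymm (ge_of_tendsto hlim ?_) zero_le
  filter_upwards [Ioo_mem_nhdsLT (by norm_num : (1 / 2 : ℝ) < 1)] with τ hτ
  exact key τ hτ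

theorem dimH_coding_hittingSet_bounds (hF : F.OpenSetCondition) {t : ℕ → Fin S}
    (ht : t ∈ admissibleTargets S) {a : ℕ → ℕ} {v : ℝ} (hv : v ∈ Icc (0 : ℝ) 1)
    (ha : Tendsto (fun n : ℕ => (a n : ℝ) / n) atTop (𝓝 v)) :
    F.lowerBound t v ≤ dimH (F.coding '' hittingSet a t) ∧
      dimH (F.coding '' hittingSet a t) ≤ F.upperBound t v := by
  unfold lowerBound upperBound
  by_cases h0 : v = 0
  · subst h0
    simp only [if_true]
    exact ⟨dimH_attractor_le_of_rate_zero hF t ha, dimH_coding_le_attractor _⟩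
  by_cases h1 : v = 1
  · subst h1
    simp only [if_true, h0, if_false]
    exact ⟨zero_le, (dimH_coding_eq_zero_of_rate_one ht ha).le⟩
  have hv' : v ∈ Ioo (0 : ℝ) 1 :=
    ⟨lt_of_le_of_ne hv.1 (Ne.symm h0), lt_of_le_of_ne hv.2 h1⟩
  simp only [h0, h1, if_false]
  exact ⟨(min_le_left _ _).trans (iSup₂_le fun θ hθ => ofReal_pressureSolution_le hF t hv' ha hθ),
    le_min (dimH_coding_le_iSup ht hv' ha) (dimH_coding_le_attractor _)⟩

end ConformalIFS

theorem theorem1 {d S : ℕ} (F : ConformalIFS d S) (hF : F.OpenSetCondition)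
    (t : ℕ → Fin S) (ht : t ∈ admissibleTargets S) :
    -- the pressure, the quantities `Ω⁺`, `Ω⁻` and the solutions `s⁺`, `s⁻` are well defined
    (∀ s : ℝ, 0 ≤ s → Tendsto (F.pressureSeq s) atTop (𝓝 (F.pressure s))) ∧
    (∀ v ∈ Ioo (0 : ℝ) 1, ∀ θ ∈ Ioi (1 / (1 - v)),
      (∃ C : ℝ, ∀ M : ℕ, |F.targetRate t θ v M| ≤ C) ∧
      (∃! s : ℝ, F.IsPressureSolution θ v (F.omegaSup t θ v) s) ∧
      (∃! s : ℝ, F.IsPressureSolution θ v (F.omegaInf t θ v) s)) ∧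
    -- the case of a finite rate `v ∈ [0, 1]`
    (∀ a : ℕ → ℕ, ∀ v ∈ Icc (0 : ℝ) 1,
      Tendsto (fun n : ℕ => (a n : ℝ) / n) atTop (𝓝 v) →
        F.lowerBound t v ≤ dimH (F.coding '' hittingSet a t) ∧
        dimH (F.coding '' hittingSet a t) ≤ F.upperBound t v ∧
        ((v ∈ Ioo (0 : ℝ) 1 →
            ∀ θ ∈ Ioi (1 / (1 - v)), F.omegaSup t θ v = F.omegaInf t θ v) →
          F.upperBound t v = F.lowerBound t v ∧
          dimH (F.coding '' hittingSet a t) = F.upperBound t v)) ∧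
    -- the case of a finite rate `v > 1`: only the sequences that end in `t` are left
    (∀ a : ℕ → ℕ, ∀ v ∈ Ioi (1 : ℝ),
      Tendsto (fun n : ℕ => (a n : ℝ) / n) atTop (𝓝 v) → hittingSet a t = preOrbit t) ∧
    -- the case of an infinite rate
    (∀ a : ℕ → ℕ, Tendsto (fun n : ℕ => (a n : ℝ) / n) atTop atTop →
      (hittingSet a t).Countable) := by
  have := ConformalIFS.nontrivial_of_openSetCondition hF
  have : NeZero S := ⟨by have := F.two_le; omega⟩
  obtain ⟨c, b, r, h⟩ := F.exists_isAlmostMultiplicative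
  refine ⟨fun s hs => h.tendsto_wordPressure hs, fun v hv θ hθ => ?_, fun a v hv ha => ?_,
    fun a v hv ha => ?_, fun a ha => ?_⟩
  · obtain ⟨hθ1, hκ⟩ := ConformalIFS.one_lt_of_critical hv hθ
    exact ⟨⟨_, ConformalIFS.abs_targetRate_le h t hv.1.le hθ1⟩,
      ConformalIFS.existsUnique_isPressureSolution h hθ1 hκ
        (ConformalIFS.omegaSup_nonpos h t hv.1.le hθ1),
      ConformalIFS.existsUnique_isPressureSolution h hθ1 hκ
        (ConformalIFS.omegaInf_nonpos h t hv.1.le hθ1)⟩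
  · obtain ⟨h1, h2⟩ := ConformalIFS.dimH_coding_hittingSet_bounds hF ht hv ha
    refine ⟨h1, h2, fun hΩ => ?_⟩
    have heq : F.upperBound t v = F.lowerBound t v := by
      unfold ConformalIFS.upperBound ConformalIFS.lowerBound
      by_cases h0 : v = 0
      · simp [h0]
      by_cases h1 : v = 1
      · simp [h1]
      have hv' : v ∈ Ioo (0 : ℝ) 1 :=
        ⟨lt_of_le_of_ne hv.1 (Ne.symm h0), lt_of_le_of_ne hv.2 h1⟩
      simp only [h0, h1, if_false]
      congr 1
      exact iSup_congr fun θ => iSup_congr fun hθ => by rw [hΩ hv' θ hθ]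
    exact ⟨heq, le_antisymm h2 (heq ▸ h1)⟩
  · have hv1 : (1 : ℝ) < v := hv
    obtain ⟨v', h1, h2⟩ := exists_between hv1
    refine (hittingSet_subset_preOrbit ht h1 ?_).antisymm (preOrbit_subset_hittingSet a t)
    filter_upwards [ha.eventually_const_le h2, eventually_gt_atTop 0] with n hn hn0
    rwa [le_div_iff₀ (by exact_mod_cast hn0)] at hn
  · refine (countable_preOrbit t).mono (hittingSet_subset_preOrbit ht (v := 2) one_lt_two ?_)
    filter_upwards [ha.eventually_ge_atTop 2, eventually_gt_atTop 0] with n hn hn0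
    rwa [le_div_iff₀ (by exact_mod_cast hn0)] at hn
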